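/- All trees are finite. A leaf of a tree is a vertex of valence one (the unique vertex of the one-vertex tree is also counted as a leaf), a node is a vertex that is not a leaf, and a tree is reduced if it has no vertex of valence two. For a tree $T$ let $L(T)$ be its set of leaves with the quaternary relation $R(x_1,x_2;y_1,y_2)$: the four leaves are distinct and the path from $x_1$ to $x_2$ shares an edge with the path from $y_1$ to $y_2$. A tree structure is a set with a quaternary relation which is empty or isomorphic to some $L(T)$; let $\mathfrak T$ be the class of tree structures. An embedding is an injection that preserves and reflects the relation. An amalgamation of embeddings $X\to Y$ and $X\to X'$ is a $Y'\in\mathfrak T$ with embeddings $Y\to Y'$, $X'\to Y'$ that agree on $X$ and are jointly surjective. A measure for $\mathfrak T$ with values in a commutative ring $k$ assigns to each embedding $i$ in $\mathfrak T$ an element $\mu(i)\in k$ such that (a) $\mu(i)=1$ if $i$ is an isomorphism; (b) $\mu(j\circ i)=\mu(j)\mu(i)$; (c) for embeddings $i\colon X\to Y$ and $X\to X'$, if $i'_\alpha\colon X'\to Y'_\alpha$ ($1\le\alpha\le n$) are the amalgamations up to isomorphism, then $\mu(i)=\sum_\alpha\mu(i'_\alpha)$. Put $\mu(T)=\mu(\emptyset\to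 L(T))$, and for a leaf $a$ of $T$ put $\mu(T,a)=\mu(L(T)\setminus a\to L(T))$. Let $X_m$ ($m\ge1$) be the tree with $m$ leaves, one of them marked, which for $m\ge3$ has a single node joined to all leaves, and which for $m=1,2$ is the tree with $m$ vertices. Let $Y$ be the tree with two adjacent nodes, each joined to two leaves, one leaf being marked. Let $Z$ be the tree whose nodes form a path $A-B-C$, with two leaves at $A$, one at $B$ and two at $C$, the leaf at $B$ being marked. For $u,v\in k$ with $uv=0$, the measure with parameters $(u,v)$ is the measure $\mu$ with $$\mu(X_1)=u+v+2,\quad \mu(X_2)=u+v+1,\quad \mu(X_3)=u+v,\quad \mu(X_m)=v+1-(m-2)(u+1)\ (m\ge4),\quad \mu(Y)=u,\quad \mu(Z)=u-v,$$ where these symbols denote the values on marked trees. Let $R=\mathbf Z[\tau,(\tau-1)^{-1}]$. **Proposition.** There is a unique measure $\mu_\tau$ for $\mathfrak T$ with values in $R$ and with parameters $v=0$, $u=-\frac{\tau-2}{\tau-1}$ (the primary measure), and for every reduced tree $T$ (with at least one vertex) $$\mu_\tau(T)=\frac{(-1)^{n(T)}\,\tau}{(\tau-1)^{\ell(T)}}\prod_x[\tau]_{v(x)},$$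 where $\ell(T)$ and $n(T)$ are the numbers of leaves and nodes of $T$, the product is over the nodes $x$ of $T$, $v(x)$ is the valence of $x$, and $[\tau]_n=(\tau-n+1)\cdots(\tau-2)$ for $n\ge3$. -/

import Mathlib

open FirstOrder CategoryTheory

noncomputable section

/-! ### Measures on classes of relational structures -/

/-- An amalgamation, inside the class `K`, of `Y` and `X'` over `X`: a structure `Z` in `K` with
embeddings of `Y` and `X'` that agree on `X` and are jointly surjective. -/
structure Amalgam {L : FirstOrder.Language.{0, 0}} {K : Set (Bundled.{0} L.Structure)} {X Y X' : K}
    (i : X.1 ↪[L] Y.1) (j : X.1 ↪[L] X'.1) where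
  Z : K
  inl : Y.1 ↪[L] Z.1
  inr : X'.1 ↪[L] Z.1
  comm : inl.comp i = inr.comp j
  cover : Set.range inl ∪ Set.range inr = Set.univ

/-- Two amalgamations are isomorphic: there is an isomorphism of the underlying structures that
is compatible with the two embeddings. -/
def Amalgam.IsIso {L : FirstOrder.Language.{0, 0}} {K : Set (Bundled.{0} L.Structure)} {X Y X' : K}
    {i : X.1 ↪[L] Y.1} {j : X.1 ↪[L] X'.1} (A B : Amalgam i j) : Prop :=
  ∃ e : A.Z.1 ≃[L] B.Z.1,
    e.toEmbedding.comp A.inl = B.inl ∧ e.toEmbedding.comp A.inr = B.inr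

/-- A measure, with values in the commutative ring `k`, for the class `K` of structures. In
`map_amalgam` the family `A` is a complete list, without repetition, of the amalgamations of
`Y` and `X'` over `X` up to isomorphism. -/
@[ext]
structure FraisseMeasure {L : FirstOrder.Language.{0, 0}} (K : Set (Bundled.{0} L.Structure))
    (k : Type) [CommRing k] where
  toFun : ∀ {X Y : K}, (X.1 ↪[L] Y.1) → k
  map_equiv : ∀ {X Y : K} (e : X.1 ≃[L] Y.1), toFun e.toEmbedding = 1
  map_comp : ∀ {X Y Z : K} (i : X.1 ↪[L] Y.1) (j : Y.1 ↪[L] Z.1),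
    toFun (j.comp i) = toFun j * toFun i
  map_amalgam : ∀ {X Y X' : K} (i : X.1 ↪[L] Y.1) (j : X.1 ↪[L] X'.1)
    (n : ℕ) (A : Fin n → Amalgam i j), (∀ B : Amalgam i j, ∃! α, (A α).IsIso B) →
      toFun i = ∑ α, toFun (A α).inr

/-! ### Trees and tree structures -/

/-- The relation symbols of the language of tree structures: a single one, of arity four. -/
inductive TreeRel : ℕ → Type
  | quartet : TreeRel 4

/-- The language with one quaternary relation symbol. -/
def treeLang : FirstOrder.Language.{0, 0} := ⟨fun _ => Empty, TreeRel⟩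

/-- The set `S` as a `treeLang`-structure, with quaternary relation `R`. -/
def quartetStructure (S : Type) (R : S → S → S → S → Prop) : Bundled.{0} treeLang.Structure :=
  ⟨S, { funMap := fun f _ => f.elim
        RelMap := fun r => match r with
          | TreeRel.quartet => fun x => R (x 0) (x 1) (x 2) (x 3) }⟩

/-- The valence of a vertex (of a finite graph). -/
def valence {V : Type} (G : SimpleGraph V) (v : V) : ℕ := (G.neighborSet v).ncard

/-- A leaf of a tree is a vertex of valence one; the only vertex of the one-vertex tree also
counts as a leaf. The other vertices are the nodes. -/
def IsLeaf {V : Type} (G : SimpleGraph V) (v : V) : Prop := valence G v ≤ 1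

/-- A tree is reduced if it has no vertex of valence two. -/
def IsReducedTree {V : Type} (G : SimpleGraph V) : Prop := ∀ v, valence G v ≠ 2

/-- The quaternary relation on the vertices of a tree: the four vertices are distinct, and the path
from `x₁` to `x₂` (which is unique in a tree) has a common edge with the path from `y₁` to `y₂`. -/
def Quartet {V : Type} (G : SimpleGraph V) (x₁ x₂ y₁ y₂ : V) : Prop :=
  [x₁, x₂, y₁, y₂].Nodup ∧
    ∃ (p : G.Walk x₁ x₂) (q : G.Walk y₁ y₂), p.IsPath ∧ q.IsPath ∧ ∃ e ∈ p.edges, e ∈ q.edges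

/-- The structure `L(T)` on the set of leaves of a tree. -/
def leafStructure {V : Type} (G : SimpleGraph V) : Bundled.{0} treeLang.Structure :=
  quartetStructure {v : V // IsLeaf G v} fun x₁ x₂ y₁ y₂ => Quartet G x₁ x₂ y₁ y₂

/-- The class of tree structures: the structures isomorphic to `L(T)` for a finite tree `T`,
and the empty structure. -/
def treeClass : Set (Bundled.{0} treeLang.Structure) :=
  {S | IsEmpty S ∨ ∃ (V : Type) (_ : Finite V) (G : SimpleGraph V),
    G.IsTree ∧ Nonempty (S ≃[treeLang] leafStructure G)}

/-- The leaf structure of a finite tree, as a member of the class of tree structures. -/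
def treeStructure {V : Type} [Finite V] (G : SimpleGraph V) (hG : G.IsTree) : treeClass :=
  ⟨leafStructure G, Or.inr ⟨V, inferInstance, G, hG, ⟨FirstOrder.Language.Equiv.refl treeLang _⟩⟩⟩

/-- The empty tree structure. -/
def emptyStructure : treeClass :=
  ⟨quartetStructure Empty fun _ _ _ _ => False, Or.inl (inferInstanceAs (IsEmpty Empty))⟩

/-- The embedding of the empty structure into a tree structure. -/
def emptyEmbedding (S : treeClass) : emptyStructure.1 ↪[treeLang] S.1 where
  toFun := fun x => Empty.elim x
  inj' := fun x => Empty.elim x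
  map_fun' := fun f _ => Empty.elim f
  map_rel' := fun {n} r x => by
    cases r
    exact Empty.elim (x 0)

/-- The measure of a tree structure `S` is the measure of the embedding of the empty structure
into `S`. -/
def FraisseMeasure.value {k : Type} [CommRing k] (μ : FraisseMeasure treeClass k)
    (S : treeClass) : k := μ.toFun (emptyEmbedding S)

/-! ### Marked trees and the parameters of a measure -/

/-- `a` is a leaf of `G`, and `f` is isomorphic to the one-point extension `L(G) \ a → L(G)`
defined by the marked tree `(G, a)`. -/
def IsMarkedExtension {X Y : treeClass} (f : X.1 ↪[treeLang] Y.1) {V : Type}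
    (G : SimpleGraph V) (a : V) : Prop :=
  IsLeaf G a ∧ ∃ e : Y.1 ≃[treeLang] leafStructure G,
    ∀ v : {v : V // IsLeaf G v}, (∃ x, e (f x) = v) ↔ v.1 ≠ a

/-- The measure `μ` takes the value `c` on the class of the marked tree `(G, a)`. -/
def FraisseMeasure.MarkedValue {k : Type} [CommRing k] (μ : FraisseMeasure treeClass k)
    {V : Type} (G : SimpleGraph V) (a : V) (c : k) : Prop :=
  ∀ (X Y : treeClass) (f : X.1 ↪[treeLang] Y.1), IsMarkedExtension f G a → μ.toFun f = c

/-- The tree with nodes `0`, `1`, where `0` has the leaves `2`, `3` and `1` has the leaves `4`, `5`.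
The marked tree `Y` is this tree with marked leaf `5`. -/
def treeY : SimpleGraph (Fin 6) :=
  SimpleGraph.fromEdgeSet {s(0, 1), s(0, 2), s(0, 3), s(1, 4), s(1, 5)}

/-- The tree with nodes `0`, `1`, `2` forming a path in this order, where `0` has the leaves
`3`, `4`, the middle node `1` has the leaf `5`, and `2` has the leaves `6`, `7`.
The marked tree `Z` is this tree with marked leaf `5`. -/
def treeZ : SimpleGraph (Fin 8) :=
  SimpleGraph.fromEdgeSet
    {s(0, 1), s(1, 2), s(0, 3), s(0, 4), s(1, 5), s(2, 6), s(2, 7)}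

/-- `μ` is the measure with parameters `(u, v)`: its values on the marked trees `X_m` (the marked
tree with `m` leaves, all joined to a common node if `m ≥ 3`), `Y` and `Z` are the images of
`x_m`, `y` and `z` under the isomorphism `Θ(𝔗) ≅ ℤ[u, v]/(uv)`, specialized at `(u, v)`. -/
structure FraisseMeasure.HasParameters {k : Type} [CommRing k] (μ : FraisseMeasure treeClass k)
    (u v : k) : Prop where
  x_one : μ.MarkedValue (SimpleGraph.starGraph (0 : Fin 1)) 0 (u + v + 2)
  x_two : μ.MarkedValue (SimpleGraph.starGraph (0 : Fin 2)) 1 (u + v + 1)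
  x_three : μ.MarkedValue (SimpleGraph.starGraph (0 : Fin 4)) (Fin.last 3) (u + v)
  x_ge_four : ∀ m : ℕ, 4 ≤ m →
    μ.MarkedValue (SimpleGraph.starGraph (0 : Fin (m + 1))) (Fin.last m)
      (v + 1 - ((m : k) - 2) * (u + 1))
  y : μ.MarkedValue treeY 5 u
  z : μ.MarkedValue treeZ 5 (u - v)

/-! ### The coefficient ring and the formula -/

/-- The ring `ℤ[τ, (τ - 1)⁻¹]`. -/
abbrev TauRing : Type := Localization.Away (Polynomial.X - 1 : Polynomial ℤ)

/-- The element `τ`. -/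
def tau : TauRing := algebraMap (Polynomial ℤ) TauRing Polynomial.X

/-- The element `(τ - 1)⁻¹`. -/
def tauSubOneInv : TauRing := IsLocalization.Away.invSelf (Polynomial.X - 1 : Polynomial ℤ)

theorem tau_sub_one_mul_inv : (tau - 1) * tauSubOneInv = 1 := by
  have h := IsLocalization.Away.mul_invSelf (S := TauRing) (Polynomial.X - 1 : Polynomial ℤ)
  rwa [map_sub, map_one] at h

/-- The variant `(t - n + 1) ⋯ (t - 2)` of the falling factorial, for `n ≥ 3`. -/
def fallingVariant {k : Type} [CommRing k] (t : k) (n : ℕ) : k :=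
  ∏ i ∈ Finset.Icc 3 n, (t - (i : k) + 1)

open scoped Classical in
/-- The finite set of leaves of a tree. -/
def leaves {V : Type} [Fintype V] (G : SimpleGraph V) : Finset V :=
  Finset.univ.filter fun x => IsLeaf G x

open scoped Classical in
/-- The finite set of nodes of a tree. -/
def nodes {V : Type} [Fintype V] (G : SimpleGraph V) : Finset V :=
  Finset.univ.filter fun x => ¬ IsLeaf G x

end

/-!
The proof describes a tree structure by its *splits*, the bipartitions of the set of leaves that are
defined by the edges of the tree. Splits are characterized by the quaternary relation alone
(`IsSplit`), and the relation is recovered from any family of pairwise compatible bipartitions that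
consists of the splits; that such a family contains all splits is Buneman's theorem
(`IsSplitSystem.isSplit_iff`). So the tree structures are exactly the finite treelike relations
(`mem_treeClass_iff`), and all constructions of trees become constructions of compatible families.

*Existence.* Every vertex of a tree contributes a factor depending on its valence, with the factor
`1` for valence two, and `τ` times the product of the factors is the weight of the tree; for reduced
trees it is the expression in the theorem. Deleting a leaf `a` multiplies the weight by a
factor that depends only on the number of branches at `a`, that is the valence of the neighbour of
`a` minus one (`structureWeight_onePoint`). It follows that the weight depends only on the tree
structure, and that the weight of the source of an embedding divides that of the target; the primary
measure is the quotient. The coefficient ring is a domain and weights do not vanish, so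
multiplicativity is clear, and the amalgamation axiom becomes an identity between weights
(`WeightAdditive`). This identity is compatible with composition (`WeightAdditive.comp`), which
reduces it to two one-point extensions of `X`, by `a` and by `b`. Such an extension is given by its
*clusters*, the sides of splits that do not contain the new point. If the clusters of the two
extensions differ, there is a single amalgamation, and it has as many branches at `a` as the first
extension. If they agree, then `a` and `b` may be identified, or be attached at the same place, or
form a cherry, and if `a` has just two branches, then `b` may also be attached to either of them.
The identity then is `w(c) = 1 + w(c + 1) + w(2)` for `c ≥ 3` and `w(2) = 1 + w(3) + 3 w(2)`, where
`w(c)` is the factor for `c` branches; there are degenerate cases when `X` has at most one point.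

*Uniqueness.* By multiplicativity a measure is determined by its values on one-point extensions
`X → Y` by a point `a`, and only the case that `X` has two or more points is not immediate. If `a` has at
least three branches, choose a point in each of them; if it has two, choose in each of them one or
two points that do not lie in a smaller cluster. Let `X₀` consist of the chosen points. Then `Y` is
the only amalgamation of `X₀ ∪ {a}` and `X` over `X₀`, so `X → Y` and `X₀ → X₀ ∪ {a}` have the same
measure (`FraisseMeasure.toFun_eq_of_representatives`, `FraisseMeasure.toFun_eq_of_isSpread`), and
the latter extension is one of the marked trees `X_m`, `Y`, `Z` whose values are the parameters.
-/

open FirstOrder CategoryTheory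

/-! ### Split systems and the quaternary relations they define -/

/-- The set `A` separates `x` from `y`: it contains exactly one of them. -/
def Separates {S : Type} (A : Set S) (x y : S) : Prop := ¬ (x ∈ A ↔ y ∈ A)

/-- Two subsets of `S`, thought of as bipartitions `A | Aᶜ` and `B | Bᶜ`, are compatible if one of
the four intersections of a side of the first with a side of the second is empty. -/
def Compat {S : Type} (A B : Set S) : Prop :=
  ∀ p q r s, p ∈ A → p ∈ B → q ∈ A → q ∉ B → r ∉ A → r ∈ B → s ∉ A → s ∉ B → False

/-- The quaternary relation defined by a family `F` of bipartitions: the four points are distinct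
and some member of `F` separates both `x₁` from `x₂` and `y₁` from `y₂`. -/
def relOf {S : Type} (F : Set (Set S)) (x₁ x₂ y₁ y₂ : S) : Prop :=
  [x₁, x₂, y₁, y₂].Nodup ∧ ∃ A ∈ F, Separates A x₁ x₂ ∧ Separates A y₁ y₂

/-- `A | Aᶜ` is a split of the quaternary relation `R`: both sides are non-empty, and two points of
`A` are always separated from two points of the complement. In a tree these are the bipartitions of
the set of leaves that are defined by the edges. -/
def IsSplit {S : Type} (R : S → S → S → S → Prop) (A : Set S) : Prop :=
  A.Nonempty ∧ Aᶜ.Nonempty ∧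
    ∀ a ∈ A, ∀ a' ∈ A, ∀ b ∉ A, ∀ b' ∉ A, a ≠ a' → b ≠ b' → R a b a' b'

/-- A quaternary relation is treelike if it is defined by pairwise compatible bipartitions. -/
def Treelike {S : Type} (R : S → S → S → S → Prop) : Prop :=
  ∃ F : Set (Set S), (∀ A ∈ F, ∀ B ∈ F, Compat A B) ∧
    ∀ x₁ x₂ y₁ y₂, R x₁ x₂ y₁ y₂ ↔ relOf F x₁ x₂ y₁ y₂

/-- A split system: a family of pairwise compatible proper non-empty subsets that is closed under
complements and contains all the singletons that are proper subsets. -/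
structure IsSplitSystem {S : Type} (F : Set (Set S)) : Prop where
  nonempty : ∀ A ∈ F, A.Nonempty
  compl : ∀ A ∈ F, Aᶜ ∈ F
  singleton : ∀ x y : S, x ≠ y → {x} ∈ F
  compat : ∀ A ∈ F, ∀ B ∈ F, Compat A B

section Splits

variable {S : Type} {R : S → S → S → S → Prop} {F : Set (Set S)} {A B : Set S}

theorem nodup_four {a b c d : S} : [a, b, c, d].Nodup ↔
    a ≠ b ∧ a ≠ c ∧ a ≠ d ∧ b ≠ c ∧ b ≠ d ∧ c ≠ d := by
  simp; tauto

theorem separates_compl {x y : S} : Separates Aᶜ x y ↔ Separates A x y := by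
  simp only [Separates, Set.mem_compl_iff]; tauto

theorem isSplit_relOf_of_mem (hA : A ∈ F) (h1 : A.Nonempty) (h2 : Aᶜ.Nonempty) :
    IsSplit (relOf F) A := by
  refine ⟨h1, h2, fun a ha a' ha' b hb b' hb' haa hbb => ⟨?_, A, hA, ?_, ?_⟩⟩
  · rw [nodup_four]
    refine ⟨?_, haa, ?_, ?_, hbb, ?_⟩ <;> rintro rfl <;> contradiction
  · simp [Separates, ha, hb]
  · simp [Separates, ha', hb']

theorem Treelike.nodup (hR : Treelike R) {a b c d : S} (h : R a b c d) : [a, b, c, d].Nodup := by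
  obtain ⟨F, -, hF⟩ := hR
  exact ((hF _ _ _ _).1 h).1

theorem Treelike.swap (hR : Treelike R) {a b c d : S} (h : R a b c d) : R b a d c := by
  obtain ⟨F, -, hF⟩ := hR
  rw [hF] at h ⊢
  obtain ⟨h1, A, hA, h2, h3⟩ := h
  refine ⟨?_, A, hA, ?_, ?_⟩
  · rw [nodup_four] at h1 ⊢; tauto
  · simp only [Separates] at *; tauto
  · simp only [Separates] at *; tauto

theorem IsSplit.compl (hR : Treelike R) (h : IsSplit R A) : IsSplit R Aᶜ := by
  refine ⟨h.2.1, by simpa using h.1, fun a ha a' ha' b hb b' hb' h1 h2 => ?_⟩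
  simp only [Set.mem_compl_iff, not_not] at *
  exact hR.swap (h.2.2 _ hb _ hb' _ ha _ ha' h2 h1)

theorem isSplit_compl_iff (hR : Treelike R) : IsSplit R Aᶜ ↔ IsSplit R A :=
  ⟨fun h => by simpa using h.compl hR, fun h => h.compl hR⟩

theorem isSplit_singleton {x y : S} (h : x ≠ y) : IsSplit R {x} :=
  ⟨⟨x, rfl⟩, ⟨y, fun e => h e.symm⟩, fun _ ha _ ha' _ _ _ _ h1 => absurd (ha.trans ha'.symm) h1⟩

theorem Compat.cross (h : Compat A B) {x y z w : S} (h1 : x ∈ A ↔ y ∈ A) (h2 : z ∈ A ↔ w ∈ A)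
    (h3 : ¬ (x ∈ A ↔ z ∈ A)) (h4 : x ∈ B ↔ z ∈ B) (h5 : y ∈ B ↔ w ∈ B)
    (h6 : ¬ (x ∈ B ↔ y ∈ B)) : False := by
  by_cases hA : x ∈ A <;> by_cases hB : x ∈ B
  · exact h x y z w (by grind) (by grind) (by grind) (by grind)
      (by grind) (by grind) (by grind) (by grind)
  · exact h y x w z (by grind) (by grind) (by grind) (by grind)
      (by grind) (by grind) (by grind) (by grind)
  · exact h z w x y (by grind) (by grind) (by grind) (by grind)
      (by grind) (by grind) (by grind) (by grind)
  · exact h w z y x (by grind) (by grind) (by grind) (by grind)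
      (by grind) (by grind) (by grind) (by grind)

/-- If two of the three ways to pair off four points are related, then a bipartition of the family
separates the four points into the third pairing. -/
theorem exists_quartet (hF : ∀ A ∈ F, ∀ B ∈ F, Compat A B) {c c' d e : S}
    (h1 : relOf F c d c' e) (h2 : relOf F c e c' d) :
    ∃ B ∈ F, (c ∈ B ↔ c' ∈ B) ∧ (d ∈ B ↔ e ∈ B) ∧ ¬ (c ∈ B ↔ d ∈ B) := by
  obtain ⟨-, A, hA, hA1, hA2⟩ := h1
  obtain ⟨-, B, hB, hB1, hB2⟩ := h2
  simp only [Separates] at *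
  by_cases h : c ∈ A ↔ c' ∈ A
  · exact ⟨A, hA, h, by tauto, hA1⟩
  by_cases h' : c ∈ B ↔ c' ∈ B
  · exact ⟨B, hB, h', by tauto, by tauto⟩
  exact ((hF A hA B hB).cross (x := c) (y := e) (z := d) (w := c') (by tauto) (by tauto) hA1
    (by tauto) (by tauto) hB1).elim

theorem relOf.swap {a b c d : S} (h : relOf F a b c d) : relOf F a b d c := by
  obtain ⟨h1, A, hA, h2, h3⟩ := h
  refine ⟨?_, A, hA, h2, ?_⟩
  · rw [nodup_four] at h1 ⊢; tauto
  · simp only [Separates] at *; tauto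

/-- Of the three ways to pair off four points, at most two are related: two different quartets on
the same four points would give incompatible bipartitions. -/
theorem relOf_not_three (hF : ∀ A ∈ F, ∀ B ∈ F, Compat A B) {p q r s : S}
    (h1 : relOf F p q r s) (h2 : relOf F p r q s) (h3 : relOf F p s q r) : False := by
  obtain ⟨A, hA, a1, a2, a3⟩ := exists_quartet hF h2 h3
  obtain ⟨B, hB, b1, b2, b3⟩ := exists_quartet hF h1 h3.swap
  exact (hF A hA B hB).cross a1 a2 a3 b1 b2 b3

theorem IsSplit.compat (hR : Treelike R) (hA : IsSplit R A) (hB : IsSplit R B) : Compat A B := by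
  intro p q r s h1 h2 h3 h4 h5 h6 h7 h8
  obtain ⟨F, hF, hRF⟩ := hR
  have pq : p ≠ q := by rintro rfl; exact h4 h2
  have pr : p ≠ r := by rintro rfl; exact h5 h1
  have qs : q ≠ s := by rintro rfl; exact h7 h3
  have rs : r ≠ s := by rintro rfl; exact h8 h6
  refine relOf_not_three hF (p := p) (q := q) (r := r) (s := s) ?_ ?_ ?_ <;> rw [← hRF]
  · exact hB.2.2 p h2 r h6 q h4 s h8 pr qs
  · exact hA.2.2 p h1 q h3 r h5 s h7 pq rs
  · have := hA.2.2 p h1 q h3 s h7 r h5 pq rs.symm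
    exact this

theorem Treelike.iff (hR : Treelike R) {a b c d : S} :
    R a b c d ↔ relOf {A | IsSplit R A} a b c d := by
  constructor
  · intro h
    obtain ⟨F, hF, hRF⟩ := hR
    obtain ⟨h1, A, hA, h2, h3⟩ := (hRF _ _ _ _).1 h
    have hs : IsSplit R A := by
      have e : R = relOf F := by funext a b c d; exact propext (hRF a b c d)
      rw [e]
      refine isSplit_relOf_of_mem hA ?_ ?_ <;> by_cases h : a ∈ A <;> simp [Separates, h] at h2
      exacts [⟨_, h⟩, ⟨_, h2⟩, ⟨_, h2⟩, ⟨_, h⟩]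
    exact ⟨h1, A, hs, h2, h3⟩
  · rintro ⟨h1, A, hA, h2, h3⟩
    have main : ∀ a b c d, [a, b, c, d].Nodup → a ∈ A → b ∉ A → Separates A c d → R a b c d := by
      intro a b c d h1 ha hb h
      rw [nodup_four] at h1
      by_cases hc : c ∈ A
      · have hd : d ∉ A := by simpa [Separates, hc] using h
        exact hA.2.2 a ha c hc b hb d hd h1.2.1 h1.2.2.2.2.1
      · have hd : d ∈ A := by simpa [Separates, hc] using h
        have := hA.2.2 a ha d hd b hb c hc h1.2.2.1 h1.2.2.2.1
        obtain ⟨F, hF, hRF⟩ := hR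
        rw [hRF] at this ⊢
        obtain ⟨h3, B, hB, h4, h5⟩ := this
        refine ⟨by rw [nodup_four]; exact h1, B, hB, h4, ?_⟩
        simp only [Separates] at *; tauto
    by_cases ha : a ∈ A
    · have hb : b ∉ A := by simpa [Separates, ha] using h2
      exact main a b c d h1 ha hb h3
    · have hb : b ∈ A := by simpa [Separates, ha] using h2
      refine hR.swap (main b a d c ?_ hb ha ?_)
      · rw [nodup_four] at h1 ⊢; tauto
      · simp only [Separates] at *; tauto

theorem treelike_relOf (hF : ∀ A ∈ F, ∀ B ∈ F, Compat A B) : Treelike (relOf F) :=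
  ⟨F, hF, fun _ _ _ _ => Iff.rfl⟩

theorem IsSplitSystem.treelike (hF : IsSplitSystem F) : Treelike (relOf F) :=
  treelike_relOf hF.compat

/-- Buneman's theorem in the form needed here: a split system contains all the splits of the
relation that it defines. For a split `C`, a maximal member of the system between a point of `C` and
`C` must be `C` itself: otherwise it is enlarged by a minimal member that contains one more point of
`C` but not a given point outside of `C`. -/
theorem IsSplitSystem.isSplit_iff [Finite S] (hF : IsSplitSystem F) {C : Set S} :
    IsSplit (relOf F) C ↔ C ∈ F := by
  constructor
  · rintro ⟨⟨c₁, hc₁⟩, ⟨d, hd⟩, hC⟩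
    -- `A` is the maximal member between `{c₁}` and `C`
    have hcd : c₁ ≠ d := by rintro rfl; exact hd hc₁
    obtain ⟨A, ⟨hA, hAc, hAC⟩, hmax⟩ := (Set.toFinite {A | A ∈ F ∧ c₁ ∈ A ∧ A ⊆ C}).exists_maximal
      ⟨{c₁}, hF.singleton _ _ hcd, rfl, by simpa using hc₁⟩
    by_contra hne
    have : ∃ c₂ ∈ C, c₂ ∉ A := by
      by_contra! h
      exact hne (hAC.antisymm h ▸ hA)
    obtain ⟨c₂, hc₂, hc₂A⟩ := this
    have hcc : c₁ ≠ c₂ := by rintro rfl; exact hc₂A hAc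
    have hcd2 : c₂ ≠ d := by rintro rfl; exact hd hc₂
    obtain ⟨B, ⟨hB, hB1, hB2, hBd⟩, hmin⟩ :=
      (Set.toFinite {B | B ∈ F ∧ c₁ ∈ B ∧ c₂ ∈ B ∧ d ∉ B}).exists_minimal
      ⟨{d}ᶜ, hF.compl _ (hF.singleton _ _ hcd.symm), hcd, hcd2, by simp⟩
    -- a point `e` of `B` outside of `C` could be cut off, as `c₁`, `c₂` and `d`, `e` are separated
    have hBC : B ⊆ C := by
      intro e heB
      by_contra heC
      have hde : d ≠ e := by rintro rfl; exact hBd heB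
      have h1 := hC c₁ hc₁ c₂ hc₂ d hd e heC hcc hde
      have h2 := hC c₁ hc₁ c₂ hc₂ e heC d hd hcc hde.symm
      have : ∃ B' ∈ F, c₁ ∈ B' ∧ c₂ ∈ B' ∧ d ∉ B' ∧ e ∉ B' := by
        obtain ⟨B, hB, h3, h4, h5⟩ := exists_quartet hF.compat h1 h2
        by_cases h6 : c₁ ∈ B
        · exact ⟨B, hB, by tauto⟩
        · exact ⟨Bᶜ, hF.compl B hB, by simp only [Set.mem_compl_iff]; tauto⟩
      obtain ⟨B', hB', h3, h4, h5, h6⟩ := this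
      have hsub : B' ⊆ B := by
        intro r hr
        by_contra hrB
        exact hF.compat B hB B' hB' c₁ e r d hB1 h3 heB h6 hrB hr hBd h5
      exact h6 (hmin ⟨hB', h3, h4, h5⟩ hsub heB)
    have hAB : A ⊆ B := by
      intro q hq
      by_contra hqB
      exact hF.compat A hA B hB c₁ q c₂ d hAc hB1 hq hqB hc₂A hB2 (fun h => hd (hAC h)) hBd
    exact hc₂A (hmax ⟨hB, hB1, hBC⟩ hAB hB2)
  · exact fun h => isSplit_relOf_of_mem h (hF.nonempty _ h) (hF.nonempty _ (hF.compl _ h))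

/-- A subset that is a split or trivial, that is, empty or the whole set. -/
def WeakSplit {S : Type} (R : S → S → S → S → Prop) (A : Set S) : Prop :=
  IsSplit R A ∨ A = ∅ ∨ A = Set.univ

theorem WeakSplit.isSplit (h : WeakSplit R A) {x y : S} (hx : x ∈ A) (hy : y ∉ A) :
    IsSplit R A := by
  rcases h with h | rfl | rfl
  · exact h
  · simp at hx
  · simp at hy

theorem weakSplit_compl_iff (hR : Treelike R) : WeakSplit R Aᶜ ↔ WeakSplit R A := by
  simp only [WeakSplit, isSplit_compl_iff hR, Set.compl_empty_iff, Set.compl_univ_iff]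
  tauto

/-! ### Restriction to a subset -/

section Restriction

variable {S' : Type} {R' : S' → S' → S' → S' → Prop} {f : S → S'}

theorem IsSplit.trace (hRR : ∀ a b c d, R a b c d ↔ R' (f a) (f b) (f c) (f d))
    (hf : Function.Injective f) {A' : Set S'} (h : IsSplit R' A') : WeakSplit R (f ⁻¹' A') := by
  by_cases h1 : f ⁻¹' A' = ∅
  · exact Or.inr (Or.inl h1)
  by_cases h2 : f ⁻¹' A' = Set.univ
  · exact Or.inr (Or.inr h2)
  refine Or.inl ⟨Set.nonempty_iff_ne_empty.2 h1, Set.nonempty_compl.2 h2, ?_⟩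
  intro a ha a' ha' b hb b' hb' h3 h4
  rw [hRR]
  exact h.2.2 _ ha _ ha' _ hb _ hb' (hf.ne h3) (hf.ne h4)

theorem Treelike.isSplitSystem_trace
    (hf : Function.Injective f) (hR' : Treelike R') :
    IsSplitSystem {C : Set S | C.Nonempty ∧ Cᶜ.Nonempty ∧ ∃ A', IsSplit R' A' ∧ f ⁻¹' A' = C} where
  nonempty A hA := hA.1
  compl A := by
    rintro ⟨h1, h2, A', h3, rfl⟩
    exact ⟨h2, by simpa using h1, A'ᶜ, h3.compl hR', rfl⟩
  singleton x y h := ⟨⟨x, rfl⟩, ⟨y, fun e => h e.symm⟩, {f x}, isSplit_singleton (hf.ne h), by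
    ext z; simp [hf.eq_iff]⟩
  compat := by
    rintro A ⟨-, -, A', h3, rfl⟩ B ⟨-, -, B', h4, rfl⟩ p q r s h1 h2
    exact IsSplit.compat hR' h3 h4 (f p) (f q) (f r) (f s) h1 h2

theorem Treelike.eq_relOf_trace (hRR : ∀ a b c d, R a b c d ↔ R' (f a) (f b) (f c) (f d))
    (hf : Function.Injective f) (hR' : Treelike R') :
    R = relOf {C : Set S | C.Nonempty ∧ Cᶜ.Nonempty ∧ ∃ A', IsSplit R' A' ∧ f ⁻¹' A' = C} := by
  funext a b c d
  rw [hRR, eq_iff_iff, hR'.iff]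
  constructor
  · rintro ⟨h1, A, hA, h2, h3⟩
    refine ⟨?_, f ⁻¹' A, ⟨?_, ?_, A, hA, rfl⟩, h2, h3⟩
    · rw [nodup_four] at h1 ⊢
      simpa [hf.eq_iff] using h1
    · by_cases h : f a ∈ A <;> simp [Separates, h] at h2
      exacts [⟨_, h⟩, ⟨_, h2⟩]
    · by_cases h : f a ∈ A <;> simp [Separates, h] at h2
      exacts [⟨_, h2⟩, ⟨_, h⟩]
  · rintro ⟨h1, _, ⟨-, -, A, hA, rfl⟩, h2, h3⟩
    refine ⟨?_, A, hA, h2, h3⟩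
    rw [nodup_four] at h1 ⊢
    simpa [hf.eq_iff] using h1

theorem Treelike.comap (hRR : ∀ a b c d, R a b c d ↔ R' (f a) (f b) (f c) (f d))
    (hf : Function.Injective f) (hR' : Treelike R') : Treelike R := by
  rw [hR'.eq_relOf_trace hRR hf]
  exact (hR'.isSplitSystem_trace hf).treelike

/-- Every split of a restriction is the trace of a split. -/
theorem IsSplit.exists_trace [Finite S] (hRR : ∀ a b c d, R a b c d ↔ R' (f a) (f b) (f c) (f d))
    (hf : Function.Injective f) (hR' : Treelike R') {C : Set S} (hC : IsSplit R C) :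
    ∃ A', IsSplit R' A' ∧ f ⁻¹' A' = C := by
  rw [hR'.eq_relOf_trace hRR hf, (hR'.isSplitSystem_trace hf).isSplit_iff] at hC
  exact hC.2.2

end Restriction

/-! ### The branches at a leaf -/

/-- Two points lie in the same branch at `a` if they are equal or some split, other than the one
given by `a` itself, has both on the side not containing `a`. In a reduced tree, these are the
branches at the vertex adjacent to the leaf `a`. -/
def SameBranch {S : Type} (R : S → S → S → S → Prop) (a s s' : S) : Prop :=
  s = s' ∨ ∃ D, IsSplit R D ∧ a ∉ D ∧ D ≠ {a}ᶜ ∧ s ∈ D ∧ s' ∈ D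

/-- The number of branches at `a`, counted as subsets of the complement of `a`. -/
noncomputable def branchCount {S : Type} (R : S → S → S → S → Prop) (a : S) : ℕ :=
  (Set.range fun s : {s : S // s ≠ a} => {s' : S | s' ≠ a ∧ SameBranch R a s s'}).ncard

theorem SameBranch.symm {a s s' : S} (h : SameBranch R a s s') : SameBranch R a s' s := by
  rcases h with rfl | ⟨D, h1, h2, h3, h4, h5⟩
  · exact Or.inl rfl
  · exact Or.inr ⟨D, h1, h2, h3, h5, h4⟩

theorem SameBranch.trans (hR : Treelike R) {a s s' s'' : S} (h : SameBranch R a s s')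
    (h' : SameBranch R a s' s'') : SameBranch R a s s'' := by
  rcases h with rfl | ⟨D, h1, h2, h3, h4, h5⟩
  · exact h'
  rcases h' with rfl | ⟨E, g1, g2, g3, g4, g5⟩
  · exact Or.inr ⟨D, h1, h2, h3, h4, h5⟩
  by_cases h : s ∈ E
  · exact Or.inr ⟨E, g1, g2, g3, h, g5⟩
  by_cases h' : s'' ∈ D
  · exact Or.inr ⟨D, h1, h2, h3, h4, h'⟩
  exact (IsSplit.compat hR h1 g1 s' s s'' a h5 g4 h4 h h' g5 h2 g2).elim

theorem branchCount_eq (hR : Treelike R) {a : S} {T : Type} (f : {s : S // s ≠ a} → T)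
    (hf : Function.Surjective f) (h : ∀ s s', f s = f s' ↔ SameBranch R a s s') :
    branchCount R a = Nat.card T := by
  rw [branchCount, ← Nat.card_coe_set_eq]
  refine Nat.card_congr (Equiv.ofBijective (fun t => f t.2.choose) ⟨?_, ?_⟩)
  · intro t t' htt
    have h1 := t.2.choose_spec
    have h2 := t'.2.choose_spec
    rw [h] at htt
    apply Subtype.ext
    rw [← h1, ← h2]
    ext z
    constructor
    · rintro ⟨hz, hz'⟩; exact ⟨hz, htt.symm.trans hR hz'⟩
    · rintro ⟨hz, hz'⟩; exact ⟨hz, htt.trans hR hz'⟩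
  · intro t
    obtain ⟨s, rfl⟩ := hf t
    let t : Set.range fun s : {s : S // s ≠ a} => {s' : S | s' ≠ a ∧ SameBranch R a s s'} :=
      ⟨_, s, rfl⟩
    refine ⟨t, ?_⟩
    have := t.2.choose_spec
    simp only [h]
    have hs : (s : S) ∈ {s' : S | s' ≠ a ∧ SameBranch R a s s'} := ⟨s.2, Or.inl rfl⟩
    rw [show {s' : S | s' ≠ a ∧ SameBranch R a s s'} = t from rfl, ← this] at hs
    exact hs.2

/-- The branches at `a` as a quotient of the set of the other points. -/
theorem exists_branch_map (hR : Treelike R) (a : S) :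
    ∃ (T : Type) (f : {s : S // s ≠ a} → T), Function.Surjective f ∧
      ∀ s s', f s = f s' ↔ SameBranch R a s s' := by
  refine ⟨_, Set.rangeFactorization fun s : {s : S // s ≠ a} =>
    {s' : S | s' ≠ a ∧ SameBranch R a s s'}, Set.rangeFactorization_surjective, fun s s' => ?_⟩
  rw [Subtype.ext_iff]
  constructor
  · intro h
    have hs : (s' : S) ∈ {t : S | t ≠ a ∧ SameBranch R a s' t} := ⟨s'.2, Or.inl rfl⟩
    simp only [Set.rangeFactorization_coe] at h
    rw [← h] at hs
    exact hs.2
  · intro h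
    simp only [Set.rangeFactorization_coe]
    ext z
    constructor
    · rintro ⟨hz, hz'⟩; exact ⟨hz, h.symm.trans hR hz'⟩
    · rintro ⟨hz, hz'⟩; exact ⟨hz, h.trans hR hz'⟩

theorem branchCount_congr {S' : Type} {R' : S' → S' → S' → S' → Prop} (hR' : Treelike R')
    (e : S ≃ S') (h : ∀ a b c d, R a b c d ↔ R' (e a) (e b) (e c) (e d)) (a : S) :
    branchCount R a = branchCount R' (e a) := by
  have hR := hR'.comap h e.injective
  obtain ⟨T, f, hf, hff⟩ := exists_branch_map hR' (e a)
  have h2 : ∀ s s' : S, SameBranch R a s s' ↔ SameBranch R' (e a) (e s) (e s') := by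
    have hsymm : ∀ a b c d, R' a b c d ↔ R (e.symm a) (e.symm b) (e.symm c) (e.symm d) := by
      intro a b c d; rw [h]; simp
    have hsp : ∀ D, IsSplit R' D → IsSplit R (e ⁻¹' D) := by
      intro D hD
      obtain ⟨x, hx⟩ := hD.1
      obtain ⟨y, hy⟩ := hD.2.1
      exact (hD.trace h e.injective).isSplit (x := e.symm x) (y := e.symm y) (by simpa using hx)
        (by simpa using hy)
    have hsp' : ∀ D, IsSplit R D → IsSplit R' (e.symm ⁻¹' D) := by
      intro D hD
      obtain ⟨x, hx⟩ := hD.1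
      obtain ⟨y, hy⟩ := hD.2.1
      exact (hD.trace hsymm e.symm.injective).isSplit (x := e x) (y := e y) (by simpa using hx)
        (by simpa using hy)
    intro s s'
    refine or_congr e.injective.eq_iff.symm ⟨?_, ?_⟩
    · rintro ⟨D, h1, h2, h3, h4, h5⟩
      refine ⟨_, hsp' D h1, by simpa using h2, ?_, by simpa using h4, by simpa using h5⟩
      intro h6
      apply h3
      have := congrArg (e ⁻¹' ·) h6
      ext z
      have := Set.ext_iff.1 h6 (e z)
      simpa using this
    · rintro ⟨D, h1, h2, h3, h4, h5⟩
      refine ⟨_, hsp D h1, h2, ?_, h4, h5⟩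
      intro h6
      apply h3
      ext z
      have := Set.ext_iff.1 h6 (e.symm z)
      simp only [Set.mem_preimage, Equiv.apply_symm_apply, Set.mem_compl_iff,
        Set.mem_singleton_iff] at this ⊢
      rw [this, Equiv.symm_apply_eq]
  rw [branchCount_eq hR' f hf hff, branchCount_eq hR (fun s => f ⟨e s, e.injective.ne s.2⟩) ?_ ?_]
  · intro t
    obtain ⟨s, rfl⟩ := hf t
    exact ⟨⟨e.symm s, by rw [Ne, Equiv.symm_apply_eq]; exact s.2⟩, by simp⟩
  · intro s s'
    rw [hff, h2]

end Splits

/-! ### Cuts of trees -/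

/-- `W` is a union of components of the graph without the edge `uv`, and this edge leads from `W`
to the complement. -/
structure IsCut {V : Type} (G : SimpleGraph V) (W : Set V) (u v : V) : Prop where
  left : u ∈ W
  right : v ∉ W
  adj : G.Adj u v
  unique : ∀ x ∈ W, ∀ y ∉ W, G.Adj x y → x = u ∧ y = v

/-- The sides of the edges of a graph. -/
def cuts {V : Type} (G : SimpleGraph V) : Set (Set V) := {W | ∃ u v, IsCut G W u v}

section Cuts

variable {V : Type} {G : SimpleGraph V} {W W' : Set V} {u v x y : V}

theorem IsCut.compl (h : IsCut G W u v) : IsCut G Wᶜ v u where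
  left := h.right
  right := by simpa using h.left
  adj := h.adj.symm
  unique x hx y hy hxy := (h.unique y (by simpa using hy) x hx hxy.symm).symm

theorem IsCut.mem_iff_of_adj (h : IsCut G W u v) (hxy : G.Adj x y) (hne : s(x, y) ≠ s(u, v)) :
    x ∈ W ↔ y ∈ W := by
  constructor
  · intro hx
    by_contra hy
    obtain ⟨rfl, rfl⟩ := h.unique x hx y hy hxy
    exact hne rfl
  · intro hy
    by_contra hx
    obtain ⟨rfl, rfl⟩ := h.unique y hy x hx hxy.symm
    exact hne Sym2.eq_swap

theorem IsCut.separates_iff_of_adj (h : IsCut G W u v) (hxy : G.Adj x y) :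
    Separates W x y ↔ s(x, y) = s(u, v) := by
  constructor
  · intro hs
    by_contra hne
    exact hs (h.mem_iff_of_adj hxy hne)
  · intro he
    rw [Sym2.eq_iff] at he
    rcases he with ⟨rfl, rfl⟩ | ⟨rfl, rfl⟩ <;> simp [Separates, h.left, h.right]

/-- A walk that does not use the edge of a cut stays on one side. -/
theorem IsCut.mem_iff_of_walk (h : IsCut G W u v) (p : G.Walk x y) (hp : s(u, v) ∉ p.edges) :
    ∀ z ∈ p.support, (z ∈ W ↔ x ∈ W) := by
  induction p with
  | nil => simp
  | cons hxz p ih =>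
    rw [SimpleGraph.Walk.edges_cons, List.mem_cons, not_or] at hp
    intro z hz
    rw [SimpleGraph.Walk.support_cons, List.mem_cons] at hz
    rcases hz with rfl | hz
    · rfl
    · rw [ih hp.2 z hz]
      exact (h.mem_iff_of_adj hxz (Ne.symm hp.1)).symm

/-- A trail uses the edge of a cut if and only if the cut separates its endpoints. -/
theorem IsCut.mem_edges_iff (h : IsCut G W u v) (p : G.Walk x y) (hp : p.IsTrail) :
    s(u, v) ∈ p.edges ↔ Separates W x y := by
  induction p with
  | nil => simp [Separates]
  | cons hxz p ih =>
    rw [SimpleGraph.Walk.isTrail_cons] at hp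
    rw [SimpleGraph.Walk.edges_cons, List.mem_cons]
    have h1 := ih hp.1
    have h2 := h.separates_iff_of_adj hxz
    by_cases he : s(u, v) ∈ p.edges
    · have h3 : ¬ Separates W _ _ := fun hs => hp.2 ((h2.1 hs).symm ▸ he)
      have h4 := h1.1 he
      simp only [he, or_true, true_iff]
      simp only [Separates] at *
      tauto
    · have h4 := mt h1.2 he
      simp only [he, or_false]
      rw [eq_comm, ← h2]
      simp only [Separates] at *
      tauto

theorem exists_isCut (hG : G.IsAcyclic) (h : G.Adj u v) : ∃ W, IsCut G W u v := by
  have hb := SimpleGraph.isAcyclic_iff_forall_adj_isBridge.1 hG h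
  rw [SimpleGraph.isBridge_iff] at hb
  refine ⟨{x | (G.deleteEdges {s(u, v)}).Reachable u x}, ?_⟩
  refine ⟨SimpleGraph.Reachable.refl _, hb, h, fun x hx y hy hxy => ?_⟩
  have he : s(x, y) = s(u, v) := by
    by_contra hne
    refine hy (SimpleGraph.Reachable.trans hx (SimpleGraph.Adj.reachable ?_))
    rw [SimpleGraph.deleteEdges_adj]
    exact ⟨hxy, hne⟩
  rw [Sym2.eq_iff] at he
  rcases he with h | ⟨rfl, rfl⟩
  · exact h
  · exact (hb hx).elim

theorem isAcyclic_of_exists_isCut (h : ∀ u v, G.Adj u v → ∃ W, IsCut G W u v ∨ IsCut G W v u) :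
    G.IsAcyclic := by
  rw [SimpleGraph.isAcyclic_iff_forall_adj_isBridge]
  intro u v huv
  rw [SimpleGraph.isBridge_iff_forall_walk_mem_edges]
  intro p
  by_contra hp
  obtain ⟨W, hW | hW⟩ := h u v huv
  · exact hW.right ((hW.mem_iff_of_walk p hp v p.end_mem_support).2 hW.left)
  · rw [Sym2.eq_swap] at hp
    exact hW.right ((hW.mem_iff_of_walk p hp v p.end_mem_support).1 hW.left)

theorem compat_of_mem_cuts (hG : G.Connected) (h : W ∈ cuts G) (h' : W' ∈ cuts G) :
    Compat W W' := by
  obtain ⟨u, v, h⟩ := h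
  obtain ⟨u', v', h'⟩ := h'
  intro p q r s h1 h2 h3 h4 h5 h6 h7 h8
  -- the endpoint `u'` of the second edge would lie on both sides of the first cut
  obtain ⟨a, ha⟩ := hG.exists_isPath p q
  obtain ⟨b, hb⟩ := hG.exists_isPath r s
  have ha1 := (h'.mem_edges_iff a ha.isTrail).2 (by simp [Separates, h2, h4])
  have hb1 := (h'.mem_edges_iff b hb.isTrail).2 (by simp [Separates, h6, h8])
  have ha2 := mt (h.mem_edges_iff a ha.isTrail).1 (by simp [Separates, h1, h3])
  have hb2 := mt (h.mem_edges_iff b hb.isTrail).1 (by simp [Separates, h5, h7])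
  have ha3 := h.mem_iff_of_walk a ha2 u' (a.fst_mem_support_of_mem_edges ha1)
  have hb3 := h.mem_iff_of_walk b hb2 u' (b.fst_mem_support_of_mem_edges hb1)
  exact h5 (hb3.1 (ha3.2 h1))

theorem quartet_iff (hG : G.IsTree) {a b c d : V} :
    Quartet G a b c d ↔ relOf (cuts G) a b c d := by
  refine and_congr Iff.rfl ⟨?_, ?_⟩
  · rintro ⟨p, q, hp, hq, e, hep, heq⟩
    induction e with | _ u v =>
    obtain ⟨W, hW⟩ := exists_isCut hG.isAcyclic (p.adj_of_mem_edges hep)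
    exact ⟨W, ⟨u, v, hW⟩, (hW.mem_edges_iff p hp.isTrail).1 hep,
      (hW.mem_edges_iff q hq.isTrail).1 heq⟩
  · rintro ⟨W, ⟨u, v, hW⟩, h1, h2⟩
    obtain ⟨p, hp⟩ := hG.connected.exists_isPath a b
    obtain ⟨q, hq⟩ := hG.connected.exists_isPath c d
    exact ⟨p, q, hp, hq, s(u, v), (hW.mem_edges_iff p hp.isTrail).2 h1,
      (hW.mem_edges_iff q hq.isTrail).2 h2⟩

theorem isCut_singleton (hu : IsLeaf G u) (huv : G.Adj u v) [Finite V] : IsCut G {u} u v where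
  left := rfl
  right h := huv.ne h.symm
  adj := huv
  unique := by
    rintro x rfl y hy hxy
    refine ⟨rfl, ?_⟩
    exact (Set.ncard_le_one (Set.toFinite _)).1 hu y hxy v huv

/-- For two edges `uv` and `xu` at a vertex `u`, the side of `xu` that does not contain `u` lies on
the same side of `uv` as `u`. -/
theorem IsCut.subset (hG : G.Connected) (h : IsCut G W u v) (h' : IsCut G W' x u) (hx : x ≠ v) :
    W' ⊆ W := by
  intro z hz
  obtain ⟨p, hp⟩ := hG.exists_isPath x z
  have h1 := mt (h'.mem_edges_iff p hp.isTrail).1 (by simp [Separates, h'.left, hz])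
  have h2 : u ∉ p.support := fun hu => h'.right ((h'.mem_iff_of_walk p h1 u hu).2 h'.left)
  have h3 : s(u, v) ∉ p.edges := fun he => h2 (p.fst_mem_support_of_mem_edges he)
  refine (h.mem_iff_of_walk p h3 z p.end_mem_support).2 ?_
  refine (h.mem_iff_of_adj h'.adj ?_).2 h.left
  rw [Ne, Sym2.eq_iff]
  rintro (⟨rfl, rfl⟩ | ⟨rfl, -⟩)
  · exact h'.adj.ne rfl
  · exact hx rfl

theorem exists_leaf_mem [Finite V] (hG : G.IsTree) (h : IsCut G W u v) :
    ∃ w ∈ W, IsLeaf G w := by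
  induction hn : W.ncard using Nat.strong_induction_on generalizing W u v with
  | _ n ih =>
    by_cases hu : IsLeaf G u
    · exact ⟨u, h.left, hu⟩
    · have h1 : 1 < (G.neighborSet u).ncard := not_le.1 hu
      obtain ⟨x, hx, hxv⟩ := Set.exists_ne_of_one_lt_ncard h1 v
      obtain ⟨W', hW'⟩ := exists_isCut hG.isAcyclic (SimpleGraph.Adj.symm hx)
      have hsub := h.subset hG.connected hW' hxv
      have hlt : W'.ncard < n := by
        rw [← hn]
        exact Set.ncard_lt_ncard ⟨hsub, fun h2 => hW'.right (h2 h.left)⟩ (Set.toFinite _)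
      obtain ⟨w, hw, hwl⟩ := ih _ hlt hW' rfl
      exact ⟨w, hsub hw, hwl⟩

/-! ### The structure on the leaves of a tree -/

/-- The quaternary relation on the leaves of a graph. -/
def leafRel {V : Type} (G : SimpleGraph V) (a b c d : {v : V // IsLeaf G v}) : Prop :=
  Quartet G a b c d

/-- The bipartitions of the set of leaves that are defined by the edges. -/
def leafCuts {V : Type} (G : SimpleGraph V) : Set (Set {v : V // IsLeaf G v}) :=
  {C | ∃ W ∈ cuts G, C = Subtype.val ⁻¹' W}

theorem leafRel_eq (hG : G.IsTree) : leafRel G = relOf (leafCuts G) := by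
  funext a b c d
  rw [leafRel, quartet_iff hG, eq_iff_iff]
  constructor
  · rintro ⟨h1, W, hW, h2, h3⟩
    refine ⟨?_, _, ⟨W, hW, rfl⟩, h2, h3⟩
    rw [nodup_four] at h1 ⊢
    simpa [← Subtype.val_inj] using h1
  · rintro ⟨h1, _, ⟨W, hW, rfl⟩, h2, h3⟩
    refine ⟨?_, W, hW, h2, h3⟩
    rw [nodup_four] at h1 ⊢
    simpa [← Subtype.val_inj] using h1

theorem isSplitSystem_leafCuts [Finite V] (hG : G.IsTree) : IsSplitSystem (leafCuts G) where
  nonempty := by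
    rintro _ ⟨W, ⟨u, v, hW⟩, rfl⟩
    obtain ⟨w, hw, hl⟩ := exists_leaf_mem hG hW
    exact ⟨⟨w, hl⟩, hw⟩
  compl := by
    rintro _ ⟨W, ⟨u, v, hW⟩, rfl⟩
    exact ⟨Wᶜ, ⟨v, u, hW.compl⟩, rfl⟩
  singleton := by
    intro x y hxy
    have : Nontrivial V := ⟨x, y, Subtype.val_injective.ne hxy⟩
    obtain ⟨z, hz⟩ := hG.connected.preconnected.exists_adj_of_nontrivial x.1
    refine ⟨{x.1}, ⟨x.1, z, isCut_singleton x.2 hz⟩, ?_⟩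
    ext w
    simp [Subtype.ext_iff]
  compat := by
    rintro _ ⟨W, hW, rfl⟩ _ ⟨W', hW', rfl⟩ p q r s
    exact compat_of_mem_cuts hG.connected hW hW' p q r s

theorem treelike_leafRel [Finite V] (hG : G.IsTree) : Treelike (leafRel G) := by
  rw [leafRel_eq hG]
  exact (isSplitSystem_leafCuts hG).treelike

theorem isSplit_leafRel_iff [Finite V] (hG : G.IsTree) {C : Set {v : V // IsLeaf G v}} :
    IsSplit (leafRel G) C ↔ ∃ W ∈ cuts G, C = Subtype.val ⁻¹' W := by
  rw [leafRel_eq hG, (isSplitSystem_leafCuts hG).isSplit_iff]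
  rfl

theorem iff_or_iff_of_not_iff {p q r : Prop} (h : ¬ (p ↔ q)) : (p ↔ r) ∨ (q ↔ r) := by tauto

theorem eq_univ_of_adj_closed (hG : G.Connected) (hx : x ∈ W)
    (h : ∀ z ∈ W, ∀ z', G.Adj z z' → z' ∈ W) (z : V) : z ∈ W := by
  by_contra hz
  obtain ⟨p⟩ := hG.preconnected x z
  obtain ⟨d, -, h1, h2⟩ := p.exists_boundary_dart W hx hz
  exact h2 (h _ h1 _ d.adj)

theorem IsCut.eq (hG : G.Connected) (h : IsCut G W u v) (h' : IsCut G W' u v) : W = W' := by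
  ext z
  obtain ⟨p, hp⟩ := hG.exists_isPath z u
  have h1 := h.mem_edges_iff p hp.isTrail
  rw [h'.mem_edges_iff p hp.isTrail] at h1
  have := h.left
  have := h'.left
  simp only [Separates] at h1
  tauto

theorem IsLeaf.eq_of_adj [Finite V] (hu : IsLeaf G u) (h1 : G.Adj u x) (h2 : G.Adj u y) : x = y :=
  (Set.ncard_le_one (Set.toFinite _)).1 hu x h1 y h2

/-- A cut that separates a leaf from the adjacent vertex only separates this leaf from the rest. -/
theorem IsCut.mem_iff_of_separates_leaf [Finite V] (hG : G.Connected) (ha : IsLeaf G x)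
    (hxy : G.Adj x y) (h : IsCut G W u v) (hs : Separates W x y) (z : V) :
    (z ∈ W ↔ x ∈ W) ↔ z = x := by
  rw [h.separates_iff_of_adj hxy, Sym2.eq_iff] at hs
  rcases hs with ⟨rfl, rfl⟩ | ⟨rfl, rfl⟩
  · rw [h.eq hG (isCut_singleton ha hxy)]; simp
  · rw [h.eq hG (isCut_singleton ha hxy).compl]; simp

theorem eq_or_eq_of_adj_leaves [Finite V] (hG : G.Connected) (hu : IsLeaf G u) (hv : IsLeaf G v)
    (huv : G.Adj u v) (z : V) : z = u ∨ z = v := by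
  refine eq_univ_of_adj_closed (W := {z | z = u ∨ z = v}) hG (Or.inl rfl) ?_ z
  rintro z (rfl | rfl) z' h
  · exact Or.inr (hu.eq_of_adj h huv)
  · exact Or.inl (hv.eq_of_adj h huv.symm)

/-- A leaf of a tree with exactly two vertices has one branch. -/
theorem branchCount_leafRel_of_adj_leaf [Finite V] (hG : G.IsTree) (a : {v : V // IsLeaf G v})
    (hax : G.Adj a x) (hx : IsLeaf G x) : branchCount (leafRel G) a = 1 := by
  have h := eq_or_eq_of_adj_leaves hG.connected a.2 hx hax
  have h' : ∀ s : {s : {v : V // IsLeaf G v} // s ≠ a}, s.1.1 = x := fun s =>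
    (h s.1.1).resolve_left (fun hs => s.2 (Subtype.ext hs))
  rw [branchCount_eq (treelike_leafRel hG) (T := Unit) (fun _ => ())]
  · simp
  · exact fun _ => ⟨⟨⟨x, hx⟩, fun h => hax.ne (congrArg Subtype.val h).symm⟩, rfl⟩
  · intro s s'
    exact ⟨fun _ => Or.inl (Subtype.ext ((h' s).trans (h' s').symm)), fun _ => rfl⟩

/-- The branches at a leaf correspond to the other edges at the adjacent vertex, if the valence of
this vertex is at least three. -/
theorem branchCount_leafRel [Finite V] (hG : G.IsTree) (a : {v : V // IsLeaf G v})
    (hax : G.Adj a x) (hx : 3 ≤ valence G x) :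
    branchCount (leafRel G) a = valence G x - 1 := by
  have hxl : ¬ IsLeaf G x := by unfold IsLeaf; omega
  have hcutA := isCut_singleton a.2 hax
  have hcut : ∀ y : {y : V // G.Adj x y ∧ y ≠ a}, ∃ W, IsCut G W y x :=
    fun y => exists_isCut hG.isAcyclic y.2.1.symm
  choose B hB using hcut
  have hBa : ∀ y, a.1 ∉ B y := fun y ha =>
    (hcutA.compl.subset hG.connected (hB y) y.2.2) ha rfl
  have hdisj : ∀ y y', y ≠ y' → ∀ z, z ∈ B y → z ∉ B y' := by
    intro y y' hne z hz hz'
    exact ((hB y).compl.subset hG.connected (hB y') (fun h => hne (Subtype.ext h.symm))) hz' hz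
  have hex : ∀ s : {s : {v : V // IsLeaf G v} // s ≠ a}, ∃ y, s.1.1 ∈ B y := by
    intro s
    have := eq_univ_of_adj_closed (W := {z : V | z = a.1 ∨ z = x ∨ ∃ y, z ∈ B y}) (x := a.1)
      hG.connected
      (Or.inl rfl) ?_ s.1.1
    · rcases this with h | h | h
      · exact (s.2 (Subtype.ext h)).elim
      · exact (hxl (h ▸ s.1.2)).elim
      · exact h
    · rintro z (rfl | rfl | ⟨y, hy⟩) z' hz
      · exact Or.inr (Or.inl (a.2.eq_of_adj hz hax))
      · by_cases hza : z' = a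
        · exact Or.inl hza
        · exact Or.inr (Or.inr ⟨⟨z', hz, hza⟩, (hB _).left⟩)
      · by_cases hz' : z' ∈ B y
        · exact Or.inr (Or.inr ⟨y, hz'⟩)
        · exact Or.inr (Or.inl ((hB y).unique z hy z' hz' hz).2)
  choose f hf using hex
  have huniq : ∀ s y, s.1.1 ∈ B y → f s = y := by
    intro s y hy
    by_contra hne
    exact hdisj _ _ hne _ (hf s) hy
  have hleaf : ∀ y, ∃ s : {s : {v : V // IsLeaf G v} // s ≠ a}, s.1.1 ∈ B y := by
    intro y
    obtain ⟨w, hw, hl⟩ := exists_leaf_mem hG (hB y)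
    exact ⟨⟨⟨w, hl⟩, fun h => hBa y (h ▸ hw)⟩, hw⟩
  have hcard : Nat.card {y : V // G.Adj x y ∧ y ≠ a} = valence G x - 1 := by
    rw [valence, ← Set.ncard_sdiff_singleton_of_mem (a := a.1) (s := G.neighborSet x) hax.symm,
      ← Nat.card_coe_set_eq]
    rfl
  rw [branchCount_eq (treelike_leafRel hG) f, hcard]
  · intro y
    obtain ⟨s, hs⟩ := hleaf y
    exact ⟨s, huniq s y hs⟩
  · intro s s'
    constructor
    · intro hff
      refine Or.inr ⟨Subtype.val ⁻¹' B (f s), ?_, hBa _, ?_, hf s, hff ▸ hf s'⟩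
      · exact (isSplit_leafRel_iff hG).2 ⟨_, ⟨_, _, hB _⟩, rfl⟩
      · -- a third neighbour of `x` gives a leaf outside the branch
        have : 1 < Nat.card {y : V // G.Adj x y ∧ y ≠ a} := by omega
        have : Nontrivial {y : V // G.Adj x y ∧ y ≠ a} := Finite.one_lt_card_iff_nontrivial.1 this
        obtain ⟨y, hy⟩ := exists_ne (f s)
        obtain ⟨l, hl⟩ := hleaf y
        intro h
        have := Set.ext_iff.1 h l.1
        simp only [Set.mem_preimage, Set.mem_compl_iff, Set.mem_singleton_iff, l.2,
          not_false_eq_true, iff_true] at this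
        exact hdisj _ _ hy _ hl this
    · rintro (h | ⟨D, hD, haD, hDa, hs, hs'⟩)
      · rw [Subtype.ext h]
      by_contra hne
      obtain ⟨W, ⟨u, v, hW⟩, rfl⟩ := (isSplit_leafRel_iff hG).1 hD
      have hs : s.1.1 ∈ W := hs
      have hs' : s'.1.1 ∈ W := hs'
      obtain ⟨p, hp⟩ := hG.connected.exists_isPath s.1.1 s'.1.1
      have h1 := mt (hW.mem_edges_iff p hp.isTrail).1
        (by simp [Separates, hs, hs'])
      have h2 := ((hB (f s)).mem_edges_iff p hp.isTrail).2
        (by simp [Separates, hf s, hdisj _ _ (Ne.symm hne) _ (hf s')])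
      -- the path from `s` to `s'` passes through `x`, so the cut separates `a` from `x`
      have h3 : x ∈ W := (hW.mem_iff_of_walk p h1 x (p.snd_mem_support_of_mem_edges h2)).2 hs
      have h4 := hW.mem_iff_of_separates_leaf hG.connected a.2 hax
        (fun h => haD (h.2 h3))
      apply hDa
      ext z
      have := h4 z.1
      have haW : a.1 ∉ W := haD
      simp only [haW, iff_false] at this
      simp only [Set.mem_preimage, Set.mem_compl_iff, Set.mem_singleton_iff, Subtype.ext_iff]
      tauto

/-! ### Deletion of a leaf -/

theorem valence_eq_add [Finite V] (a : V) (v : ({a}ᶜ : Set V)) [Decidable (G.Adj v a)] :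
    valence G v = valence (G.induce {a}ᶜ) v + if G.Adj v a then 1 else 0 := by
  have h : valence (G.induce {a}ᶜ) v = (G.neighborSet v \ {a}).ncard := by
    rw [valence, ← Set.ncard_image_of_injective _ Subtype.val_injective]
    congr 1
    ext z
    simp [and_comm]
  rw [h, valence]
  split_ifs with hva
  · exact (Set.ncard_sdiff_singleton_add_one (s := G.neighborSet v) hva (Set.toFinite _)).symm
  · rw [Set.sdiff_singleton_eq_self (s := G.neighborSet v) hva, add_zero]

theorem isTree_induce [Finite V] {a : V} (hG : G.IsTree) (ha : IsLeaf G a) (hax : G.Adj a x) :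
    (G.induce {a}ᶜ).IsTree := by
  classical
  have := Fintype.ofFinite V
  refine ⟨hG.connected.induce_compl_singleton_of_degree_eq_one ?_, hG.isAcyclic.induce _⟩
  rw [SimpleGraph.degree_eq_one_iff_existsUnique_adj]
  exact ⟨x, hax, fun y hy => ha.eq_of_adj hy hax⟩

theorem quartet_embedding {V' : Type} {G' : SimpleGraph V'} (φ : G' ↪g G) (hG : G.IsAcyclic)
    (hG' : G'.Connected) {a b c d : V'} :
    Quartet G (φ a) (φ b) (φ c) (φ d) ↔ Quartet G' a b c d := by
  refine and_congr (by simp) ⟨?_, ?_⟩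
  · rintro ⟨p, q, hp, hq, e, hep, heq⟩
    obtain ⟨p', hp'⟩ := hG'.exists_isPath a b
    obtain ⟨q', hq'⟩ := hG'.exists_isPath c d
    have h1 : p = p'.map φ.toHom :=
      congrArg Subtype.val ((hG.subsingleton_path _ _).elim ⟨p, hp⟩ ⟨_, hp'.map φ.injective⟩)
    have h2 : q = q'.map φ.toHom :=
      congrArg Subtype.val ((hG.subsingleton_path _ _).elim ⟨q, hq⟩ ⟨_, hq'.map φ.injective⟩)
    rw [h1, SimpleGraph.Walk.edges_map, List.mem_map] at hep
    rw [h2, SimpleGraph.Walk.edges_map, List.mem_map] at heq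
    obtain ⟨e1, he1, rfl⟩ := hep
    obtain ⟨e2, he2, he⟩ := heq
    rw [Sym2.map.injective φ.injective he] at he2
    exact ⟨p', q', hp', hq', e1, he1, he2⟩
  · rintro ⟨p, q, hp, hq, e, hep, heq⟩
    refine ⟨p.map φ.toHom, q.map φ.toHom, hp.map φ.injective, hq.map φ.injective,
      e.map φ, ?_, ?_⟩ <;> rw [SimpleGraph.Walk.edges_map]
    · exact List.mem_map_of_mem hep
    · exact List.mem_map_of_mem heq

theorem isLeaf_induce_iff [Finite V] {a : V} (ha : IsLeaf G a) (hax : G.Adj a x)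
    (hx : valence G x ≠ 2) (v : ({a}ᶜ : Set V)) : IsLeaf (G.induce {a}ᶜ) v ↔ IsLeaf G v := by
  classical
  have h := valence_eq_add (G := G) a v
  split_ifs at h with hva
  · have : v.1 = x := ha.eq_of_adj hva.symm hax
    rw [← this] at hx
    unfold IsLeaf
    omega
  · unfold IsLeaf
    omega

theorem isLeaf_induce_iff_of_valence_two [Finite V] {a : V} (ha : IsLeaf G a) (hax : G.Adj a x)
    (hx : valence G x = 2) (v : ({a}ᶜ : Set V)) :
    IsLeaf (G.induce {a}ᶜ) v ↔ v.1 = x ∨ IsLeaf G v := by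
  classical
  have h := valence_eq_add (G := G) a v
  split_ifs at h with hva
  · have : v.1 = x := ha.eq_of_adj hva.symm hax
    rw [← this] at hx
    simp only [this, true_or, iff_true]
    unfold IsLeaf
    omega
  · have : v.1 ≠ x := by rintro h; rw [h] at hva; exact hva hax.symm
    unfold IsLeaf
    simp only [this, false_or]
    omega

/-- Deleting a leaf whose neighbour has valence two does not change the structure on the leaves:
the neighbour takes the place of the leaf. -/
theorem exists_leaf_equiv_of_valence_two [Finite V] {a : V} (hG : G.IsTree) (ha : IsLeaf G a)
    (hax : G.Adj a x) (hx : valence G x = 2) :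
    ∃ e : {v : V // IsLeaf G v} ≃ {v : ({a}ᶜ : Set V) // IsLeaf (G.induce {a}ᶜ) v},
      ∀ s₁ s₂ s₃ s₄, leafRel G s₁ s₂ s₃ s₄ ↔
        leafRel (G.induce {a}ᶜ) (e s₁) (e s₂) (e s₃) (e s₄) := by
  classical
  have hl := isLeaf_induce_iff_of_valence_two ha hax hx
  have hxl : ¬ IsLeaf G x := by unfold IsLeaf; omega
  have hxa : x ≠ a := hax.ne.symm
  let g : {v : V // IsLeaf G v} → V := fun s => if s.1 = a then x else s.1
  have hga : ∀ s, g s ≠ a := by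
    intro s
    by_cases h : s.1 = a <;> simp [g, h, hxa]
  have hginj : Function.Injective g := by
    intro s s' h
    apply Subtype.ext
    by_cases h1 : s.1 = a <;> by_cases h2 : s'.1 = a
    · rw [h1, h2]
    · simp only [g, h1, h2, if_true, if_false] at h
      exact (hxl (h ▸ s'.2)).elim
    · simp only [g, h1, h2, if_true, if_false] at h
      exact (hxl (h ▸ s.2)).elim
    · simpa [g, h1, h2] using h
  have hgl : ∀ s, IsLeaf (G.induce {a}ᶜ) ⟨g s, hga s⟩ := by
    intro s
    rw [hl]
    by_cases h : s.1 = a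
    · left; simp [g, h]
    · right; simpa [g, h] using s.2
  refine ⟨Equiv.ofBijective (fun s => ⟨⟨g s, hga s⟩, hgl s⟩) ⟨?_, ?_⟩, ?_⟩
  · intro s s' h
    exact hginj (congrArg (fun t => t.1.1) h)
  · rintro ⟨⟨v, hv⟩, hvl⟩
    have hva : v ≠ a := hv
    rcases (hl _).1 hvl with h | h
    · exact ⟨⟨a, ha⟩, by simp only [g, if_true, Subtype.mk.injEq]; exact h.symm⟩
    · exact ⟨⟨v, h⟩, by simp [g, hva]⟩
  · intro s₁ s₂ s₃ s₄
    have h1 := quartet_embedding (SimpleGraph.Embedding.induce (G := G) {a}ᶜ) hG.isAcyclic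
      (isTree_induce hG ha hax).connected
      (a := ⟨g s₁, hga s₁⟩) (b := ⟨g s₂, hga s₂⟩) (c := ⟨g s₃, hga s₃⟩) (d := ⟨g s₄, hga s₄⟩)
    refine Iff.trans ?_ h1
    change Quartet G s₁.1 s₂.1 s₃.1 s₄.1 ↔ Quartet G (g s₁) (g s₂) (g s₃) (g s₄)
    rw [quartet_iff hG, quartet_iff hG]
    have hnd : [s₁.1, s₂.1, s₃.1, s₄.1].Nodup ↔ [g s₁, g s₂, g s₃, g s₄].Nodup := by
      rw [nodup_four, nodup_four]
      simp [hginj.eq_iff, Subtype.ext_iff]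
    have hsep : ∀ W, ¬ Separates W a x → ∀ s s' : {v : V // IsLeaf G v},
        (Separates W s.1 s'.1 ↔ Separates W (g s) (g s')) := by
      intro W hW s s'
      have : ∀ s : {v : V // IsLeaf G v}, (g s ∈ W ↔ s.1 ∈ W) := by
        intro s
        by_cases h : s.1 = a
        · simp only [g, h, if_true]; simp only [Separates] at hW; tauto
        · simp [g, h]
      simp only [Separates, this]
    constructor
    · rintro ⟨h1, W, ⟨u, v, hW⟩, h2, h3⟩
      refine ⟨hnd.1 h1, W, ⟨u, v, hW⟩, ?_⟩
      by_cases hWa : Separates W a x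
      · have h4 := hW.mem_iff_of_separates_leaf hG.connected ha hax hWa
        rw [nodup_four] at h1
        simp only [Separates] at h2 h3
        have h5 : s₁.1 = a ∨ s₂.1 = a := by
          rw [← h4, ← h4]; exact iff_or_iff_of_not_iff h2
        have h6 : s₃.1 = a ∨ s₄.1 = a := by
          rw [← h4, ← h4]; exact iff_or_iff_of_not_iff h3
        clear h4
        rcases h5 with h5 | h5 <;> rcases h6 with h6 | h6
        · exact (h1.2.1 (h5.trans h6.symm)).elim
        · exact (h1.2.2.1 (h5.trans h6.symm)).elim
        · exact (h1.2.2.2.1 (h5.trans h6.symm)).elim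
        · exact (h1.2.2.2.2.1 (h5.trans h6.symm)).elim
      · rw [← hsep W hWa, ← hsep W hWa]
        exact ⟨h2, h3⟩
    · rintro ⟨h1, W, ⟨u, v, hW⟩, h2, h3⟩
      refine ⟨hnd.2 h1, W, ⟨u, v, hW⟩, ?_⟩
      by_cases hWa : Separates W a x
      · have h4 := hW.mem_iff_of_separates_leaf hG.connected ha hax hWa
        simp only [Separates] at h2
        exact ((iff_or_iff_of_not_iff h2).elim (mt (h4 (g s₁)).1 (hga _))
          (mt (h4 (g s₂)).1 (hga _))).elim
      · rw [hsep W hWa, hsep W hWa]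
        exact ⟨h2, h3⟩

end Cuts

/-! ### The tree of a split system -/

section ClusterTree

variable {S : Type} {R : S → S → S → S → Prop} {r : S}

/-- The vertices of the tree of a treelike relation on `S`, rooted at the leaf `r`: the whole set,
which plays the role of `r`, and the clusters, that is, the sides not containing `r` of the
splits. -/
abbrev Cluster {S : Type} (R : S → S → S → S → Prop) (r : S) : Type :=
  {A : Set S // A = Set.univ ∨ IsSplit R A ∧ r ∉ A}

/-- The whole set as a cluster. -/
def Cluster.top (R : S → S → S → S → Prop) (r : S) : Cluster R r := ⟨Set.univ, Or.inl rfl⟩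

theorem Cluster.le_top (A : Cluster R r) : A ≤ Cluster.top R r := Set.subset_univ A.1

theorem Cluster.nonempty (A : Cluster R r) : A.1.Nonempty := by
  rcases A.2 with h | h
  · exact ⟨r, by rw [h]; trivial⟩
  · exact h.1.1

theorem Cluster.le_or_le (hR : Treelike R) {A B : Cluster R r} {x : S} (hA : x ∈ A.1)
    (hB : x ∈ B.1) : A ≤ B ∨ B ≤ A := by
  rcases A.2 with h | h
  · right; intro y _; rw [h]; trivial
  rcases B.2 with h' | h'
  · left; intro y _; rw [h']; trivial
  by_contra! hne
  obtain ⟨q, hq, hq'⟩ := Set.not_subset.1 hne.1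
  obtain ⟨p, hp, hp'⟩ := Set.not_subset.1 hne.2
  exact IsSplit.compat hR h.1 h'.1 x q p r hA hB hq hq' hp' hp h.2 h'.2

theorem Cluster.isCut (hR : Treelike R) {A B : Cluster R r} (h : A ⋖ B) :
    IsCut (SimpleGraph.hasse (Cluster R r)) (Set.Iic A) A B where
  left := le_refl A
  right hB := h.lt.not_ge hB
  adj := Or.inl h
  unique := by
    rintro x hx y hy (hxy | hxy)
    · obtain ⟨z, hz⟩ := x.nonempty
      have hAy : A ≤ y := (Cluster.le_or_le hR (hx hz) (hxy.le hz)).resolve_right hy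
      have hxA : x = A := by
        by_contra hne
        exact hxy.2 (lt_of_le_of_ne hx hne) (lt_of_le_of_ne hAy (fun h => hy h.ge))
      subst hxA
      refine ⟨rfl, ?_⟩
      rcases Cluster.le_or_le hR (hxy.le hz) (h.le hz) with h1 | h1
      · exact (h.wcovBy.eq_or_eq hxy.le h1).resolve_left hxy.lt.ne'
      · exact ((hxy.wcovBy.eq_or_eq h.le h1).resolve_left h.lt.ne').symm
    · exact (hy (hxy.le.trans hx)).elim

theorem Cluster.isTree [Finite S] (hR : Treelike R) :
    (SimpleGraph.hasse (Cluster R r)).IsTree := by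
  have : Nonempty (Cluster R r) := ⟨Cluster.top R r⟩
  refine ⟨⟨?_⟩, isAcyclic_of_exists_isCut ?_⟩
  · have key : ∀ A, (SimpleGraph.hasse (Cluster R r)).Reachable A (Cluster.top R r) := by
      intro A
      induction A using (wellFounded_gt (α := Cluster R r)).induction with
      | _ A ih =>
        by_cases hA : A = Cluster.top R r
        · rw [hA]
        · obtain ⟨B, hB, -⟩ := exists_covBy_le_of_lt (lt_of_le_of_ne A.le_top hA)
          exact SimpleGraph.Reachable.trans (SimpleGraph.Adj.reachable (Or.inl hB)) (ih B hB.lt)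
    exact fun A B => (key A).trans (key B).symm
  · rintro A B (h | h)
    · exact ⟨_, Or.inl (Cluster.isCut hR h)⟩
    · exact ⟨_, Or.inr (Cluster.isCut hR h)⟩

open scoped Classical in
/-- The vertex of the tree of clusters that corresponds to an element of the set. -/
noncomputable def Cluster.leaf (R : S → S → S → S → Prop) (r s : S) : Cluster R r :=
  if h : s = r then Cluster.top R r else ⟨{s}, Or.inr ⟨isSplit_singleton h, fun hr => h hr.symm⟩⟩

theorem Cluster.leaf_self : Cluster.leaf R r r = Cluster.top R r := by simp [Cluster.leaf]

theorem Cluster.leaf_of_ne {s : S} (h : s ≠ r) : (Cluster.leaf R r s).1 = {s} := by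
  simp [Cluster.leaf, h]

theorem Cluster.leaf_le_iff {s : S} {A : Cluster R r} (hA : r ∉ A.1) :
    Cluster.leaf R r s ≤ A ↔ s ∈ A.1 := by
  by_cases h : s = r
  · subst h
    simp only [Cluster.leaf_self, hA, iff_false]
    exact fun h => hA (h (Set.mem_univ s))
  · change (Cluster.leaf R r s).1 ⊆ A.1 ↔ _
    rw [Cluster.leaf_of_ne h, Set.singleton_subset_iff]

theorem Cluster.leaf_injective : Function.Injective (Cluster.leaf R r) := by
  intro s s' h
  have h0 := congrArg Subtype.val h
  by_cases h1 : s = r <;> by_cases h2 : s' = r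
  · rw [h1, h2]
  · subst h1
    rw [Cluster.leaf_of_ne h2, Cluster.leaf_self] at h0
    have : s ∈ ({s'} : Set S) := h0 ▸ Set.mem_univ s
    exact this
  · subst h2
    rw [Cluster.leaf_of_ne h1, Cluster.leaf_self] at h0
    have : s' ∈ ({s} : Set S) := h0 ▸ Set.mem_univ s'
    exact this.symm
  · rw [Cluster.leaf_of_ne h1, Cluster.leaf_of_ne h2] at h0
    exact Set.singleton_injective h0

theorem Cluster.notMem_of_ne_top {A : Cluster R r} (h : A ≠ Cluster.top R r) : r ∉ A.1 :=
  (A.2.resolve_left (fun h' => h (Subtype.ext h'))).2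

theorem Cluster.isLeaf_iff [Finite S] (hR : Treelike R) (A : Cluster R r) :
    IsLeaf (SimpleGraph.hasse (Cluster R r)) A ↔ ∃ s, Cluster.leaf R r s = A := by
  constructor
  · intro hA
    by_cases hT : A = Cluster.top R r
    · exact ⟨r, by rw [hT, Cluster.leaf_self]⟩
    have hr := Cluster.notMem_of_ne_top hT
    obtain ⟨s, hs⟩ := A.nonempty
    have hsr : s ≠ r := by rintro rfl; exact hr hs
    have hle : Cluster.leaf R r s ≤ A := (Cluster.leaf_le_iff hr).2 hs
    by_contra! hne
    obtain ⟨B, hB, -⟩ := exists_covBy_le_of_lt (lt_of_le_of_ne A.le_top hT)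
    obtain ⟨C, -, hC⟩ := exists_le_covBy_of_lt (lt_of_le_of_ne hle (hne s))
    have := (Set.ncard_le_one (Set.toFinite _)).1 hA B (Or.inl hB) C (Or.inr hC)
    exact (hC.lt.trans hB.lt).ne this.symm
  · rintro ⟨s, rfl⟩
    refine (Set.ncard_le_one (Set.toFinite _)).2 ?_
    by_cases h : s = r
    · subst h
      rw [Cluster.leaf_self]
      have key : ∀ B, (SimpleGraph.hasse (Cluster R s)).Adj (Cluster.top R s) B → B.1 = {s}ᶜ := by
        rintro B (hB | hB)
        · exact (hB.lt.not_ge B.le_top).elim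
        · have hsB := Cluster.notMem_of_ne_top hB.lt.ne
          obtain ⟨t, ht⟩ := B.nonempty
          have hts : s ≠ t := by rintro rfl; exact hsB ht
          let C : Cluster R s := ⟨{s}ᶜ, Or.inr ⟨(isSplit_singleton hts).compl hR, by simp⟩⟩
          have hBC : B ≤ C := fun x hx h => hsB (h ▸ hx)
          rcases hB.wcovBy.eq_or_eq hBC C.le_top with h | h
          · exact (congrArg Subtype.val h).symm
          · have h' : ({s}ᶜ : Set S) = Set.univ := congrArg Subtype.val h
            have : s ∈ ({s}ᶜ : Set S) := by rw [h']; trivial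
            exact (this rfl).elim
      exact fun B hB C hC => Subtype.ext ((key B hB).trans (key C hC).symm)
    · have key : ∀ B, (SimpleGraph.hasse (Cluster R r)).Adj (Cluster.leaf R r s) B →
          Cluster.leaf R r s ⋖ B := by
        rintro B (hB | hB)
        · exact hB
        · have h1 : B.1 ⊂ {s} := Cluster.leaf_of_ne (R := R) h ▸ hB.lt
          rw [Set.ssubset_singleton_iff] at h1
          exact (B.nonempty.ne_empty h1).elim
      intro B hB C hC
      exact ((Cluster.isCut hR (key B hB)).unique _ (Set.mem_Iic.2 le_rfl) C
        (fun h => (key C hC).lt.not_ge h) (Or.inl (key C hC))).2.symm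

/-- Every treelike relation on a non-empty finite set is the relation on the leaves of a tree: the
Hasse diagram of the clusters, in which the edge above a cluster defines the corresponding split. -/
theorem Treelike.exists_tree [Finite S] [Nonempty S] (hR : Treelike R) :
    ∃ (V : Type) (_ : Finite V) (G : SimpleGraph V), G.IsTree ∧
      ∃ e : S ≃ {v : V // IsLeaf G v},
        ∀ a b c d, R a b c d ↔ leafRel G (e a) (e b) (e c) (e d) := by
  obtain ⟨r⟩ := ‹Nonempty S›
  have hT := Cluster.isTree (r := r) hR
  have hl := Cluster.isLeaf_iff (r := r) hR
  refine ⟨Cluster R r, inferInstance, _, hT,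
    Equiv.ofBijective (fun s => ⟨Cluster.leaf R r s, (hl _).2 ⟨s, rfl⟩⟩) ⟨?_, ?_⟩, ?_⟩
  · intro s s' h
    exact Cluster.leaf_injective (congrArg Subtype.val h)
  · rintro ⟨A, hA⟩
    obtain ⟨s, rfl⟩ := (hl A).1 hA
    exact ⟨s, rfl⟩
  · intro a b c d
    change _ ↔ Quartet _ (Cluster.leaf R r a) (Cluster.leaf R r b) (Cluster.leaf R r c)
      (Cluster.leaf R r d)
    rw [quartet_iff hT, hR.iff]
    have hsep : ∀ A : Cluster R r, r ∉ A.1 → ∀ s s',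
        (Separates (Set.Iic A) (Cluster.leaf R r s) (Cluster.leaf R r s') ↔
          Separates A.1 s s') := by
      intro A hA s s'
      simp only [Separates, Set.mem_Iic, Cluster.leaf_le_iff hA]
    refine and_congr ?_ ⟨?_, ?_⟩
    · rw [nodup_four, nodup_four]
      simp [Cluster.leaf_injective.eq_iff]
    · have key : ∀ A, IsSplit R A → r ∉ A → Separates A a b → Separates A c d →
          ∃ W ∈ cuts (SimpleGraph.hasse (Cluster R r)),
            Separates W (Cluster.leaf R r a) (Cluster.leaf R r b) ∧
            Separates W (Cluster.leaf R r c) (Cluster.leaf R r d) := by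
        intro A hA hr h1 h2
        let A' : Cluster R r := ⟨A, Or.inr ⟨hA, hr⟩⟩
        have hne : A' ≠ Cluster.top R r := fun h => hr (by
          rw [show A = Set.univ from congrArg Subtype.val h]; trivial)
        obtain ⟨B, hB, -⟩ := exists_covBy_le_of_lt (lt_of_le_of_ne A'.le_top hne)
        exact ⟨_, ⟨_, _, Cluster.isCut hR hB⟩, (hsep A' hr _ _).2 h1, (hsep A' hr _ _).2 h2⟩
      rintro ⟨A, hA, h1, h2⟩
      by_cases hr : r ∈ A
      · exact key Aᶜ (IsSplit.compl hR hA) (by simpa using hr) (separates_compl.2 h1)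
          (separates_compl.2 h2)
      · exact key A hA hr h1 h2
    · have key : ∀ (W : Set (Cluster R r)) (u v : Cluster R r),
          IsCut (SimpleGraph.hasse (Cluster R r)) W u v → u ⋖ v →
          Separates W (Cluster.leaf R r a) (Cluster.leaf R r b) →
          Separates W (Cluster.leaf R r c) (Cluster.leaf R r d) →
          ∃ A ∈ {A | IsSplit R A}, Separates A a b ∧ Separates A c d := by
        intro W u v hW huv h1 h2
        rw [hW.eq hT.connected (Cluster.isCut hR huv)] at h1 h2
        have hne : u ≠ Cluster.top R r := (huv.lt.trans_le v.le_top).ne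
        have hr := Cluster.notMem_of_ne_top hne
        rw [hsep u hr] at h1 h2
        exact ⟨u.1, (u.2.resolve_left fun h => hne (Subtype.ext h)).1, h1, h2⟩
      rintro ⟨W, ⟨u, v, hW⟩, h1, h2⟩
      rcases hW.adj with h | h
      · exact key W u v hW h h1 h2
      · exact key Wᶜ v u hW.compl h (separates_compl.2 h1) (separates_compl.2 h2)

end ClusterTree

/-! ### Members of the class of tree structures -/

/-- The quaternary relation of a structure. -/
def quartetRel (X : Bundled.{0} treeLang.Structure) (a b c d : X) : Prop :=
  FirstOrder.Language.Structure.RelMap (L := treeLang) (M := X)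
    (TreeRel.quartet : treeLang.Relations 4) ![a, b, c, d]

section Structures

variable {X Y : Bundled.{0} treeLang.Structure}

theorem relMap_iff {n : ℕ} (r : treeLang.Relations n) (f : X → Y)
    (h : ∀ a b c d, quartetRel Y (f a) (f b) (f c) (f d) ↔ quartetRel X a b c d) (x : Fin n → X) :
    FirstOrder.Language.Structure.RelMap r (f ∘ x) ↔ FirstOrder.Language.Structure.RelMap r x := by
  cases r
  have h1 : x = ![x 0, x 1, x 2, x 3] := by
    funext i; fin_cases i <;> rfl
  have h2 : f ∘ x = ![f (x 0), f (x 1), f (x 2), f (x 3)] := by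
    funext i; fin_cases i <;> rfl
  rw [h2]
  conv_rhs => rw [h1]
  exact h _ _ _ _

/-- An injective map that preserves and reflects the quaternary relation, as an embedding. -/
def mkEmbedding (f : X → Y) (hf : Function.Injective f)
    (h : ∀ a b c d, quartetRel Y (f a) (f b) (f c) (f d) ↔ quartetRel X a b c d) :
    X ↪[treeLang] Y where
  toFun := f
  inj' := hf
  map_fun' := fun f _ => Empty.elim f
  map_rel' := fun r x => relMap_iff r f h x

/-- A bijection that preserves and reflects the quaternary relation, as an isomorphism. -/
def mkEquiv (e : X ≃ Y)
    (h : ∀ a b c d, quartetRel Y (e a) (e b) (e c) (e d) ↔ quartetRel X a b c d) :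
    X ≃[treeLang] Y where
  toEquiv := e
  map_fun' := fun f _ => Empty.elim f
  map_rel' := fun r x => relMap_iff r e h x

theorem quartetRel_embedding (f : X ↪[treeLang] Y) (a b c d : X) :
    quartetRel X a b c d ↔ quartetRel Y (f a) (f b) (f c) (f d) := by
  refine (f.map_rel (TreeRel.quartet : treeLang.Relations 4) ![a, b, c, d]).symm.trans ?_
  have : (f ∘ ![a, b, c, d] : Fin 4 → Y) = ![f a, f b, f c, f d] := by
    funext i; fin_cases i <;> rfl
  rw [this]
  rfl

theorem quartetRel_equiv (f : X ≃[treeLang] Y) (a b c d : X) :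
    quartetRel X a b c d ↔ quartetRel Y (f a) (f b) (f c) (f d) :=
  quartetRel_embedding f.toEmbedding a b c d

theorem mem_treeClass_iff : X ∈ treeClass ↔ Finite X ∧ Treelike (quartetRel X) := by
  constructor
  · rintro (h | ⟨V, hV, G, hG, ⟨e⟩⟩)
    · exact ⟨inferInstance, ∅, by simp, fun x => isEmptyElim x⟩
    · have : Finite (leafStructure G) := inferInstanceAs (Finite {v : V // IsLeaf G v})
      refine ⟨Finite.of_injective e e.injective, ?_⟩
      exact (treelike_leafRel hG).comap (f := e) (quartetRel_equiv e) e.injective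
  · rintro ⟨h1, h2⟩
    rcases isEmpty_or_nonempty X with h | h
    · exact Or.inl h
    · obtain ⟨V, hV, G, hG, e, he⟩ := h2.exists_tree
      exact Or.inr ⟨V, hV, G, hG,
        ⟨mkEquiv (Y := leafStructure G) e fun a b c d => (he a b c d).symm⟩⟩

theorem finite_of_mem (X : treeClass) : Finite X.1 := (mem_treeClass_iff.1 X.2).1

theorem treelike_of_mem (X : treeClass) : Treelike (quartetRel X.1) := (mem_treeClass_iff.1 X.2).2

/-- The member of the class of tree structures given by a treelike relation on a finite set. -/
def treelikeStructure {S : Type} [Finite S] {R : S → S → S → S → Prop} (hR : Treelike R) :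
    treeClass :=
  ⟨quartetStructure S R, mem_treeClass_iff.2 ⟨inferInstanceAs (Finite S), hR⟩⟩

end Structures

/-! ### The coefficient ring -/

theorem X_sub_one_ne_zero : (Polynomial.X - 1 : Polynomial ℤ) ≠ 0 :=
  Polynomial.X_sub_C_ne_zero (1 : ℤ)

theorem powers_le_nonZeroDivisors_tau :
    Submonoid.powers (Polynomial.X - 1 : Polynomial ℤ) ≤ nonZeroDivisors (Polynomial ℤ) :=
  powers_le_nonZeroDivisors_of_noZeroDivisors X_sub_one_ne_zero

instance isDomain_tauRing : IsDomain TauRing :=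
  IsLocalization.isDomain_localization powers_le_nonZeroDivisors_tau

theorem algebraMap_tau_injective : Function.Injective (algebraMap (Polynomial ℤ) TauRing) :=
  IsLocalization.injective _ powers_le_nonZeroDivisors_tau

theorem tau_sub_intCast_ne_zero (n : ℤ) : tau - (n : TauRing) ≠ 0 := by
  have h : tau - (n : TauRing) =
      algebraMap (Polynomial ℤ) TauRing (Polynomial.X - Polynomial.C n) := by
    simp [tau]
  rw [h, Ne, map_eq_zero_iff _ algebraMap_tau_injective]
  exact Polynomial.X_sub_C_ne_zero n

theorem tau_ne_zero : tau ≠ 0 := by simpa using tau_sub_intCast_ne_zero 0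

theorem tauSubOneInv_ne_zero : tauSubOneInv ≠ 0 := by
  intro h
  have := tau_sub_one_mul_inv
  rw [h, mul_zero] at this
  exact zero_ne_one this

theorem tau_mul_inv : tau * tauSubOneInv = 1 + tauSubOneInv := by
  linear_combination tau_sub_one_mul_inv

theorem fallingVariant_ne_zero (n : ℕ) : fallingVariant tau n ≠ 0 := by
  rw [fallingVariant, Finset.prod_ne_zero_iff]
  intro i _
  have := tau_sub_intCast_ne_zero ((i : ℤ) - 1)
  rw [show tau - (i : TauRing) + 1 = tau - (((i : ℤ) - 1 : ℤ) : TauRing) by push_cast; ring]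
  exact this

theorem fallingVariant_succ {k : Type} [CommRing k] (x : k) {n : ℕ} (hn : 2 ≤ n) :
    fallingVariant x (n + 1) = fallingVariant x n * (x - n) := by
  rw [fallingVariant, Finset.prod_Icc_succ_top (by omega), ← fallingVariant]
  push_cast
  ring

theorem fallingVariant_two {k : Type} [CommRing k] (x : k) : fallingVariant x 2 = 1 := by
  simp [fallingVariant]

/-! ### The weight of a tree -/

/-- The factor by which a vertex of valence `d` contributes to the value of a tree. A vertex of
valence two contributes `1`, so that subdividing an edge does not change the value. -/
noncomputable def vertexFactor (d : ℕ) : TauRing :=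
  if d ≤ 1 then tauSubOneInv else if d = 2 then 1 else -fallingVariant tau d

/-- The value that the primary measure takes on a tree, which need not be reduced. -/
noncomputable def treeWeight {V : Type} [Fintype V] (G : SimpleGraph V) : TauRing :=
  tau * ∏ v, vertexFactor (valence G v)

/-- The value of the primary measure on a one-point extension by a leaf with `c` branches. The cases
`c = 0` and `c = 1` are the trees with one and two vertices. -/
noncomputable def branchWeight (c : ℕ) : TauRing :=
  if c = 0 then 1 + tauSubOneInv else if c = 1 then tauSubOneInv else
    if c = 2 then tauSubOneInv - 1 else 1 - ((c : TauRing) - 1) * tauSubOneInv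

theorem vertexFactor_ne_zero (d : ℕ) : vertexFactor d ≠ 0 := by
  unfold vertexFactor
  split_ifs
  · exact tauSubOneInv_ne_zero
  · exact one_ne_zero
  · exact neg_ne_zero.2 (fallingVariant_ne_zero d)

theorem treeWeight_ne_zero {V : Type} [Fintype V] (G : SimpleGraph V) : treeWeight G ≠ 0 :=
  mul_ne_zero tau_ne_zero (Finset.prod_ne_zero_iff.2 fun _ _ => vertexFactor_ne_zero _)

theorem vertexFactor_mul {d : ℕ} (hd : 3 ≤ d) :
    tauSubOneInv * vertexFactor d = branchWeight (d - 1) * vertexFactor (d - 1) := by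
  obtain ⟨n, rfl⟩ : ∃ n, d = n + 1 := ⟨d - 1, by omega⟩
  have h := tau_mul_inv
  rw [Nat.add_sub_cancel, vertexFactor, if_neg (by omega), if_neg (by omega),
    fallingVariant_succ _ (by omega)]
  by_cases hn : n = 2
  · subst hn
    simp only [fallingVariant_two, branchWeight, vertexFactor]
    norm_num
    linear_combination -h
  · simp only [branchWeight, vertexFactor]
    rw [if_neg (by omega), if_neg (by omega), if_neg hn, if_neg (by omega), if_neg hn]
    linear_combination (-fallingVariant tau n) * h

section Weight

variable {V : Type} [Fintype V] {G : SimpleGraph V} {a x : V}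

theorem treeWeight_eq_prod_compl (a : V) [Fintype ({a}ᶜ : Set V)] :
    treeWeight G = tau * (vertexFactor (valence G a) *
      ∏ v : ({a}ᶜ : Set V), vertexFactor (valence G v)) := by
  classical
  rw [treeWeight, ← Finset.mul_prod_erase Finset.univ _ (Finset.mem_univ a)]
  congr 2
  exact Finset.prod_subtype (p := fun v => v ∈ ({a}ᶜ : Set V)) _ (by simp) _

theorem valence_eq_one (ha : IsLeaf G a) (hax : G.Adj a x) : valence G a = 1 :=
  le_antisymm ha ((Set.ncard_pos (Set.toFinite _)).2 ⟨x, hax⟩)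

/-- The comparison of the weights of a tree and of the tree obtained by deleting a leaf. -/
theorem treeWeight_induce [Fintype ({a}ᶜ : Set V)] (ha : IsLeaf G a) (hax : G.Adj a x) {w : TauRing}
    (hw : tauSubOneInv * vertexFactor (valence G x) = w * vertexFactor (valence G x - 1)) :
    treeWeight G = w * treeWeight (G.induce {a}ᶜ) := by
  classical
  have hxa : x ∈ ({a}ᶜ : Set V) := hax.ne.symm
  rw [treeWeight_eq_prod_compl a, treeWeight, valence_eq_one ha hax]
  have h1 : ∀ v : ({a}ᶜ : Set V), v ≠ ⟨x, hxa⟩ →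
      valence (G.induce {a}ᶜ) v = valence G v := by
    intro v hv
    have := valence_eq_add (G := G) a v
    rw [if_neg] at this
    · exact this.symm
    · exact fun h => hv (Subtype.ext (ha.eq_of_adj h.symm hax))
  have h2 : valence (G.induce {a}ᶜ) ⟨x, hxa⟩ = valence G x - 1 := by
    have := valence_eq_add (G := G) a ⟨x, hxa⟩
    rw [if_pos hax.symm] at this
    exact (Nat.sub_eq_of_eq_add this).symm
  rw [← Finset.mul_prod_erase Finset.univ _ (Finset.mem_univ (⟨x, hxa⟩ : ({a}ᶜ : Set V))),
    ← Finset.mul_prod_erase Finset.univ (fun v => vertexFactor (valence (G.induce {a}ᶜ) v))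
    (Finset.mem_univ (⟨x, hxa⟩ : ({a}ᶜ : Set V))), h2]
  have h3 : ∏ v ∈ Finset.univ.erase (⟨x, hxa⟩ : ({a}ᶜ : Set V)), vertexFactor (valence G v) =
      ∏ v ∈ Finset.univ.erase (⟨x, hxa⟩ : ({a}ᶜ : Set V)),
        vertexFactor (valence (G.induce {a}ᶜ) v) :=
    Finset.prod_congr rfl fun v hv => by rw [h1 v (Finset.ne_of_mem_erase hv)]
  rw [h3]
  have : vertexFactor 1 = tauSubOneInv := by simp [vertexFactor]
  rw [this]
  dsimp only
  linear_combination (tau * ∏ v ∈ Finset.univ.erase (⟨x, hxa⟩ : ({a}ᶜ : Set V)),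
        vertexFactor (valence (G.induce {a}ᶜ) v)) * hw

theorem treeWeight_of_subsingleton (hG : G.IsTree)
    (h : ∀ a b : V, IsLeaf G a → IsLeaf G b → a = b) : treeWeight G = tau * tauSubOneInv := by
  have hs : Subsingleton V := by
    by_contra hne
    rw [not_subsingleton_iff_nontrivial] at hne
    obtain ⟨u⟩ := hG.connected.nonempty
    obtain ⟨v, hv⟩ := hG.connected.preconnected.exists_adj_of_nontrivial u
    obtain ⟨W, hW⟩ := exists_isCut hG.isAcyclic hv
    obtain ⟨a, ha, hal⟩ := exists_leaf_mem hG hW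
    obtain ⟨b, hb, hbl⟩ := exists_leaf_mem hG hW.compl
    exact hb (h a b hal hbl ▸ ha)
  obtain ⟨u⟩ := hG.connected.nonempty
  have : Unique V := ⟨⟨u⟩, fun _ => Subsingleton.elim _ _⟩
  have hval : valence G default = 0 := by
    rw [valence, Set.ncard_eq_zero (Set.toFinite _), Set.eq_empty_iff_forall_notMem]
    exact fun y hy => G.ne_of_adj hy (Subsingleton.elim _ _)
  rw [treeWeight, Fintype.prod_unique, hval]
  simp [vertexFactor]

end Weight

/-- Deletion of a leaf from the structure of a tree: the remaining leaves are the leaves of a tree,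
and the weight changes by a factor that only depends on the number of branches at the leaf. -/
theorem exists_tree_of_deletion {V : Type} [Fintype V] {G : SimpleGraph V} (hG : G.IsTree)
    (a b : {v : V // IsLeaf G v}) (hab : b ≠ a) :
    ∃ (V' : Type) (_ : Fintype V') (G' : SimpleGraph V'), G'.IsTree ∧
      treeWeight G = branchWeight (branchCount (leafRel G) a) * treeWeight G' ∧
      ∃ e : {s : {v : V // IsLeaf G v} // s ≠ a} ≃ {v : V' // IsLeaf G' v},
        ∀ s₁ s₂ s₃ s₄, leafRel G s₁.1 s₂.1 s₃.1 s₄.1 ↔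
          leafRel G' (e s₁) (e s₂) (e s₃) (e s₄) := by
  classical
  induction hn : Fintype.card V using Nat.strong_induction_on generalizing V with
  | _ n ih =>
  have : Nontrivial V := ⟨b, a, Subtype.val_injective.ne hab⟩
  obtain ⟨x, hax⟩ := hG.connected.preconnected.exists_adj_of_nontrivial a.1
  have hG' := isTree_induce hG a.2 hax
  by_cases hx : valence G x = 2
  · obtain ⟨e, he⟩ := exists_leaf_equiv_of_valence_two hG a.2 hax hx
    have hlt : Fintype.card ({a.1}ᶜ : Set V) < n := by
      rw [← hn]
      exact Fintype.card_subtype_lt (x := a.1) (by simp)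
    obtain ⟨V', i, G', h1, h2, e', he'⟩ := ih _ hlt hG' (e a) (e b) (e.injective.ne hab) rfl
    refine ⟨V', i, G', h1, ?_, ?_⟩
    · rw [branchCount_congr (treelike_leafRel hG') e he, ← h2]
      rw [treeWeight_induce (w := 1) a.2 hax, one_mul]
      simp [hx, vertexFactor]
    · refine ⟨(e.subtypeEquiv (p := fun s => s ≠ a) (q := fun s => s ≠ e a)
        (fun s => e.injective.ne_iff.symm)).trans e', ?_⟩
      intro s₁ s₂ s₃ s₄
      rw [he]
      exact he' ⟨e s₁.1, e.injective.ne s₁.2⟩ ⟨e s₂.1, e.injective.ne s₂.2⟩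
        ⟨e s₃.1, e.injective.ne s₃.2⟩ ⟨e s₄.1, e.injective.ne s₄.2⟩
  · have hl := isLeaf_induce_iff a.2 hax hx
    refine ⟨({a.1}ᶜ : Set V), inferInstance, G.induce {a.1}ᶜ, hG', ?_, ?_⟩
    · by_cases hx1 : IsLeaf G x
      · rw [branchCount_leafRel_of_adj_leaf hG a hax hx1]
        apply treeWeight_induce a.2 hax
        rw [valence_eq_one hx1 hax.symm]
        simp [vertexFactor, branchWeight]
      · have h3 : 3 ≤ valence G x := by unfold IsLeaf at hx1; omega
        rw [branchCount_leafRel hG a hax h3]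
        exact treeWeight_induce a.2 hax (vertexFactor_mul h3)
    · refine ⟨⟨fun s => ⟨⟨s.1.1, fun h => s.2 (Subtype.ext h)⟩, (hl _).2 s.1.2⟩,
        fun s => ⟨⟨s.1.1, (hl _).1 s.2⟩, fun h => s.1.2 (congrArg Subtype.val h)⟩,
        fun _ => rfl, fun _ => rfl⟩, ?_⟩
      intro s₁ s₂ s₃ s₄
      exact quartet_embedding (SimpleGraph.Embedding.induce (G := G) {a.1}ᶜ) hG.isAcyclic
        hG'.connected (a := ⟨s₁.1.1, _⟩) (b := ⟨s₂.1.1, _⟩) (c := ⟨s₃.1.1, _⟩) (d := ⟨s₄.1.1, _⟩)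

/-- The weight of a tree only depends on the structure on its leaves, by induction on the number of
leaves: the number of branches at a deleted leaf is determined by the structure. -/
theorem treeWeight_eq_of_equiv {V V' : Type} [Fintype V] [Fintype V'] {G : SimpleGraph V}
    {G' : SimpleGraph V'} (hG : G.IsTree) (hG' : G'.IsTree)
    (e : {v : V // IsLeaf G v} ≃ {v : V' // IsLeaf G' v})
    (he : ∀ s₁ s₂ s₃ s₄, leafRel G s₁ s₂ s₃ s₄ ↔ leafRel G' (e s₁) (e s₂) (e s₃) (e s₄)) :
    treeWeight G = treeWeight G' := by
  induction hn : Nat.card {v : V // IsLeaf G v} using Nat.strong_induction_on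
    generalizing V V' with
  | _ n ih =>
  by_cases h : ∀ a b : {v : V // IsLeaf G v}, a = b
  · rw [treeWeight_of_subsingleton hG, treeWeight_of_subsingleton hG']
    · intro a b ha hb
      have := h (e.symm ⟨a, ha⟩) (e.symm ⟨b, hb⟩)
      exact congrArg Subtype.val (e.symm.injective this)
    · exact fun a b ha hb => congrArg Subtype.val (h ⟨a, ha⟩ ⟨b, hb⟩)
  · push Not at h
    obtain ⟨b, a, hab⟩ := h
    obtain ⟨V₁, i₁, G₁, hG₁, hw₁, e₁, he₁⟩ := exists_tree_of_deletion hG a b hab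
    obtain ⟨V₂, i₂, G₂, hG₂, hw₂, e₂, he₂⟩ :=
      exists_tree_of_deletion hG' (e a) (e b) (e.injective.ne hab)
    rw [hw₁, hw₂, branchCount_congr (treelike_leafRel hG') e he]
    congr 1
    let e' : {s : {v : V // IsLeaf G v} // s ≠ a} ≃ {s : {v : V' // IsLeaf G' v} // s ≠ e a} :=
      e.subtypeEquiv (fun s => e.injective.ne_iff.symm)
    refine ih _ ?_ hG₁ hG₂ ((e₁.symm.trans e').trans e₂) ?_ rfl
    · rw [← hn, ← Nat.card_congr e₁]
      have := Fintype.ofFinite {v : V // IsLeaf G v}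
      classical
      rw [Nat.card_eq_fintype_card, Nat.card_eq_fintype_card]
      exact Fintype.card_subtype_lt (x := a) (by simp)
    · intro s₁ s₂ s₃ s₄
      simp only [Equiv.trans_apply]
      rw [← he₂]
      simp only [e', Equiv.subtypeEquiv_apply]
      rw [← he, he₁]
      simp

/-! ### The weight of a tree structure -/

theorem exists_tree_of_mem (X : treeClass) (hX : Nonempty X.1) :
    ∃ (V : Type) (_ : Fintype V) (G : SimpleGraph V), G.IsTree ∧
      ∃ e : X.1 ≃ {v : V // IsLeaf G v},
        ∀ a b c d, quartetRel X.1 a b c d ↔ leafRel G (e a) (e b) (e c) (e d) := by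
  have := finite_of_mem X
  obtain ⟨V, hV, G, hG, he⟩ := (treelike_of_mem X).exists_tree
  exact ⟨V, Fintype.ofFinite V, G, hG, he⟩

open scoped Classical in
/-- The value that the primary measure takes on a tree structure: the weight of any tree that
represents it. -/
noncomputable def structureWeight (X : treeClass) : TauRing :=
  if hX : Nonempty X.1 then
    letI := (exists_tree_of_mem X hX).choose_spec.choose
    treeWeight (exists_tree_of_mem X hX).choose_spec.choose_spec.choose
  else 1

theorem structureWeight_eq {X : treeClass} {V : Type} [Fintype V] {G : SimpleGraph V}
    (hG : G.IsTree) (e : X.1 ≃ {v : V // IsLeaf G v})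
    (he : ∀ a b c d, quartetRel X.1 a b c d ↔ leafRel G (e a) (e b) (e c) (e d)) :
    structureWeight X = treeWeight G := by
  have hne : Nonempty X.1 := by
    obtain ⟨u⟩ := hG.connected.nonempty
    by_contra h
    rw [not_nonempty_iff] at h
    have hl : ∀ v : V, ¬ IsLeaf G v := fun v hv => h.elim (e.symm ⟨v, hv⟩)
    have h1 : 1 < (G.neighborSet u).ncard := not_le.1 (hl u)
    obtain ⟨v, hv, -⟩ := Set.exists_ne_of_one_lt_ncard h1 u
    obtain ⟨W, hW⟩ := exists_isCut hG.isAcyclic hv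
    obtain ⟨a, -, ha⟩ := exists_leaf_mem hG hW
    exact hl a ha
  rw [structureWeight, dif_pos hne]
  have h := (exists_tree_of_mem X hne).choose_spec.choose_spec.choose_spec
  obtain ⟨e', he'⟩ := h.2
  let _ := (exists_tree_of_mem X hne).choose_spec.choose
  refine treeWeight_eq_of_equiv h.1 hG (e'.symm.trans e) fun s₁ s₂ s₃ s₄ => ?_
  rw [Equiv.trans_apply, Equiv.trans_apply, Equiv.trans_apply, Equiv.trans_apply, ← he, he']
  simp

theorem structureWeight_of_isEmpty {X : treeClass} (hX : IsEmpty X.1) : structureWeight X = 1 := by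
  rw [structureWeight, dif_neg (not_nonempty_iff.2 hX)]

theorem structureWeight_ne_zero (X : treeClass) : structureWeight X ≠ 0 := by
  rcases isEmpty_or_nonempty X.1 with h | h
  · rw [structureWeight_of_isEmpty h]; exact one_ne_zero
  · obtain ⟨V, i, G, hG, e, he⟩ := exists_tree_of_mem X h
    rw [structureWeight_eq hG e he]
    exact treeWeight_ne_zero G

theorem structureWeight_congr {X Y : treeClass} (f : X.1 ≃[treeLang] Y.1) :
    structureWeight X = structureWeight Y := by
  rcases isEmpty_or_nonempty Y.1 with h | h
  · have : IsEmpty X.1 := f.toEquiv.isEmpty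
    rw [structureWeight_of_isEmpty h, structureWeight_of_isEmpty this]
  · obtain ⟨V, i, G, hG, e, he⟩ := exists_tree_of_mem Y h
    rw [structureWeight_eq hG e he, structureWeight_eq hG (f.toEquiv.trans e)]
    intro a b c d
    rw [quartetRel_equiv f, he]
    rfl

/-- `f` is a one-point extension, by the point `a`: its image is the complement of `a`. -/
def IsOnePoint {X Y : treeClass} (f : X.1 ↪[treeLang] Y.1) (a : Y.1) : Prop :=
  Set.range f = {a}ᶜ

theorem structureWeight_onePoint {X Y : treeClass} {f : X.1 ↪[treeLang] Y.1} {a : Y.1}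
    (h : IsOnePoint f a) :
    structureWeight Y = branchWeight (branchCount (quartetRel Y.1) a) * structureWeight X := by
  have hY := treelike_of_mem Y
  have hfa : ∀ x, f x ≠ a := fun x => by
    have : f x ∈ Set.range f := ⟨x, rfl⟩
    rw [h] at this
    exact this
  have hex : ∀ s : Y.1, s ≠ a → ∃ x, f x = s := fun s hs => by
    have : s ∈ Set.range f := by rw [h]; exact hs
    exact this
  obtain ⟨V, i, G, hG, e, he⟩ := exists_tree_of_mem Y ⟨a⟩
  rw [structureWeight_eq hG e he]
  rcases isEmpty_or_nonempty X.1 with hX | hX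
  · have hsub : ∀ s : Y.1, s = a := by
      intro s
      by_contra hs
      obtain ⟨x, -⟩ := hex s hs
      exact hX.elim x
    rw [structureWeight_of_isEmpty hX, mul_one, treeWeight_of_subsingleton hG, tau_mul_inv,
      branchCount_eq hY (T := Empty) (fun s => (s.2 (hsub s.1)).elim)]
    · simp [branchWeight]
    · exact fun x => x.elim
    · exact fun s => (s.2 (hsub s.1)).elim
    · intro u v hu hv
      have : e.symm ⟨u, hu⟩ = e.symm ⟨v, hv⟩ := (hsub _).trans (hsub _).symm
      exact congrArg Subtype.val (e.symm.injective this)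
  · obtain ⟨x⟩ := hX
    obtain ⟨V', i', G', hG', hw, e', he'⟩ :=
      exists_tree_of_deletion hG (e a) (e (f x)) (e.injective.ne (hfa x))
    rw [hw, branchCount_congr (treelike_leafRel hG) e he]
    congr 1
    let g : X.1 ≃ {s : {v : V // IsLeaf G v} // s ≠ e a} :=
      Equiv.ofBijective (fun y => ⟨e (f y), e.injective.ne (hfa y)⟩) ⟨fun y y' hy =>
        f.injective (e.injective (congrArg Subtype.val hy)), fun s => by
          obtain ⟨y, hy⟩ := hex (e.symm s.1) (fun hs => s.2 ((e.symm_apply_eq).1 hs))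
          exact ⟨y, Subtype.ext (by simp [hy])⟩⟩
    symm
    refine structureWeight_eq hG' (g.trans e') fun s₁ s₂ s₃ s₄ => ?_
    rw [quartetRel_embedding f, he]
    exact he' (g s₁) (g s₂) (g s₃) (g s₄)

/-! ### Amalgamations and complete lists -/

section Amalgamation

variable {X Y Y₁ X' : treeClass}

theorem Amalgam.IsIso.refl {i : X.1 ↪[treeLang] Y.1} {j : X.1 ↪[treeLang] X'.1} (A : Amalgam i j) :
    A.IsIso A :=
  ⟨FirstOrder.Language.Equiv.refl treeLang _, by ext; rfl, by ext; rfl⟩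

theorem Amalgam.IsIso.symm {i : X.1 ↪[treeLang] Y.1} {j : X.1 ↪[treeLang] X'.1} {A B : Amalgam i j}
    (h : A.IsIso B) : B.IsIso A := by
  obtain ⟨e, h1, h2⟩ := h
  refine ⟨e.symm, ?_, ?_⟩
  · rw [← h1]; ext x; exact e.symm_apply_apply _
  · rw [← h2]; ext x; exact e.symm_apply_apply _

theorem Amalgam.IsIso.trans {i : X.1 ↪[treeLang] Y.1} {j : X.1 ↪[treeLang] X'.1}
    {A B C : Amalgam i j} (h : A.IsIso B) (h' : B.IsIso C) : A.IsIso C := by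
  obtain ⟨e, h1, h2⟩ := h
  obtain ⟨f, h3, h4⟩ := h'
  refine ⟨f.comp e, ?_, ?_⟩
  · rw [← h3, ← h1]; ext x; rfl
  · rw [← h4, ← h2]; ext x; rfl

/-- The amalgamation with the roles of the two extensions exchanged. -/
def Amalgam.swap {i : X.1 ↪[treeLang] Y.1} {j : X.1 ↪[treeLang] X'.1} (A : Amalgam i j) :
    Amalgam j i where
  Z := A.Z
  inl := A.inr
  inr := A.inl
  comm := A.comm.symm
  cover := by rw [Set.union_comm, A.cover]

theorem Amalgam.IsIso.swap {i : X.1 ↪[treeLang] Y.1} {j : X.1 ↪[treeLang] X'.1} {A B : Amalgam i j}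
    (h : A.IsIso B) : A.swap.IsIso B.swap := by
  obtain ⟨e, h1, h2⟩ := h
  exact ⟨e, h2, h1⟩

/-- A family of amalgamations that contains each isomorphism class exactly once. -/
def IsCompleteList {i : X.1 ↪[treeLang] Y.1} {j : X.1 ↪[treeLang] X'.1} {ι : Type}
    (A : ι → Amalgam i j) : Prop :=
  ∀ B : Amalgam i j, ∃! α, (A α).IsIso B

/-- The additivity of the weights for a pair of embeddings. It is stated in a form without
division, which is symmetric in the two embeddings. -/
def WeightAdditive (i : X.1 ↪[treeLang] Y.1) (j : X.1 ↪[treeLang] X'.1) : Prop :=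
  ∃ (ι : Type) (_ : Fintype ι) (A : ι → Amalgam i j), IsCompleteList A ∧
    structureWeight X * ∑ α, structureWeight (A α).Z = structureWeight Y * structureWeight X'

theorem WeightAdditive.symm {i : X.1 ↪[treeLang] Y.1} {j : X.1 ↪[treeLang] X'.1}
    (h : WeightAdditive i j) : WeightAdditive j i := by
  obtain ⟨ι, _, A, hA, hs⟩ := h
  refine ⟨ι, inferInstance, fun α => (A α).swap, fun B => ?_,
    by rw [mul_comm (structureWeight X')]; exact hs⟩
  obtain ⟨α, h1, h2⟩ := hA B.swap
  exact ⟨α, h1.swap, fun β hβ => h2 β hβ.swap⟩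

/-- The sum of the weights over a complete list does not depend on the list. -/
theorem sum_weight_eq {i : X.1 ↪[treeLang] Y.1} {j : X.1 ↪[treeLang] X'.1} {ι κ : Type}
    [Fintype ι] [Fintype κ] {A : ι → Amalgam i j} {B : κ → Amalgam i j} (hA : IsCompleteList A)
    (hB : IsCompleteList B) :
    ∑ α, structureWeight (A α).Z = ∑ β, structureWeight (B β).Z := by
  choose g hg hg' using fun α => hB (A α)
  refine Fintype.sum_bijective g ⟨?_, ?_⟩ _ _ ?_
  · intro α α' h
    have h1 := (hg α).symm
    have h2 := (hg α').symm
    rw [← h] at h2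
    exact (hA (B (g α))).unique h1 h2
  · intro β
    obtain ⟨α, hα, -⟩ := hA (B β)
    exact ⟨α, (hB (B β)).unique ((hg α).trans hα) (Amalgam.IsIso.refl _)⟩
  · intro α
    obtain ⟨e, -⟩ := hg α
    exact (structureWeight_congr e).symm

/-! ### Substructures -/

theorem treelike_restrict (Z : treeClass) (T : Set Z.1) :
    Treelike (fun a b c d : T => quartetRel Z.1 a b c d) :=
  (treelike_of_mem Z).comap (f := Subtype.val) (fun _ _ _ _ => Iff.rfl) Subtype.val_injective

/-- The substructure on a subset. -/
def restrict (Z : treeClass) (T : Set Z.1) : treeClass :=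
  haveI := finite_of_mem Z
  treelikeStructure (treelike_restrict Z T)

/-- The inclusion of a substructure. -/
def restrictEmbedding (Z : treeClass) (T : Set Z.1) : (restrict Z T).1 ↪[treeLang] Z.1 :=
  mkEmbedding (X := (restrict Z T).1) (fun x : T => x.1) Subtype.val_injective
    fun _ _ _ _ => Iff.rfl

/-- An embedding with image in a subset, as an embedding into the substructure. -/
def restrictLift {Z : treeClass} (T : Set Z.1) (f : X.1 ↪[treeLang] Z.1) (h : ∀ x, f x ∈ T) :
    X.1 ↪[treeLang] (restrict Z T).1 :=
  mkEmbedding (Y := (restrict Z T).1) (fun x => (⟨f x, h x⟩ : T))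
    (fun _ _ hxy => f.injective (congrArg Subtype.val hxy))
    fun a b c d => (quartetRel_embedding f a b c d).symm

theorem range_restrictEmbedding (Z : treeClass) (T : Set Z.1) :
    Set.range (restrictEmbedding Z T) = T := Subtype.range_coe

theorem restrictEmbedding_mem (Z : treeClass) (T : Set Z.1) (x : (restrict Z T).1) :
    restrictEmbedding Z T x ∈ T := Subtype.coe_prop (S := T) x

/-! ### Reduction of additivity to one-point extensions -/

/-- An isomorphism from a bijective embedding. -/
noncomputable def equivOfBijective (f : X.1 ↪[treeLang] Y.1) (h : Function.Bijective f) :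
    X.1 ≃[treeLang] Y.1 :=
  mkEquiv (Equiv.ofBijective f h) fun a b c d => (quartetRel_embedding f a b c d).symm

/-- The number of points outside the image of an embedding. -/
noncomputable def codim (f : X.1 ↪[treeLang] Y.1) : ℕ := (Set.range f)ᶜ.ncard

theorem surjective_of_codim_eq_zero {f : X.1 ↪[treeLang] Y.1} (h : codim f = 0) :
    Function.Surjective f := by
  have := finite_of_mem Y
  rw [codim, Set.ncard_eq_zero (Set.toFinite _), Set.compl_empty_iff] at h
  exact Set.range_eq_univ.1 h

theorem weightAdditive_of_surjective (i : X.1 ↪[treeLang] Y.1) (j : X.1 ↪[treeLang] X'.1)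
    (hi : Function.Surjective i) : WeightAdditive i j := by
  let e := equivOfBijective i ⟨i.injective, hi⟩
  let A : Amalgam i j :=
    { Z := X'
      inl := j.comp e.symm.toEmbedding
      inr := FirstOrder.Language.Embedding.refl treeLang _
      comm := by
        ext x
        exact congrArg j (e.symm_apply_apply x)
      cover := by
        rw [Set.eq_univ_iff_forall]
        exact fun x => Or.inr ⟨x, rfl⟩ }
  refine ⟨Unit, inferInstance, fun _ => A, fun B => ⟨(), ?_, fun _ _ => rfl⟩, ?_⟩
  · have hcomm : ∀ x, B.inl (i x) = B.inr (j x) := fun x => DFunLike.congr_fun B.comm x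
    have hsurj : Function.Surjective B.inr := by
      intro z
      rcases (Set.eq_univ_iff_forall.1 B.cover) z with ⟨y, rfl⟩ | ⟨x, rfl⟩
      · obtain ⟨x, rfl⟩ := hi y
        exact ⟨j x, (hcomm x).symm⟩
      · exact ⟨x, rfl⟩
    refine ⟨equivOfBijective B.inr ⟨B.inr.injective, hsurj⟩, ?_, ?_⟩
    · ext y
      change B.inr (j (e.symm y)) = B.inl y
      rw [← hcomm]
      exact congrArg B.inl (e.apply_symm_apply y)
    · ext x; rfl
  · simp only [Finset.univ_unique, Finset.sum_const, Finset.card_singleton, one_smul]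
    rw [structureWeight_congr e]

theorem codim_inl_le {i : X.1 ↪[treeLang] Y.1} {j : X.1 ↪[treeLang] X'.1} (A : Amalgam i j) :
    codim A.inl ≤ codim j := by
  have := finite_of_mem X'
  refine (Set.ncard_le_ncard (t := A.inr '' (Set.range j)ᶜ) ?_ (Set.toFinite _)).trans
    (Set.ncard_image_le (Set.toFinite _))
  intro z hz
  rcases (Set.eq_univ_iff_forall.1 A.cover) z with h | ⟨x, rfl⟩
  · exact (hz h).elim
  · refine ⟨x, ?_, rfl⟩
    rintro ⟨y, rfl⟩
    exact hz ⟨i y, DFunLike.congr_fun A.comm y⟩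

/-- Additivity for a composition: an amalgamation with `Y` over `X` is obtained by first
amalgamating with an intermediate structure `Y₁`. -/
theorem WeightAdditive.comp {i₁ : X.1 ↪[treeLang] Y₁.1} {i₂ : Y₁.1 ↪[treeLang] Y.1}
    {j : X.1 ↪[treeLang] X'.1} (h₁ : WeightAdditive i₁ j)
    (h₂ : ∀ (Z : treeClass) (f : Y₁.1 ↪[treeLang] Z.1), codim f ≤ codim j → WeightAdditive i₂ f) :
    WeightAdditive (i₂.comp i₁) j := by
  obtain ⟨ι, _, A, hA, hs⟩ := h₁
  choose κ hκ B hB hBs using fun α => h₂ (A α).Z (A α).inl (codim_inl_le (A α))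
  have hcA : ∀ α x, (A α).inl (i₁ x) = (A α).inr (j x) := fun α => DFunLike.congr_fun (A α).comm
  have hcB : ∀ α β y, (B α β).inl (i₂ y) = (B α β).inr ((A α).inl y) :=
    fun α β => DFunLike.congr_fun (B α β).comm
  let C : (Σ α, κ α) → Amalgam (i₂.comp i₁) j := fun p =>
    { Z := (B p.1 p.2).Z
      inl := (B p.1 p.2).inl
      inr := (B p.1 p.2).inr.comp (A p.1).inr
      comm := by
        ext x
        change (B p.1 p.2).inl (i₂ (i₁ x)) = (B p.1 p.2).inr ((A p.1).inr (j x))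
        rw [hcB, hcA]
      cover := by
        rw [Set.eq_univ_iff_forall]
        intro z
        rcases Set.eq_univ_iff_forall.1 (B p.1 p.2).cover z with h | ⟨w, rfl⟩
        · exact Or.inl h
        rcases Set.eq_univ_iff_forall.1 (A p.1).cover w with ⟨y, rfl⟩ | ⟨x, rfl⟩
        · exact Or.inl ⟨i₂ y, hcB _ _ _⟩
        · exact Or.inr ⟨x, rfl⟩ }
  refine ⟨Σ α, κ α, inferInstance, C, ?_, ?_⟩
  · intro D
    have hcD : ∀ x, D.inl (i₂ (i₁ x)) = D.inr (j x) := DFunLike.congr_fun D.comm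
    let T : Set D.Z.1 := Set.range (fun y => D.inl (i₂ y)) ∪ Set.range D.inr
    -- the part of `D` that is generated by `Y₁` and `X'`
    let D₁ : Amalgam i₁ j :=
      { Z := restrict D.Z T
        inl := restrictLift T (D.inl.comp i₂) (fun y => Or.inl ⟨y, rfl⟩)
        inr := restrictLift T D.inr (fun x => Or.inr ⟨x, rfl⟩)
        comm := by
          ext x
          exact Subtype.ext (hcD x)
        cover := by
          rw [Set.eq_univ_iff_forall]
          rintro ⟨z, ⟨y, rfl⟩ | ⟨x, rfl⟩⟩
          · exact Or.inl ⟨y, rfl⟩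
          · exact Or.inr ⟨x, rfl⟩ }
    obtain ⟨α, ⟨e, he1, he2⟩, hα⟩ := hA D₁
    have he1' : ∀ y, e ((A α).inl y) = D₁.inl y := DFunLike.congr_fun he1
    have he2' : ∀ x, e ((A α).inr x) = D₁.inr x := DFunLike.congr_fun he2
    let D₂ : Amalgam i₂ (A α).inl :=
      { Z := D.Z
        inl := D.inl
        inr := (restrictEmbedding D.Z T).comp e.toEmbedding
        comm := by
          ext y
          change D.inl (i₂ y) = restrictEmbedding D.Z T (e ((A α).inl y))
          rw [he1']
          rfl
        cover := by
          rw [Set.eq_univ_iff_forall]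
          intro z
          rcases Set.eq_univ_iff_forall.1 D.cover z with h | ⟨x, rfl⟩
          · exact Or.inl h
          · refine Or.inr ⟨(A α).inr x, ?_⟩
            change restrictEmbedding D.Z T (e ((A α).inr x)) = _
            rw [he2']
            rfl }
    obtain ⟨β, ⟨f, hf1, hf2⟩, hβ⟩ := hB α D₂
    have hf2' : ∀ z, f ((B α β).inr z) = restrictEmbedding D.Z T (e z) := DFunLike.congr_fun hf2
    refine ⟨⟨α, β⟩, ⟨f, hf1, ?_⟩, ?_⟩
    · ext x
      change f ((B α β).inr ((A α).inr x)) = _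
      rw [hf2', he2']
      rfl
    · rintro ⟨α', β'⟩ ⟨g, hg1, hg2⟩
      have hg1' : ∀ y, g ((B α' β').inl y) = D.inl y := DFunLike.congr_fun hg1
      have hg2' : ∀ x, g ((B α' β').inr ((A α').inr x)) = D.inr x := DFunLike.congr_fun hg2
      have hgl : ∀ y, g ((B α' β').inr ((A α').inl y)) = D.inl (i₂ y) := by
        intro y
        rw [← hcB, hg1']
      have hT : ∀ z, g ((B α' β').inr z) ∈ T := by
        intro z
        rcases Set.eq_univ_iff_forall.1 (A α').cover z with ⟨y, rfl⟩ | ⟨x, rfl⟩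
        · exact Or.inl ⟨y, (hgl y).symm⟩
        · exact Or.inr ⟨x, (hg2' x).symm⟩
      have hα' : α' = α := by
        refine hα α' ?_
        let g₁ := restrictLift T (g.toEmbedding.comp (B α' β').inr) hT
        have hsurj : Function.Surjective g₁ := by
          rintro ⟨z, ⟨y, rfl⟩ | ⟨x, rfl⟩⟩
          · exact ⟨(A α').inl y, Subtype.ext (hgl y)⟩
          · exact ⟨(A α').inr x, Subtype.ext (hg2' x)⟩
        refine ⟨equivOfBijective g₁ ⟨g₁.injective, hsurj⟩, ?_, ?_⟩
        · ext y
          exact Subtype.ext (hgl y)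
        · ext x
          exact Subtype.ext (hg2' x)
      subst hα'
      congr 1
      refine hβ β' ⟨g, hg1, ?_⟩
      ext z
      change g ((B α' β').inr z) = restrictEmbedding D.Z T (e z)
      rcases Set.eq_univ_iff_forall.1 (A α').cover z with ⟨y, rfl⟩ | ⟨x, rfl⟩
      · rw [hgl, he1']
        rfl
      · rw [hg2', he2']
        rfl
  · rw [Fintype.sum_sigma]
    apply mul_left_cancel₀ (structureWeight_ne_zero Y₁)
    calc structureWeight Y₁ * (structureWeight X * ∑ α, ∑ β, structureWeight (B α β).Z)
        = structureWeight X * ∑ α, structureWeight Y₁ * ∑ β, structureWeight (B α β).Z := by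
          rw [← Finset.mul_sum]; ring
      _ = structureWeight Y * (structureWeight X * ∑ α, structureWeight (A α).Z) := by
          rw [Finset.sum_congr rfl fun α _ => hBs α, ← Finset.mul_sum]; ring
      _ = structureWeight Y₁ * (structureWeight Y * structureWeight X') := by
          rw [hs]; ring

/-- Every embedding that is not an isomorphism factors through a one-point extension. -/
theorem exists_factorization (i : X.1 ↪[treeLang] Y.1) {n : ℕ} (h : codim i = n + 1) :
    ∃ (Y₁ : treeClass) (i₁ : X.1 ↪[treeLang] Y₁.1) (i₂ : Y₁.1 ↪[treeLang] Y.1) (a : Y₁.1),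
      i = i₂.comp i₁ ∧ IsOnePoint i₁ a ∧ codim i₂ = n := by
  have := finite_of_mem Y
  have hne : ((Set.range i)ᶜ).Nonempty := by
    rw [← Set.ncard_pos (Set.toFinite _)]
    exact (Nat.succ_pos n).trans_eq h.symm
  obtain ⟨a, ha⟩ := hne
  let T : Set Y.1 := insert a (Set.range i)
  refine ⟨restrict Y T, restrictLift T i (fun x => Or.inr ⟨x, rfl⟩), restrictEmbedding Y T,
    (⟨a, Or.inl rfl⟩ : T), rfl, ?_, ?_⟩
  · refine Set.eq_of_subset_of_subset ?_ ?_
    · rintro _ ⟨x, rfl⟩ hx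
      exact ha ⟨x, congrArg Subtype.val hx⟩
    · rintro ⟨z, rfl | ⟨x, rfl⟩⟩ hz
      · exact (hz rfl).elim
      · exact ⟨x, rfl⟩
  · rw [codim, range_restrictEmbedding]
    have h1 : Tᶜ = (Set.range i)ᶜ \ {a} := by
      ext z; simp [T]; tauto
    rw [h1, Set.ncard_sdiff_singleton_of_mem ha, ← codim, h, Nat.add_sub_cancel]

theorem exists_isOnePoint_of_codim_eq_one {i : X.1 ↪[treeLang] Y.1} (h : codim i = 1) :
    ∃ a, IsOnePoint i a := by
  obtain ⟨a, ha⟩ := Set.ncard_eq_one.1 h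
  exact ⟨a, by rw [IsOnePoint, ← ha, compl_compl]⟩

theorem IsOnePoint.codim_eq {i : X.1 ↪[treeLang] Y.1} {a : Y.1} (h : IsOnePoint i a) :
    codim i = 1 := by
  rw [codim, h, compl_compl, Set.ncard_singleton]

theorem weightAdditive_of_onePoint
    (H : ∀ {X Y X' : treeClass} (i : X.1 ↪[treeLang] Y.1) (j : X.1 ↪[treeLang] X'.1) (a : Y.1)
      (b : X'.1), IsOnePoint i a → IsOnePoint j b → WeightAdditive i j)
    (i : X.1 ↪[treeLang] Y.1) (j : X.1 ↪[treeLang] X'.1) : WeightAdditive i j := by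
  have key : ∀ n, ∀ {X Y X' : treeClass} (i : X.1 ↪[treeLang] Y.1) (j : X.1 ↪[treeLang] X'.1),
      codim i = n → codim j ≤ 1 → WeightAdditive i j := by
    intro n
    induction n with
    | zero =>
      intro X Y X' i j hi hj
      exact weightAdditive_of_surjective i j (surjective_of_codim_eq_zero hi)
    | succ n ih =>
      intro X Y X' i j hi hj
      rcases Nat.le_one_iff_eq_zero_or_eq_one.1 hj with h0 | h1
      · exact (weightAdditive_of_surjective j i (surjective_of_codim_eq_zero h0)).symm
      obtain ⟨b, hb⟩ := exists_isOnePoint_of_codim_eq_one h1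
      obtain ⟨Y₁, i₁, i₂, a, rfl, ha, h2⟩ := exists_factorization i hi
      exact WeightAdditive.comp (H i₁ j a b ha hb) fun Z f hf => ih i₂ f h2 (hf.trans hj)
  have key' : ∀ n, ∀ {X Y X' : treeClass} (i : X.1 ↪[treeLang] Y.1) (j : X.1 ↪[treeLang] X'.1),
      codim j = n → WeightAdditive i j := by
    intro n
    induction n with
    | zero =>
      intro X Y X' i j hj
      exact (weightAdditive_of_surjective j i (surjective_of_codim_eq_zero hj)).symm
    | succ n ih =>
      intro X Y X' i j hj
      obtain ⟨Y₁, j₁, j₂, b, rfl, hb, h2⟩ := exists_factorization j hj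
      exact (WeightAdditive.comp (key _ i j₁ rfl hb.codim_eq.le).symm
        fun Z f _ => (ih f j₂ h2).symm).symm
  exact key' _ i j rfl

end Amalgamation

/-! ### Rooted families of clusters -/

section Rooted

variable {S : Type}

/-- The bipartitions of `Option S` given by a family `H` of subsets of `S`, which are the sides not
containing `none`. -/
def rootedFamily (H : Set (Set S)) : Set (Set (Option S)) :=
  {A | (none ∉ A ∧ some ⁻¹' A ∈ H) ∨ (none ∈ A ∧ (some ⁻¹' A)ᶜ ∈ H)}

/-- Hierarchies on `S` define split systems on `Option S`. -/
theorem isSplitSystem_rootedFamily {H : Set (Set S)} (h_ne : ∀ C ∈ H, C.Nonempty)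
    (h_univ : Nonempty S → Set.univ ∈ H) (h_single : ∀ s, {s} ∈ H)
    (h_lam : ∀ C ∈ H, ∀ D ∈ H, C ⊆ D ∨ D ⊆ C ∨ Disjoint C D) :
    IsSplitSystem (rootedFamily H) where
  nonempty := by
    rintro A (⟨-, h⟩ | ⟨h, -⟩)
    · obtain ⟨s, hs⟩ := h_ne _ h
      exact ⟨some s, hs⟩
    · exact ⟨none, h⟩
  compl := by
    rintro A (⟨h1, h2⟩ | ⟨h1, h2⟩)
    · exact Or.inr ⟨h1, by rwa [Set.preimage_compl, compl_compl]⟩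
    · exact Or.inl ⟨fun h => h h1, h2⟩
  singleton := by
    rintro (_ | s) y hy
    · refine Or.inr ⟨rfl, ?_⟩
      obtain ⟨t, rfl⟩ := Option.ne_none_iff_exists'.1 hy.symm
      convert h_univ ⟨t⟩
      ext; simp
    · refine Or.inl ⟨by simp, ?_⟩
      convert h_single s
      ext; simp
  compat := by
    have key : ∀ A B : Set (Option S), none ∉ A → none ∉ B → some ⁻¹' A ∈ H → some ⁻¹' B ∈ H →
        (A ⊆ B ∨ B ⊆ A ∨ Disjoint A B) := by
      intro A B hA hB h1 h2
      rcases h_lam _ h1 _ h2 with h | h | h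
      · refine Or.inl ?_
        rintro (_ | s) hs
        exacts [(hA hs).elim, h hs]
      · refine Or.inr (Or.inl ?_)
        rintro (_ | s) hs
        exacts [(hB hs).elim, h hs]
      · refine Or.inr (Or.inr ?_)
        rw [Set.disjoint_left] at h ⊢
        rintro (_ | s) hs
        exacts [(hA hs).elim, h hs]
    have comp : ∀ A B : Set (Option S), (A ⊆ B ∨ B ⊆ A ∨ Disjoint A B) →
        Compat A B ∧ Compat Aᶜ B ∧ Compat A Bᶜ ∧ Compat Aᶜ Bᶜ := by
      intro A B h
      simp only [Set.disjoint_left] at h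
      refine ⟨?_, ?_, ?_, ?_⟩ <;> intro p q r s h1 h2 h3 h4 h5 h6 h7 h8 <;>
        (try simp only [Set.mem_compl_iff, not_not] at *) <;> rcases h with h | h | h
      exacts [h4 (h h3), h5 (h h6), h h1 h2, h8 (h h7), h1 (h h2), h h5 h6, h2 (h h1), h7 (h h8),
        h h3 h4, h6 (h h5), h3 (h h4), h h7 h8]
    rintro A (⟨h1, h2⟩ | ⟨h1, h2⟩) B (⟨h3, h4⟩ | ⟨h3, h4⟩)
    · exact (comp A B (key A B h1 h3 h2 h4)).1
    · have := (comp A Bᶜ (key A Bᶜ h1 (by simpa using h3) h2 h4)).2.2.1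
      rwa [compl_compl] at this
    · have := (comp Aᶜ B (key Aᶜ B (by simpa using h1) h3 h2 h4)).2.1
      rwa [compl_compl] at this
    · have := (comp Aᶜ Bᶜ (key Aᶜ Bᶜ (by simpa using h1) (by simpa using h3) h2 h4)).2.2.2
      rwa [compl_compl, compl_compl] at this

/-- A treelike relation is the restriction of the relation of a split system if their bipartitions
correspond. -/
theorem rel_iff_of_traces {S' : Type} {R : S → S → S → S → Prop} (hR : Treelike R)
    {F : Set (Set S')} {f : S → S'} (hf : Function.Injective f)
    (h1 : ∀ A ∈ F, WeakSplit R (f ⁻¹' A)) (h2 : ∀ C, IsSplit R C → ∃ A ∈ F, f ⁻¹' A = C)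
    (a b c d : S) : R a b c d ↔ relOf F (f a) (f b) (f c) (f d) := by
  rw [hR.iff]
  refine and_congr ?_ ⟨?_, ?_⟩
  · rw [nodup_four, nodup_four]
    simp [hf.eq_iff]
  · rintro ⟨C, hC, h3, h4⟩
    obtain ⟨A, hA, rfl⟩ := h2 C hC
    exact ⟨A, hA, h3, h4⟩
  · rintro ⟨A, hA, h3, h4⟩
    refine ⟨f ⁻¹' A, ?_, h3, h4⟩
    by_cases ha : f a ∈ A
    · exact (h1 A hA).isSplit (x := a) (y := b) ha (by simpa [Separates, ha] using h3)
    · exact (h1 A hA).isSplit (x := b) (y := a) (by simpa [Separates, ha] using h3) ha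

end Rooted

section OnePoint

variable {X Y X' Y' : treeClass}

/-- For a one-point extension `f : X → Y` by the point `a`, the clusters are the sides of the
splits of `Y` that do not contain `a`, as subsets of `X`. They determine the extension. -/
def IsCluster (f : X.1 ↪[treeLang] Y.1) (C : Set X.1) : Prop := IsSplit (quartetRel Y.1) (f '' C)

theorem IsOnePoint.apply_ne {f : X.1 ↪[treeLang] Y.1} {a : Y.1} (h : IsOnePoint f a) (x : X.1) :
    f x ≠ a := by
  have : f x ∈ Set.range f := ⟨x, rfl⟩
  rw [h] at this
  exact this

theorem IsOnePoint.exists_eq {f : X.1 ↪[treeLang] Y.1} {a : Y.1} (h : IsOnePoint f a) {y : Y.1}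
    (hy : y ≠ a) : ∃ x, f x = y := by
  have : y ∈ Set.range f := by rw [h]; exact hy
  exact this

theorem IsOnePoint.image_preimage {f : X.1 ↪[treeLang] Y.1} {a : Y.1} (h : IsOnePoint f a)
    {A : Set Y.1} (hA : a ∉ A) : f '' (f ⁻¹' A) = A := by
  rw [Set.image_preimage_eq_inter_range, h, Set.inter_eq_left]
  exact fun y hy hya => hA (hya ▸ hy)

theorem IsOnePoint.notMem_image {f : X.1 ↪[treeLang] Y.1} {a : Y.1} (h : IsOnePoint f a)
    (C : Set X.1) : a ∉ f '' C := by
  rintro ⟨x, -, hx⟩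
  exact h.apply_ne x hx

theorem IsOnePoint.isCluster_preimage {f : X.1 ↪[treeLang] Y.1} {a : Y.1} (h : IsOnePoint f a)
    {A : Set Y.1} (hA : a ∉ A) : IsCluster f (f ⁻¹' A) ↔ IsSplit (quartetRel Y.1) A := by
  rw [IsCluster, h.image_preimage hA]

theorem IsCluster.nonempty {f : X.1 ↪[treeLang] Y.1} {C : Set X.1} (h : IsCluster f C) :
    C.Nonempty := Set.image_nonempty.1 h.1

theorem IsOnePoint.image_univ {f : X.1 ↪[treeLang] Y.1} {a : Y.1} (h : IsOnePoint f a) :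
    f '' Set.univ = {a}ᶜ := by rw [Set.image_univ, h]

theorem IsOnePoint.isCluster_univ {f : X.1 ↪[treeLang] Y.1} {a : Y.1} (h : IsOnePoint f a)
    (hX : Nonempty X.1) : IsCluster f Set.univ := by
  obtain ⟨x⟩ := hX
  rw [IsCluster, h.image_univ]
  exact (isSplit_singleton (h.apply_ne x).symm).compl (treelike_of_mem Y)

theorem IsOnePoint.isCluster_singleton {f : X.1 ↪[treeLang] Y.1} {a : Y.1} (h : IsOnePoint f a)
    (x : X.1) : IsCluster f {x} := by
  rw [IsCluster, Set.image_singleton]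
  exact isSplit_singleton (h.apply_ne x)

theorem IsOnePoint.laminar {f : X.1 ↪[treeLang] Y.1} {a : Y.1} (h : IsOnePoint f a) {C D : Set X.1}
    (hC : IsCluster f C) (hD : IsCluster f D) : C ⊆ D ∨ D ⊆ C ∨ Disjoint C D := by
  by_contra! hne
  obtain ⟨h1, h2, h3⟩ := hne
  obtain ⟨q, hq, hq'⟩ := Set.not_subset.1 h1
  obtain ⟨r, hr, hr'⟩ := Set.not_subset.1 h2
  obtain ⟨p, hp, hp'⟩ := Set.not_disjoint_iff.1 h3
  have hinj := f.injective
  refine IsSplit.compat (treelike_of_mem Y) hC hD (f p) (f q) (f r) a ⟨p, hp, rfl⟩ ⟨p, hp', rfl⟩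
    ⟨q, hq, rfl⟩ ?_ ?_ ⟨r, hr, rfl⟩ (h.notMem_image C) (h.notMem_image D) <;>
  rwa [hinj.mem_set_image]

theorem IsOnePoint.weakSplit_of_isCluster {f : X.1 ↪[treeLang] Y.1} {C : Set X.1}
    (hC : IsCluster f C) : WeakSplit (quartetRel X.1) C := by
  have := hC.trace (quartetRel_embedding f) f.injective
  rwa [Set.preimage_image_eq _ f.injective] at this

/-- A split of `X` has a side that remains a side of a split when the point `a` is added to the
other side. -/
theorem IsOnePoint.isCluster_or {f : X.1 ↪[treeLang] Y.1} {a : Y.1} (h : IsOnePoint f a)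
    {C : Set X.1} (hC : IsSplit (quartetRel X.1) C) : IsCluster f C ∨ IsCluster f Cᶜ := by
  have := finite_of_mem X
  obtain ⟨A, hA, rfl⟩ := hC.exists_trace (quartetRel_embedding f) f.injective (treelike_of_mem Y)
  by_cases ha : a ∈ A
  · right
    rw [← Set.preimage_compl, h.isCluster_preimage (by simpa using ha)]
    exact hA.compl (treelike_of_mem Y)
  · left
    rwa [h.isCluster_preimage ha]

/-- A one-point extension of `X`, as the type `Option X`. -/
noncomputable def IsOnePoint.equivOption {f : X.1 ↪[treeLang] Y.1} {a : Y.1} (h : IsOnePoint f a) :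
    Option X.1 ≃ Y.1 :=
  Equiv.ofBijective (fun o => o.elim a f) ⟨by
    rintro (_ | x) (_ | y) hxy
    · rfl
    · exact (h.apply_ne y hxy.symm).elim
    · exact (h.apply_ne x hxy).elim
    · exact congrArg some (f.injective hxy), fun y => by
    by_cases hy : y = a
    · exact ⟨none, hy.symm⟩
    · obtain ⟨x, hx⟩ := h.exists_eq hy
      exact ⟨some x, hx⟩⟩

/-- Two one-point extensions of `X` with the same clusters are isomorphic over `X`. -/
theorem IsOnePoint.exists_equiv {f : X.1 ↪[treeLang] Y.1} {a : Y.1} (h : IsOnePoint f a)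
    {f' : X.1 ↪[treeLang] Y'.1} {a' : Y'.1} (h' : IsOnePoint f' a')
    (hC : ∀ C, IsCluster f C ↔ IsCluster f' C) :
    ∃ e : Y.1 ≃[treeLang] Y'.1, (∀ x, e (f x) = f' x) ∧ e a = a' := by
  let e : Y.1 ≃ Y'.1 := h.equivOption.symm.trans h'.equivOption
  have he1 : ∀ x, e (f x) = f' x := by
    intro x
    have : h.equivOption.symm (f x) = some x := by
      rw [Equiv.symm_apply_eq]; rfl
    simp only [e, Equiv.trans_apply, this]
    rfl
  have he2 : e a = a' := by
    have : h.equivOption.symm a = none := by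
      rw [Equiv.symm_apply_eq]; rfl
    simp only [e, Equiv.trans_apply, this]
    rfl
  have hY := treelike_of_mem Y
  have hY' := treelike_of_mem Y'
  have hnone : ∀ A : Set Y'.1, a' ∉ A → (IsSplit (quartetRel Y.1) (e ⁻¹' A) ↔
      IsSplit (quartetRel Y'.1) A) := by
    intro A hA
    rw [← h.isCluster_preimage (by simpa [he2] using hA), ← h'.isCluster_preimage hA, hC]
    have : f ⁻¹' (e ⁻¹' A) = f' ⁻¹' A := by
      ext x; simp [he1]
    rw [this]
  have hall : ∀ A : Set Y'.1, (IsSplit (quartetRel Y.1) (e ⁻¹' A) ↔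
      IsSplit (quartetRel Y'.1) A) := by
    intro A
    by_cases hA : a' ∈ A
    · rw [← isSplit_compl_iff hY, ← isSplit_compl_iff hY', ← Set.preimage_compl]
      exact hnone _ (by simpa using hA)
    · exact hnone A hA
  refine ⟨mkEquiv e fun a b c d => ?_, he1, he2⟩
  rw [hY'.iff]
  refine (rel_iff_of_traces hY e.injective ?_ ?_ a b c d).symm
  · exact fun A hA => Or.inl ((hall A).2 hA)
  · intro C hC
    refine ⟨e.symm ⁻¹' C, ?_, ?_⟩
    · change IsSplit _ _
      rw [← hall]
      convert hC
      ext; simp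
    · ext; simp

theorem IsOnePoint.preimage_cases {f : X.1 ↪[treeLang] Y.1} {a : Y.1} (h : IsOnePoint f a)
    (D : Set Y.1) : D = f '' (f ⁻¹' D) ∨ D = insert a (f '' (f ⁻¹' D)) := by
  by_cases ha : a ∈ D
  · right
    ext y
    by_cases hy : y = a
    · simp [hy, ha]
    · obtain ⟨x, rfl⟩ := h.exists_eq hy
      simp [hy]
  · left
    exact (h.image_preimage ha).symm

theorem IsOnePoint.compl_image {f : X.1 ↪[treeLang] Y.1} {a : Y.1} (h : IsOnePoint f a)
    (C : Set X.1) : (f '' C)ᶜ = insert a (f '' Cᶜ) := by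
  ext y
  by_cases hy : y = a
  · simp [hy, h.apply_ne]
  · obtain ⟨x, rfl⟩ := h.exists_eq hy
    simp [h.apply_ne]

theorem IsOnePoint.preimage_insert {f : X.1 ↪[treeLang] Y.1} {a : Y.1} (h : IsOnePoint f a)
    (C : Set X.1) : f ⁻¹' (insert a (f '' C)) = C := by
  ext x
  simp [h.apply_ne]

end OnePoint

/-! ### Amalgamations of two one-point extensions -/

section Gluing

variable {X Y X' : treeClass} {i : X.1 ↪[treeLang] Y.1} {j : X.1 ↪[treeLang] X'.1}
  {a : Y.1} {b : X'.1}

/-- The data that describe an amalgamation of the one-point extensions `i` by `a` and `j` by `b` in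
which the two new points differ: the proposition `n` says that `{a, b}` is a side of a split, and
`E` is the set of all `C ⊆ X` for which `C ∪ {b}` is a side of a split. It always contains `∅` and
`X`, for the splits `{b}` and `{a}ᶜ`. The other conditions express that the restrictions of splits
are splits (`mem`), that splits are compatible (`compl`, `exclusive`), and that every split of one
of the two extensions comes from the amalgamation (`left`, `right`). If `X` has a single point, then
its complement `{a, b}` is a side of a split (`small`). -/
structure IsGluing (i : X.1 ↪[treeLang] Y.1) (j : X.1 ↪[treeLang] X'.1) (n : Prop)
    (E : Set (Set X.1)) : Prop where
  empty : ∅ ∈ E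
  univ : Set.univ ∈ E
  mem : ∀ C ∈ E, C ≠ ∅ → C ≠ Set.univ → IsCluster i C ∧ IsCluster j Cᶜ
  compl : ∀ C ∈ E, Cᶜ ∈ E → C = ∅ ∨ C = Set.univ
  exclusive : n → ∀ C ∈ E, C = ∅ ∨ C = Set.univ
  left : ∀ C, IsCluster i C → C ≠ Set.univ → ¬ IsCluster j C → C ∈ E
  right : ∀ C, IsCluster j C → C ≠ Set.univ → ¬ IsCluster i C → Cᶜ ∈ E
  nonempty : n → Nonempty X.1
  small : Nonempty X.1 → Subsingleton X.1 → n

/-- The clusters, as seen from `a`, of the amalgamation with given data, as subsets of the target of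
`j`. Those that do not contain `b` come from common clusters of `i` and `j`, where the whole of `X`
is only allowed if `{a, b}` is a side of a split. -/
def gluingFamily (i : X.1 ↪[treeLang] Y.1) (j : X.1 ↪[treeLang] X'.1) (b : X'.1) (n : Prop)
    (E : Set (Set X.1)) : Set (Set X'.1) :=
  {D | (b ∉ D ∧ IsCluster i (j ⁻¹' D) ∧ IsCluster j (j ⁻¹' D) ∧ (j ⁻¹' D = Set.univ → n)) ∨
    (b ∈ D ∧ j ⁻¹' D ∈ E)}

section Construction

variable {n : Prop} {E : Set (Set X.1)}

theorem IsGluing.laminar (hi : IsOnePoint i a) (hj : IsOnePoint j b) (h : IsGluing i j n E) :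
    ∀ C ∈ gluingFamily i j b n E, ∀ D ∈ gluingFamily i j b n E, C ⊆ D ∨ D ⊆ C ∨ Disjoint C D := by
  have hsub : ∀ C D : Set X'.1, (b ∈ C → b ∈ D) → j ⁻¹' C ⊆ j ⁻¹' D → C ⊆ D := by
    intro C D h1 h2 y hy
    by_cases hyb : y = b
    · subst hyb; exact h1 hy
    · obtain ⟨x, rfl⟩ := hj.exists_eq hyb
      exact h2 hy
  have hdisj : ∀ C D : Set X'.1, ¬ (b ∈ C ∧ b ∈ D) → Disjoint (j ⁻¹' C) (j ⁻¹' D) →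
      Disjoint C D := by
    intro C D h1 h2
    rw [Set.disjoint_left]
    intro y hy hy'
    by_cases hyb : y = b
    · subst hyb; exact h1 ⟨hy, hy'⟩
    · obtain ⟨x, rfl⟩ := hj.exists_eq hyb
      exact Set.disjoint_left.1 h2 hy hy'
  -- the case in which only the second cluster contains `b`
  have mixed : ∀ C D : Set X'.1, b ∉ C → IsCluster i (j ⁻¹' C) → IsCluster j (j ⁻¹' C) →
      (j ⁻¹' C = Set.univ → n) → b ∈ D → j ⁻¹' D ∈ E → C ⊆ D ∨ Disjoint C D := by
    intro C D h1 h2 h3 h4 h5 h6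
    by_cases hD0 : j ⁻¹' D = ∅
    · exact Or.inr (hdisj _ _ (fun h => h1 h.1) (by rw [hD0]; exact Set.disjoint_empty _))
    by_cases hD1 : j ⁻¹' D = Set.univ
    · exact Or.inl (hsub _ _ (fun h => (h1 h).elim) (by rw [hD1]; exact Set.subset_univ _))
    obtain ⟨h7, h8⟩ := h.mem _ h6 hD0 hD1
    rcases hi.laminar h2 h7 with h9 | h9 | h9
    · exact Or.inl (hsub _ _ (fun h => (h1 h).elim) h9)
    · rcases hj.laminar h3 h8 with h10 | h10 | h10
      · obtain ⟨x, hx⟩ := Set.nonempty_iff_ne_empty.2 hD0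
        exact (h10 (h9 hx) hx).elim
      · have : j ⁻¹' C = Set.univ := by
          rw [Set.eq_univ_iff_forall]
          intro x
          by_cases hx : x ∈ j ⁻¹' D
          exacts [h9 hx, h10 hx]
        rcases h.exclusive (h4 this) _ h6 with h | h
        exacts [(hD0 h).elim, (hD1 h).elim]
      · refine Or.inl (hsub _ _ (fun h => (h1 h).elim) ?_)
        rwa [Set.disjoint_compl_right_iff_subset] at h10
    · exact Or.inr (hdisj _ _ (fun h => h1 h.1) h9)
  rintro C (⟨h1, h2, h3, h4⟩ | ⟨h1, h2⟩) D (⟨h5, h6, h7, h8⟩ | ⟨h5, h6⟩)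
  · rcases hi.laminar h2 h6 with h | h | h
    · exact Or.inl (hsub _ _ (fun h => (h1 h).elim) h)
    · exact Or.inr (Or.inl (hsub _ _ (fun h => (h5 h).elim) h))
    · exact Or.inr (Or.inr (hdisj _ _ (fun h => h1 h.1) h))
  · rcases mixed C D h1 h2 h3 h4 h5 h6 with h | h
    exacts [Or.inl h, Or.inr (Or.inr h)]
  · rcases mixed D C h5 h6 h7 h8 h1 h2 with h | h
    exacts [Or.inr (Or.inl h), Or.inr (Or.inr h.symm)]
  · by_cases hC0 : j ⁻¹' C = ∅
    · exact Or.inl (hsub _ _ (fun _ => h5) (by rw [hC0]; exact Set.empty_subset _))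
    by_cases hC1 : j ⁻¹' C = Set.univ
    · exact Or.inr (Or.inl (hsub _ _ (fun _ => h1) (by rw [hC1]; exact Set.subset_univ _)))
    by_cases hD0 : j ⁻¹' D = ∅
    · exact Or.inr (Or.inl (hsub _ _ (fun _ => h1) (by rw [hD0]; exact Set.empty_subset _)))
    by_cases hD1 : j ⁻¹' D = Set.univ
    · exact Or.inl (hsub _ _ (fun _ => h5) (by rw [hD1]; exact Set.subset_univ _))
    obtain ⟨g1, g2⟩ := h.mem _ h2 hC0 hC1
    obtain ⟨g3, g4⟩ := h.mem _ h6 hD0 hD1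
    rcases hi.laminar g1 g3 with h9 | h9 | h9
    · exact Or.inl (hsub _ _ (fun _ => h5) h9)
    · exact Or.inr (Or.inl (hsub _ _ (fun _ => h1) h9))
    rcases hj.laminar g2 g4 with h10 | h10 | h10
    · exact Or.inr (Or.inl (hsub _ _ (fun _ => h1) (Set.compl_subset_compl.1 h10)))
    · exact Or.inl (hsub _ _ (fun _ => h5) (Set.compl_subset_compl.1 h10))
    · have : (j ⁻¹' C)ᶜ = j ⁻¹' D := by
        ext x
        have e1 : x ∈ j ⁻¹' C → x ∉ j ⁻¹' D := fun h => Set.disjoint_left.1 h9 h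
        have e2 : x ∉ j ⁻¹' C → ¬ x ∉ j ⁻¹' D := fun h => Set.disjoint_left.1 h10 h
        exact ⟨fun h => not_not.1 (e2 h), fun h h' => e1 h' h⟩
      rcases h.compl _ h2 (this ▸ h6) with h | h
      exacts [(hC0 h).elim, (hC1 h).elim]

theorem IsGluing.isSplitSystem (hi : IsOnePoint i a) (hj : IsOnePoint j b) (h : IsGluing i j n E) :
    IsSplitSystem (rootedFamily (gluingFamily i j b n E)) := by
  refine isSplitSystem_rootedFamily ?_ ?_ ?_ (h.laminar hi hj)
  · rintro C (⟨-, h1, -⟩ | ⟨h1, -⟩)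
    · obtain ⟨x, hx⟩ := h1.nonempty
      exact ⟨j x, hx⟩
    · exact ⟨b, h1⟩
  · exact fun _ => Or.inr ⟨trivial, h.univ⟩
  · intro s
    by_cases hs : s = b
    · subst hs
      refine Or.inr ⟨rfl, ?_⟩
      convert h.empty
      ext x
      simp [hj.apply_ne]
    · obtain ⟨x, rfl⟩ := hj.exists_eq hs
      have : j ⁻¹' {j x} = {x} := by ext y; simp
      refine Or.inl ⟨fun h => hs h.symm, ?_⟩
      rw [this]
      refine ⟨hi.isCluster_singleton x, hj.isCluster_singleton x, fun hu => h.small ⟨x⟩ ⟨?_⟩⟩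
      intro y z
      have hy : y ∈ ({x} : Set X.1) := hu ▸ Set.mem_univ y
      have hz : z ∈ ({x} : Set X.1) := hu ▸ Set.mem_univ z
      exact hy.trans hz.symm

theorem IsGluing.weakSplit (hj : IsOnePoint j b) (h : IsGluing i j n E)
    {D : Set X'.1} (hD : D ∈ gluingFamily i j b n E) : WeakSplit (quartetRel X'.1) D := by
  rcases hD with ⟨h1, -, h2, -⟩ | ⟨h1, h2⟩
  · exact Or.inl ((hj.isCluster_preimage h1).1 h2)
  · have hcompl : b ∉ Dᶜ := by simpa using h1
    by_cases h3 : j ⁻¹' D = ∅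
    · rw [← weakSplit_compl_iff (treelike_of_mem X')]
      rcases isEmpty_or_nonempty X.1 with hX | hX
      · right; left
        rw [Set.eq_empty_iff_forall_notMem]
        intro y hy
        obtain ⟨x, -⟩ := hj.exists_eq (fun h => hcompl (h ▸ hy) : y ≠ b)
        exact hX.elim x
      · left
        rw [← hj.isCluster_preimage hcompl, Set.preimage_compl, h3, Set.compl_empty]
        exact hj.isCluster_univ hX
    by_cases h4 : j ⁻¹' D = Set.univ
    · right; right
      rw [Set.eq_univ_iff_forall]
      intro y
      by_cases hy : y = b
      · exact hy ▸ h1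
      · obtain ⟨x, rfl⟩ := hj.exists_eq hy
        exact Set.eq_univ_iff_forall.1 h4 x
    rw [← weakSplit_compl_iff (treelike_of_mem X')]
    left
    rw [← hj.isCluster_preimage hcompl]
    exact (h.mem _ h2 h3 h4).2

theorem IsGluing.mem_or_compl_mem (hj : IsOnePoint j b) (h : IsGluing i j n E)
    {D : Set X'.1} (hD : IsSplit (quartetRel X'.1) D) :
    D ∈ gluingFamily i j b n E ∨ Dᶜ ∈ gluingFamily i j b n E := by
  have key : ∀ D, b ∉ D → IsSplit (quartetRel X'.1) D →
      D ∈ gluingFamily i j b n E ∨ Dᶜ ∈ gluingFamily i j b n E := by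
    intro D hb hD
    have h1 := (hj.isCluster_preimage hb).2 hD
    by_cases hu : j ⁻¹' D = Set.univ
    · refine Or.inr (Or.inr ⟨hb, ?_⟩)
      rw [Set.preimage_compl, hu, Set.compl_univ]
      exact h.empty
    by_cases h2 : IsCluster i (j ⁻¹' D)
    · exact Or.inl (Or.inl ⟨hb, h2, h1, fun h => (hu h).elim⟩)
    · exact Or.inr (Or.inr ⟨hb, h.right _ h1 hu h2⟩)
  by_cases hb : b ∈ D
  · have := key Dᶜ (by simpa using hb) (hD.compl (treelike_of_mem X'))
    rw [compl_compl] at this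
    exact this.symm
  · exact key D hb hD

open scoped Classical in
/-- Every gluing datum comes from an amalgamation. -/
theorem IsGluing.exists_amalgam (hi : IsOnePoint i a) (hj : IsOnePoint j b)
    (h : IsGluing i j n E) :
    ∃ B : Amalgam i j, B.inl a ≠ B.inr b ∧
      ∀ D, IsCluster B.inr D ↔ D ∈ gluingFamily i j b n E := by
  have hF := h.isSplitSystem hi hj
  have := finite_of_mem X'
  let F := rootedFamily (gluingFamily i j b n E)
  let Z : treeClass := treelikeStructure hF.treelike
  have hX' := treelike_of_mem X'
  have hY := treelike_of_mem Y
  have hr : ∀ s t u v, relOf F (some s) (some t) (some u) (some v) ↔ quartetRel X'.1 s t u v := by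
    intro s t u v
    refine (rel_iff_of_traces hX' (Option.some_injective _) ?_ ?_ s t u v).symm
    · rintro A (⟨-, h1⟩ | ⟨-, h1⟩)
      · exact h.weakSplit hj h1
      · exact (weakSplit_compl_iff hX').1 (h.weakSplit hj h1)
    · intro C hC
      rcases h.mem_or_compl_mem hj hC with h1 | h1
      · refine ⟨some '' C, Or.inl ⟨by simp, ?_⟩, Set.preimage_image_eq _ (Option.some_injective _)⟩
        rwa [Set.preimage_image_eq _ (Option.some_injective _)]
      · have : some ⁻¹' (insert none (some '' C)) = C := by ext; simp
        refine ⟨insert none (some '' C), Or.inr ⟨by simp, ?_⟩, this⟩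
        rwa [this]
  let g : Y.1 → Option X'.1 := fun y => Option.map j (hi.equivOption.symm y)
  have hga : g a = none := by
    have : hi.equivOption.symm a = none := by rw [Equiv.symm_apply_eq]; rfl
    simp [g, this]
  have hgi : ∀ x, g (i x) = some (j x) := by
    intro x
    have : hi.equivOption.symm (i x) = some x := by rw [Equiv.symm_apply_eq]; rfl
    simp [g, this]
  have hg : Function.Injective g :=
    (Option.map_injective j.injective).comp hi.equivOption.symm.injective
  have hgimg : ∀ A : Set (Option X'.1), none ∉ A → g ⁻¹' A = i '' (j ⁻¹' (some ⁻¹' A)) := by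
    intro A hA
    rw [← hi.image_preimage (A := g ⁻¹' A) (by simpa [hga] using hA)]
    congr 1
    ext x
    simp [hgi]
  have htr : ∀ A : Set (Option X'.1), none ∉ A → some ⁻¹' A ∈ gluingFamily i j b n E →
      WeakSplit (quartetRel Y.1) (g ⁻¹' A) := by
    intro A hA h1
    rw [hgimg A hA]
    rcases h1 with ⟨-, h1, -⟩ | ⟨-, h1⟩
    · exact Or.inl h1
    by_cases h3 : j ⁻¹' (some ⁻¹' A) = ∅
    · rw [h3]; exact Or.inr (Or.inl (Set.image_empty _))
    by_cases h4 : j ⁻¹' (some ⁻¹' A) = Set.univ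
    · rw [h4]
      obtain ⟨x, -⟩ := Set.nonempty_iff_ne_empty.2 h3
      exact Or.inl (hi.isCluster_univ ⟨x⟩)
    exact Or.inl (h.mem _ h1 h3 h4).1
  have hex : ∀ C : Set X.1, IsCluster i C → ∃ D ∈ gluingFamily i j b n E, j ⁻¹' D = C := by
    intro C hC
    by_cases hu : C = Set.univ
    · exact ⟨Set.univ, Or.inr ⟨trivial, h.univ⟩, by rw [hu]; rfl⟩
    by_cases hq : IsCluster j C
    · have := Set.preimage_image_eq C j.injective
      exact ⟨j '' C, Or.inl ⟨hj.notMem_image C, by rwa [this], by rwa [this],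
        fun h => (hu (this ▸ h)).elim⟩, this⟩
    · have := hj.preimage_insert C
      exact ⟨insert b (j '' C), Or.inr ⟨by simp, by rw [this]; exact h.left C hC hu hq⟩, this⟩
  have hsplit : ∀ C, IsSplit (quartetRel Y.1) C → ∃ A ∈ F, g ⁻¹' A = C := by
    have key : ∀ C, a ∉ C → IsSplit (quartetRel Y.1) C → ∃ A ∈ F, g ⁻¹' A = C := by
      intro C ha hC
      obtain ⟨D, hD, hDC⟩ := hex _ ((hi.isCluster_preimage ha).2 hC)
      have h1 : some ⁻¹' (some '' D) = D := Set.preimage_image_eq _ (Option.some_injective _)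
      refine ⟨some '' D, Or.inl ⟨by simp, by rwa [h1]⟩, ?_⟩
      rw [hgimg _ (by simp), h1, hDC, hi.image_preimage ha]
    intro C hC
    by_cases ha : a ∈ C
    · obtain ⟨A, hA, hAC⟩ := key Cᶜ (by simpa using ha) (hC.compl hY)
      exact ⟨Aᶜ, hF.compl A hA, by rw [Set.preimage_compl, hAC, compl_compl]⟩
    · exact key C ha hC
  have hl : ∀ s t u v, relOf F (g s) (g t) (g u) (g v) ↔ quartetRel Y.1 s t u v := by
    intro s t u v
    refine (rel_iff_of_traces hY hg ?_ hsplit s t u v).symm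
    rintro A (⟨h0, h1⟩ | ⟨h0, h1⟩)
    · exact htr A h0 h1
    · rw [← weakSplit_compl_iff hY, ← Set.preimage_compl]
      exact htr Aᶜ (by simpa using h0) h1
  let B : Amalgam i j :=
    { Z := Z
      inl := mkEmbedding (Y := Z.1) g hg hl
      inr := mkEmbedding (Y := Z.1) (some : X'.1 → Option X'.1) (Option.some_injective _) hr
      comm := by ext x; exact hgi x
      cover := by
        rw [Set.eq_univ_iff_forall]
        rintro (_ | x)
        · exact Or.inl ⟨a, hga⟩
        · exact Or.inr ⟨x, rfl⟩ }
  refine ⟨B, ?_, fun D => ?_⟩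
  · change g a ≠ some b
    rw [hga]; exact (Option.some_ne_none b).symm
  · change IsSplit (relOf F) (some '' D) ↔ _
    rw [hF.isSplit_iff]
    simp [rootedFamily, Set.preimage_image_eq _ (Option.some_injective _)]

end Construction

/-! ### Analysis of an amalgamation -/

theorem Amalgam.isOnePoint_inr (B : Amalgam i j) (hi : IsOnePoint i a) (hj : IsOnePoint j b)
    (hB : B.inl a ≠ B.inr b) : IsOnePoint B.inr (B.inl a) := by
  have hc : ∀ x, B.inl (i x) = B.inr (j x) := DFunLike.congr_fun B.comm
  refine Set.eq_of_subset_of_subset ?_ ?_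
  · rintro _ ⟨y, rfl⟩ hy
    by_cases hyb : y = b
    · exact hB (hyb ▸ hy).symm
    · obtain ⟨x, rfl⟩ := hj.exists_eq hyb
      rw [← hc] at hy
      exact hi.apply_ne x (B.inl.injective hy)
  · intro z hz
    rcases Set.eq_univ_iff_forall.1 B.cover z with ⟨y, rfl⟩ | h
    · obtain ⟨x, rfl⟩ := hi.exists_eq (fun h => hz (h ▸ rfl) : y ≠ a)
      exact ⟨j x, (hc x).symm⟩
    · exact h

theorem Amalgam.isOnePoint_inl (B : Amalgam i j) (hi : IsOnePoint i a) (hj : IsOnePoint j b)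
    (hB : B.inl a ≠ B.inr b) : IsOnePoint B.inl (B.inr b) :=
  B.swap.isOnePoint_inr hj hi hB.symm

theorem Amalgam.isCluster_image (B : Amalgam i j) (hi : IsOnePoint i a) (hj : IsOnePoint j b)
    {C : Set X.1} (h : IsCluster B.inr (j '' C)) :
    IsCluster i C ∧ IsCluster j C := by
  have hc : ∀ x, B.inl (i x) = B.inr (j x) := DFunLike.congr_fun B.comm
  obtain ⟨x, hx⟩ := Set.image_nonempty.1 h.nonempty
  constructor
  · have h' : IsCluster B.inl (i '' C) := by
      rw [IsCluster, Set.image_image] at h ⊢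
      simpa only [hc] using h
    exact (IsOnePoint.weakSplit_of_isCluster h').isSplit (Set.mem_image_of_mem i hx)
      (hi.notMem_image C)
  · exact (IsOnePoint.weakSplit_of_isCluster h).isSplit (Set.mem_image_of_mem j hx)
      (hj.notMem_image C)

theorem Amalgam.compl_insert (B : Amalgam i j) (hi : IsOnePoint i a) (hj : IsOnePoint j b)
    (hB : B.inl a ≠ B.inr b) (C : Set X.1) :
    (B.inr '' (insert b (j '' C)))ᶜ = B.inl '' (insert a (i '' Cᶜ)) := by
  have hc : ∀ x, B.inl (i x) = B.inr (j x) := DFunLike.congr_fun B.comm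
  rw [(B.isOnePoint_inr hi hj hB).compl_image, ← compl_compl (insert b (j '' C)),
    show insert b (j '' C) = (j '' Cᶜ)ᶜ by rw [hj.compl_image, compl_compl], compl_compl,
    compl_compl, Set.image_insert_eq, Set.image_image, Set.image_image]
  simp only [hc]

/-- `{a, b}` is a side of a split of the amalgamation, stated for its complement `X`. -/
def Amalgam.IsCherry (B : Amalgam i j) : Prop := IsCluster B.inr (j '' Set.univ)

/-- The sets `C` for which `C ∪ {b}` is a cluster, as seen from `a`. -/
def Amalgam.mixedClusters (B : Amalgam i j) (b : X'.1) : Set (Set X.1) :=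
  {C | IsCluster B.inr (insert b (j '' C))}

theorem Amalgam.isCluster_or_mem (B : Amalgam i j) (hi : IsOnePoint i a) (hj : IsOnePoint j b)
    (hB : B.inl a ≠ B.inr b) {C : Set X.1} (h : IsCluster i C) :
    IsCluster B.inr (j '' C) ∨ C ∈ B.mixedClusters b := by
  have hc : ∀ x, B.inl (i x) = B.inr (j x) := DFunLike.congr_fun B.comm
  rcases (B.isOnePoint_inl hi hj hB).isCluster_or h with h1 | h1
  · left
    rw [IsCluster, Set.image_image] at h1 ⊢
    simpa only [hc] using h1
  · right
    rw [hi.compl_image, IsCluster, ← B.compl_insert hi hj hB,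
      isSplit_compl_iff (treelike_of_mem _)] at h1
    exact h1

theorem Amalgam.isCluster_or_compl_mem (B : Amalgam i j) (hi : IsOnePoint i a)
    (hj : IsOnePoint j b) (hB : B.inl a ≠ B.inr b) {C : Set X.1} (h : IsCluster j C) :
    IsCluster B.inr (j '' C) ∨ Cᶜ ∈ B.mixedClusters b := by
  rcases (B.isOnePoint_inr hi hj hB).isCluster_or h with h1 | h1
  · exact Or.inl h1
  · rw [hj.compl_image] at h1
    exact Or.inr h1

theorem Amalgam.isGluing (B : Amalgam i j) (hi : IsOnePoint i a) (hj : IsOnePoint j b)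
    (hB : B.inl a ≠ B.inr b) : IsGluing i j B.IsCherry (B.mixedClusters b) := by
  have hc : ∀ x, B.inl (i x) = B.inr (j x) := DFunLike.congr_fun B.comm
  have hr := B.isOnePoint_inr hi hj hB
  have hl := B.isOnePoint_inl hi hj hB
  have hZ := treelike_of_mem B.Z
  refine ⟨?_, ?_, ?_, ?_, ?_, ?_, ?_, ?_, ?_⟩
  · have : insert b (j '' (∅ : Set X.1)) = {b} := by simp
    change IsCluster _ _
    rw [this]
    exact hr.isCluster_singleton b
  · have : insert b (j '' (Set.univ : Set X.1)) = Set.univ := by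
      rw [hj.image_univ]
      ext y
      simp [em]
    change IsCluster _ _
    rw [this]
    exact hr.isCluster_univ ⟨b⟩
  · intro C hC h0 h1
    constructor
    · have h2 := (isSplit_compl_iff hZ).2 hC
      rw [B.compl_insert hi hj hB] at h2
      have h3 := (weakSplit_compl_iff (treelike_of_mem Y)).2 (IsOnePoint.weakSplit_of_isCluster h2)
      rw [← hi.compl_image, compl_compl] at h3
      obtain ⟨x, hx⟩ := Set.nonempty_iff_ne_empty.2 h0
      exact h3.isSplit (Set.mem_image_of_mem i hx) (hi.notMem_image C)
    · have h3 := (weakSplit_compl_iff (treelike_of_mem X')).2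
        (IsOnePoint.weakSplit_of_isCluster hC)
      obtain ⟨x, hx⟩ := (Set.ne_univ_iff_exists_notMem C).1 h1
      have h4 : (insert b (j '' C))ᶜ = j '' Cᶜ := by
        rw [← compl_compl (j '' Cᶜ), hj.compl_image, compl_compl]
      rw [h4] at h3
      exact h3.isSplit (Set.mem_image_of_mem j hx) (hj.notMem_image Cᶜ)
  · intro C hC hC'
    have hsub : ∀ C D : Set X.1, insert b (j '' C) ⊆ insert b (j '' D) → C ⊆ D := by
      intro C D h x hx
      have := h (Or.inr (Set.mem_image_of_mem j hx))
      rw [← hj.preimage_insert D]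
      exact this
    rcases hr.laminar hC hC' with h | h | h
    · left
      exact Set.eq_empty_iff_forall_notMem.2 fun x hx => hsub _ _ h hx hx
    · right
      have := hsub _ _ h
      rwa [Set.compl_subset_iff_union, Set.union_self] at this
    · exact (Set.disjoint_left.1 h (Set.mem_insert b _) (Set.mem_insert b _)).elim
  · intro hn C hC
    rcases hr.laminar hn hC with h | h | h
    · right
      rw [Set.eq_univ_iff_forall]
      intro x
      have := h (Set.mem_image_of_mem j (Set.mem_univ x))
      rw [← hj.preimage_insert C]
      exact this
    · exact (hj.notMem_image _ (h (Set.mem_insert b _))).elim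
    · left
      rw [Set.eq_empty_iff_forall_notMem]
      intro x hx
      exact Set.disjoint_left.1 h (Set.mem_image_of_mem j (Set.mem_univ x))
        (Or.inr (Set.mem_image_of_mem j hx))
  · intro C h1 _ h2
    exact (B.isCluster_or_mem hi hj hB h1).resolve_left
      (fun h => h2 (B.isCluster_image hi hj h).2)
  · intro C h1 _ h2
    exact (B.isCluster_or_compl_mem hi hj hB h1).resolve_left
      (fun h => h2 (B.isCluster_image hi hj h).1)
  · intro h
    obtain ⟨x, -⟩ := Set.image_nonempty.1 h.nonempty
    exact ⟨x⟩
  · rintro ⟨x⟩ hs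
    have : (Set.univ : Set X.1) = {x} := Set.eq_singleton_iff_unique_mem.2
      ⟨trivial, fun y _ => Subsingleton.elim _ _⟩
    rw [Amalgam.IsCherry, this, Set.image_singleton]
    exact hr.isCluster_singleton _

/-- The clusters of an amalgamation are determined by its gluing datum. -/
theorem Amalgam.isCluster_iff (B : Amalgam i j) (hi : IsOnePoint i a) (hj : IsOnePoint j b)
    (hB : B.inl a ≠ B.inr b) (D : Set X'.1) :
    IsCluster B.inr D ↔ D ∈ gluingFamily i j b B.IsCherry (B.mixedClusters b) := by
  have hg := B.isGluing hi hj hB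
  by_cases hb : b ∈ D
  · have h1 : D = insert b (j '' (j ⁻¹' D)) := by
      rcases hj.preimage_cases D with h | h
      · rw [h] at hb
        exact (hj.notMem_image _ hb).elim
      · exact h
    simp only [gluingFamily, Set.mem_ofPred_eq, hb, not_true_eq_false, false_and, true_and,
      false_or]
    conv_lhs => rw [h1]
    rfl
  · have h1 : j '' (j ⁻¹' D) = D := hj.image_preimage hb
    simp only [gluingFamily, Set.mem_ofPred_eq, hb, not_false_eq_true, false_and, true_and,
      or_false]
    constructor
    · intro h
      rw [← h1] at h
      refine ⟨(B.isCluster_image hi hj h).1, (B.isCluster_image hi hj h).2, fun hu => ?_⟩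
      rwa [hu] at h
    · rintro ⟨h2, h3, h4⟩
      by_cases hu : j ⁻¹' D = Set.univ
      · rw [← h1, hu]
        exact h4 hu
      rcases B.isCluster_or_mem hi hj hB h2 with h5 | h5
      · rwa [h1] at h5
      rcases B.isCluster_or_compl_mem hi hj hB h3 with h6 | h6
      · rwa [h1] at h6
      rcases hg.compl _ h5 h6 with h | h
      exacts [(h2.nonempty.ne_empty h).elim, (hu h).elim]

theorem Amalgam.isIso_of_gluing {B B' : Amalgam i j} (hi : IsOnePoint i a) (hj : IsOnePoint j b)
    (hB : B.inl a ≠ B.inr b) (hB' : B'.inl a ≠ B'.inr b) (h1 : B.IsCherry ↔ B'.IsCherry)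
    (h2 : B.mixedClusters b = B'.mixedClusters b) : B.IsIso B' := by
  have hc : ∀ x, B.inl (i x) = B.inr (j x) := DFunLike.congr_fun B.comm
  have hc' : ∀ x, B'.inl (i x) = B'.inr (j x) := DFunLike.congr_fun B'.comm
  obtain ⟨e, he1, he2⟩ := (B.isOnePoint_inr hi hj hB).exists_equiv (B'.isOnePoint_inr hi hj hB')
    (fun C => by rw [B.isCluster_iff hi hj hB, B'.isCluster_iff hi hj hB', h2, propext h1])
  refine ⟨e, ?_, ?_⟩
  · ext y
    change e (B.inl y) = B'.inl y
    by_cases hy : y = a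
    · rw [hy, he2]
    · obtain ⟨x, rfl⟩ := hi.exists_eq hy
      rw [hc, hc', he1]
  · ext x
    exact he1 x

theorem isSplit_image_equiv {Z Z' : treeClass} (e : Z.1 ≃[treeLang] Z'.1) {A : Set Z.1}
    (h : IsSplit (quartetRel Z.1) A) : IsSplit (quartetRel Z'.1) (e '' A) := by
  obtain ⟨x, hx⟩ := h.1
  obtain ⟨y, hy⟩ := h.2.1
  have h1 := h.trace (quartetRel_equiv e.symm) e.symm.injective
  have h2 : e '' A = e.symm ⁻¹' A := by
    ext z
    constructor
    · rintro ⟨w, hw, rfl⟩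
      simpa using hw
    · intro hz
      exact ⟨e.symm z, hz, e.apply_symm_apply z⟩
  rw [h2]
  exact h1.isSplit (x := e x) (y := e y) (by simpa using hx) (by simpa using hy)

theorem Amalgam.IsIso.isCherry {B B' : Amalgam i j} (h : B.IsIso B') (hB : B.IsCherry) :
    B'.IsCherry := by
  obtain ⟨e, -, h2⟩ := h
  have := isSplit_image_equiv e hB
  rw [Amalgam.IsCherry, IsCluster, ← h2]
  rwa [Set.image_image] at this

theorem Amalgam.IsIso.mixedClusters_subset {B B' : Amalgam i j} (h : B.IsIso B') :
    B.mixedClusters b ⊆ B'.mixedClusters b := by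
  obtain ⟨e, -, h2⟩ := h
  intro C hC
  have := isSplit_image_equiv e hC
  change IsCluster _ _
  rw [IsCluster, ← h2]
  rwa [Set.image_image] at this

theorem Amalgam.IsIso.glued {B B' : Amalgam i j} (h : B.IsIso B') (hB : B.inl a = B.inr b) :
    B'.inl a = B'.inr b := by
  obtain ⟨e, h1, h2⟩ := h
  rw [← h1, ← h2]
  exact congrArg e hB

/-! ### The amalgamation in which the two new points are identified -/

theorem Amalgam.bijective_inr_of_glued (B : Amalgam i j) (hi : IsOnePoint i a)
    (hB : B.inl a = B.inr b) : Function.Bijective B.inr := by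
  refine ⟨B.inr.injective, fun z => ?_⟩
  rcases Set.eq_univ_iff_forall.1 B.cover z with ⟨y, rfl⟩ | h
  · by_cases hy : y = a
    · exact ⟨b, by rw [hy, hB]⟩
    · obtain ⟨x, rfl⟩ := hi.exists_eq hy
      exact ⟨j x, (DFunLike.congr_fun B.comm x).symm⟩
  · exact h

theorem Amalgam.isIso_of_glued {B B' : Amalgam i j} (hi : IsOnePoint i a)
    (hB : B.inl a = B.inr b) (hB' : B'.inl a = B'.inr b) : B.IsIso B' := by
  have hc : ∀ x, B.inl (i x) = B.inr (j x) := DFunLike.congr_fun B.comm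
  have hc' : ∀ x, B'.inl (i x) = B'.inr (j x) := DFunLike.congr_fun B'.comm
  let e := equivOfBijective B.inr (B.bijective_inr_of_glued hi hB)
  let e' := equivOfBijective B'.inr (B'.bijective_inr_of_glued hi hB')
  have he : ∀ x, e'.comp e.symm (B.inr x) = B'.inr x := by
    intro x
    change e' (e.symm (e x)) = e' x
    rw [e.symm_apply_apply]
  refine ⟨e'.comp e.symm, ?_, ?_⟩
  · ext y
    change e'.comp e.symm (B.inl y) = B'.inl y
    by_cases hy : y = a
    · rw [hy, hB, hB', he]
    · obtain ⟨x, rfl⟩ := hi.exists_eq hy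
      rw [hc, hc', he]
  · ext x
    exact he x

/-- If some amalgamation identifies the two new points, the extensions have the same clusters. -/
theorem Amalgam.isCluster_iff_of_glued (B : Amalgam i j) (hi : IsOnePoint i a)
    (hj : IsOnePoint j b) (hB : B.inl a = B.inr b) (C : Set X.1) :
    IsCluster i C ↔ IsCluster j C := by
  have hc : ∀ x, B.inl (i x) = B.inr (j x) := DFunLike.congr_fun B.comm
  let e := equivOfBijective B.inr (B.bijective_inr_of_glued hi hB)
  let e' := equivOfBijective B.inl (B.swap.bijective_inr_of_glued hj hB.symm)
  have key : e' '' (i '' C) = e '' (j '' C) := by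
    rw [Set.image_image, Set.image_image]
    congr 1
    ext x
    exact hc x
  have h2 : ∀ {Z Z' : treeClass} (e : Z.1 ≃[treeLang] Z'.1) (A : Set Z.1),
      e.symm '' (e '' A) = A := by
    intro Z Z' e A
    rw [Set.image_image]
    simp
  constructor
  · intro h
    have := isSplit_image_equiv e.symm (isSplit_image_equiv e' h)
    rwa [key, h2] at this
  · intro h
    have := isSplit_image_equiv e'.symm (isSplit_image_equiv e h)
    rwa [← key, h2] at this

theorem exists_glued (hi : IsOnePoint i a) (hj : IsOnePoint j b)
    (h : ∀ C, IsCluster i C ↔ IsCluster j C) : ∃ B : Amalgam i j, B.inl a = B.inr b := by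
  obtain ⟨e, he1, he2⟩ := hi.exists_equiv hj h
  refine ⟨
    { Z := X'
      inl := e.toEmbedding
      inr := FirstOrder.Language.Embedding.refl treeLang _
      comm := by ext x; exact he1 x
      cover := by
        rw [Set.eq_univ_iff_forall]
        exact fun x => Or.inr ⟨x, rfl⟩ }, he2⟩

/-- An amalgamation with the clusters of a gluing datum has this gluing datum. -/
theorem IsGluing.isCherry_iff {n : Prop} {E : Set (Set X.1)} (hi : IsOnePoint i a)
    (hj : IsOnePoint j b) (h : IsGluing i j n E) {B : Amalgam i j}
    (hB : ∀ D, IsCluster B.inr D ↔ D ∈ gluingFamily i j b n E) :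
    (B.IsCherry ↔ n) ∧ B.mixedClusters b = E := by
  constructor
  · have h1 : j ⁻¹' (j '' Set.univ) = Set.univ := Set.preimage_image_eq _ j.injective
    rw [Amalgam.IsCherry, hB, gluingFamily, Set.mem_ofPred_eq, h1]
    have h2 := hj.notMem_image Set.univ
    constructor
    · rintro (⟨-, -, -, h3⟩ | ⟨h3, -⟩)
      exacts [h3 rfl, (h2 h3).elim]
    · intro hn
      exact Or.inl ⟨h2, hi.isCluster_univ (h.nonempty hn), hj.isCluster_univ (h.nonempty hn),
        fun _ => hn⟩
  · ext C
    change IsCluster _ _ ↔ _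
    rw [hB, gluingFamily, Set.mem_ofPred_eq, hj.preimage_insert]
    simp

/-- A list of gluing data, each of them occurring exactly once. -/
structure IsGluingList (i : X.1 ↪[treeLang] Y.1) (j : X.1 ↪[treeLang] X'.1) {κ : Type}
    (n : κ → Prop) (E : κ → Set (Set X.1)) : Prop where
  isGluing : ∀ k, IsGluing i j (n k) (E k)
  injective : ∀ k k', (n k ↔ n k') → E k = E k' → k = k'
  surjective : ∀ n' E', IsGluing i j n' E' → ∃ k, (n k ↔ n') ∧ E k = E'

/-- A list of gluing data yields a list of the amalgamations in which the new points differ. -/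
theorem IsGluingList.exists_amalgam {κ : Type} {n : κ → Prop} {E : κ → Set (Set X.1)}
    (hi : IsOnePoint i a) (hj : IsOnePoint j b) (h : IsGluingList i j n E) :
    ∃ A : κ → Amalgam i j, (∀ k, (A k).inl a ≠ (A k).inr b) ∧
      (∀ k D, IsCluster (A k).inr D ↔ D ∈ gluingFamily i j b (n k) (E k)) ∧
      ∀ B : Amalgam i j, B.inl a ≠ B.inr b → ∃! k, (A k).IsIso B := by
  choose A h1 h2 using fun k => (h.isGluing k).exists_amalgam hi hj
  have h3 := fun k => (h.isGluing k).isCherry_iff hi hj (h2 k)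
  refine ⟨A, h1, h2, fun B hB => ?_⟩
  obtain ⟨k, hk1, hk2⟩ := h.surjective _ _ (B.isGluing hi hj hB)
  refine ⟨k, Amalgam.isIso_of_gluing hi hj (h1 k) hB ((h3 k).1.trans hk1) ((h3 k).2.trans hk2), ?_⟩
  intro k' hk'
  refine h.injective k' k ?_ ?_
  · rw [hk1, ← (h3 k').1]
    exact ⟨hk'.isCherry, hk'.symm.isCherry⟩
  · rw [hk2, ← (h3 k').2]
    exact Set.Subset.antisymm hk'.mixedClusters_subset hk'.symm.mixedClusters_subset

/-- Additivity for two one-point extensions with different clusters. -/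
theorem weightAdditive_of_isGluingList (hi : IsOnePoint i a) (hj : IsOnePoint j b)
    (hne : ¬ ∀ C, IsCluster i C ↔ IsCluster j C) {κ : Type} [Fintype κ] {n : κ → Prop}
    {E : κ → Set (Set X.1)} (hg : IsGluingList i j n E) (w : κ → TauRing)
    (hw : ∀ k, ∀ B : Amalgam i j, B.inl a ≠ B.inr b →
      (∀ D, IsCluster B.inr D ↔ D ∈ gluingFamily i j b (n k) (E k)) →
      branchWeight (branchCount (quartetRel B.Z.1) (B.inl a)) = w k)
    (hsum : ∑ k, w k = branchWeight (branchCount (quartetRel Y.1) a)) : WeightAdditive i j := by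
  obtain ⟨A, h1, h2, h3⟩ := hg.exists_amalgam hi hj
  refine ⟨κ, inferInstance, A, fun B => h3 B fun hB => hne (B.isCluster_iff_of_glued hi hj hB), ?_⟩
  have h4 : ∀ k, structureWeight (A k).Z = w k * structureWeight X' := fun k => by
    rw [structureWeight_onePoint ((A k).isOnePoint_inr hi hj (h1 k)), hw k (A k) (h1 k) (h2 k)]
  simp only [h4]
  rw [← Finset.sum_mul, hsum, structureWeight_onePoint hi]
  ring

/-- Additivity for two one-point extensions with the same clusters: there is one more
amalgamation, in which the new points are identified. -/
theorem weightAdditive_of_isGluingList_of_iff (hi : IsOnePoint i a) (hj : IsOnePoint j b)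
    (heq : ∀ C, IsCluster i C ↔ IsCluster j C) {κ : Type} [Fintype κ] {n : κ → Prop}
    {E : κ → Set (Set X.1)} (hg : IsGluingList i j n E) (w : κ → TauRing)
    (hw : ∀ k, ∀ B : Amalgam i j, B.inl a ≠ B.inr b →
      (∀ D, IsCluster B.inr D ↔ D ∈ gluingFamily i j b (n k) (E k)) →
      branchWeight (branchCount (quartetRel B.Z.1) (B.inl a)) = w k)
    (hsum : 1 + ∑ k, w k = branchWeight (branchCount (quartetRel Y.1) a)) :
    WeightAdditive i j := by
  obtain ⟨A, h1, h2, h3⟩ := hg.exists_amalgam hi hj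
  obtain ⟨G, hG⟩ := exists_glued hi hj heq
  refine ⟨Option κ, inferInstance, fun k => k.elim G A, fun B => ?_, ?_⟩
  · by_cases hB : B.inl a = B.inr b
    · refine ⟨none, Amalgam.isIso_of_glued hi hG hB, ?_⟩
      rintro (_ | k) hk
      · rfl
      · exact (h1 k (hk.symm.glued hB)).elim
    · obtain ⟨k, hk, hk'⟩ := h3 B hB
      refine ⟨some k, hk, ?_⟩
      rintro (_ | l) hl
      · exact (hB (hl.glued hG)).elim
      · rw [hk' l hl]
  have h4 : ∀ k, structureWeight (A k).Z = w k * structureWeight X' := fun k => by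
    rw [structureWeight_onePoint ((A k).isOnePoint_inr hi hj (h1 k)), hw k (A k) (h1 k) (h2 k)]
  have h5 : structureWeight G.Z = structureWeight X' :=
    (structureWeight_congr (equivOfBijective G.inr (G.bijective_inr_of_glued hi hG))).symm
  rw [Fintype.sum_option]
  simp only [Option.elim, h4, h5]
  rw [← Finset.sum_mul, structureWeight_onePoint hi, ← hsum]
  ring

end Gluing

/-! ### Branches in terms of clusters -/

section Near

variable {X Y X' : treeClass} {i : X.1 ↪[treeLang] Y.1} {j : X.1 ↪[treeLang] X'.1}
  {a : Y.1} {b : X'.1}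

/-- For a one-point extension `f` of `X` by a point `a`, the points `s` and `s'` of `X` lie in the
same branch at `a`: this is `SameBranch` in terms of clusters (`IsOnePoint.near_iff`). -/
def Near (f : X.1 ↪[treeLang] Y.1) (s s' : X.1) : Prop :=
  s = s' ∨ ∃ C, IsCluster f C ∧ C ≠ Set.univ ∧ s ∈ C ∧ s' ∈ C

theorem IsOnePoint.near_iff (hi : IsOnePoint i a) (s s' : X.1) :
    Near i s s' ↔ SameBranch (quartetRel Y.1) a (i s) (i s') := by
  constructor
  · rintro (rfl | ⟨C, h1, h2, h3, h4⟩)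
    · exact Or.inl rfl
    · refine Or.inr ⟨i '' C, h1, hi.notMem_image C, ?_, Set.mem_image_of_mem i h3,
        Set.mem_image_of_mem i h4⟩
      rw [← hi.image_univ]
      exact fun h => h2 (i.injective.image_injective h)
  · rintro (h | ⟨D, h1, h2, h3, h4, h5⟩)
    · exact Or.inl (i.injective h)
    · refine Or.inr ⟨i ⁻¹' D, (hi.isCluster_preimage h2).2 h1, fun h => h3 ?_, h4, h5⟩
      rw [← hi.image_preimage h2, h, hi.image_univ]

theorem Near.symm {s s' : X.1} (h : Near i s s') : Near i s' s := by
  rcases h with h | ⟨C, h1, h2, h3, h4⟩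
  exacts [Or.inl h.symm, Or.inr ⟨C, h1, h2, h4, h3⟩]

theorem Near.trans (hi : IsOnePoint i a) {s s' s'' : X.1} (h : Near i s s') (h' : Near i s' s'') :
    Near i s s'' := by
  rw [hi.near_iff] at h h' ⊢
  exact h.trans (treelike_of_mem Y) h'

theorem IsOnePoint.branchCount_eq (hi : IsOnePoint i a) {T : Type} (g : X.1 → T)
    (hg : Function.Surjective g) (h : ∀ s s', g s = g s' ↔ Near i s s') :
    branchCount (quartetRel Y.1) a = Nat.card T := by
  have hex : ∀ y : {y : Y.1 // y ≠ a}, ∃ x, i x = y := fun y => hi.exists_eq y.2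
  choose r hr using hex
  refine _root_.branchCount_eq (treelike_of_mem Y) (fun y => g (r y)) ?_ ?_
  · intro t
    obtain ⟨x, rfl⟩ := hg t
    refine ⟨⟨i x, hi.apply_ne x⟩, ?_⟩
    exact congrArg g (i.injective (hr _))
  · intro s s'
    rw [h, hi.near_iff, hr, hr]

theorem IsOnePoint.exists_branch_map (hi : IsOnePoint i a) :
    ∃ (T : Type) (g : X.1 → T), Function.Surjective g ∧ (∀ s s', g s = g s' ↔ Near i s s') ∧
      branchCount (quartetRel Y.1) a = Nat.card T := by
  let r : Setoid X.1 := ⟨Near i, ⟨fun _ => Or.inl rfl, fun h => h.symm, fun h h' => h.trans hi h'⟩⟩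
  have h : ∀ s s', Quotient.mk r s = Quotient.mk r s' ↔ Near i s s' := fun s s' => Quotient.eq
  exact ⟨Quotient r, Quotient.mk r, Quotient.mk_surjective, h,
    hi.branchCount_eq _ Quotient.mk_surjective h⟩

/-- A branch is the largest proper cluster that contains a given point. -/
theorem IsOnePoint.isCluster_near (hi : IsOnePoint i a) [Nontrivial X.1] (s : X.1) :
    IsCluster i {s' | Near i s s'} ∧ {s' | Near i s s'} ≠ Set.univ := by
  have := finite_of_mem X
  have hfin : {C : Set X.1 | IsCluster i C ∧ C ≠ Set.univ ∧ s ∈ C}.Finite := Set.toFinite _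
  have hne : {C : Set X.1 | IsCluster i C ∧ C ≠ Set.univ ∧ s ∈ C}.Nonempty := by
    refine ⟨{s}, hi.isCluster_singleton s, ?_, rfl⟩
    obtain ⟨y, hy⟩ := exists_ne s
    exact fun h => hy (h ▸ Set.mem_univ y : y ∈ ({s} : Set X.1))
  obtain ⟨M, hM⟩ := hfin.exists_maximal hne
  obtain ⟨h1, h2, h3⟩ := hM.prop
  have : {s' | Near i s s'} = M := by
    refine Set.eq_of_subset_of_subset ?_ fun x hx => Or.inr ⟨M, h1, h2, h3, hx⟩
    rintro x (rfl | ⟨C, g1, g2, g3, g4⟩)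
    · exact h3
    rcases hi.laminar h1 g1 with h | h | h
    · exact hM.le_of_ge ⟨g1, g2, g3⟩ h g4
    · exact h g4
    · exact (Set.disjoint_left.1 h h3 g3).elim
  rw [this]
  exact ⟨h1, h2⟩

/-- A cluster is contained in one of two complementary clusters, unless it is everything. -/
theorem IsOnePoint.subset_or_subset (hi : IsOnePoint i a) {C D : Set X.1} (h1 : IsCluster i C)
    (h2 : IsCluster i Cᶜ) (hD : IsCluster i D) (hu : D ≠ Set.univ) : D ⊆ C ∨ D ⊆ Cᶜ := by
  rcases hi.laminar hD h1 with h | h | h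
  · exact Or.inl h
  · rcases hi.laminar hD h2 with h' | h' | h'
    · exact Or.inr h'
    · refine (hu (Set.eq_univ_iff_forall.2 fun x => ?_)).elim
      by_cases hx : x ∈ C
      exacts [h hx, h' hx]
    · exact Or.inl (Set.disjoint_compl_right_iff_subset.1 h')
  · exact Or.inr (Set.subset_compl_iff_disjoint_right.2 h)

theorem IsOnePoint.near_iff_of_compl (hi : IsOnePoint i a) {C : Set X.1} (h1 : IsCluster i C)
    (h2 : IsCluster i Cᶜ) (s s' : X.1) : Near i s s' ↔ (s ∈ C ↔ s' ∈ C) := by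
  have hC : C ≠ Set.univ := fun h => by
    rw [h, Set.compl_univ] at h2
    exact h2.nonempty.ne_empty rfl
  have hC' : Cᶜ ≠ Set.univ := fun h => h1.nonempty.ne_empty (Set.compl_univ_iff.1 h)
  constructor
  · rintro (rfl | ⟨D, g1, g2, g3, g4⟩)
    · rfl
    rcases hi.subset_or_subset h1 h2 g1 g2 with h | h
    · exact iff_of_true (h g3) (h g4)
    · exact iff_of_false (h g3) (h g4)
  · intro h
    by_cases hs : s ∈ C
    · exact Or.inr ⟨C, h1, hC, hs, h.1 hs⟩
    · exact Or.inr ⟨Cᶜ, h2, hC', hs, fun h' => hs (h.2 h')⟩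

theorem IsOnePoint.eq_or_eq_compl (hi : IsOnePoint i a) {C D : Set X.1} (h1 : IsCluster i C)
    (h2 : IsCluster i Cᶜ) (g1 : IsCluster i D) (g2 : IsCluster i Dᶜ) : D = C ∨ D = Cᶜ := by
  have h := fun s s' =>
    (hi.near_iff_of_compl h1 h2 s s').symm.trans (hi.near_iff_of_compl g1 g2 s s')
  obtain ⟨s, hs⟩ := h1.nonempty
  by_cases hsD : s ∈ D
  · left
    ext x
    simpa [hs, hsD] using (h s x).symm
  · right
    ext x
    have := h s x
    simp only [hs, hsD, true_iff, false_iff] at this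
    rw [Set.mem_compl_iff, this, not_not]

/-- If two complementary sets are clusters, then they are the only branches. -/
theorem branchCount_of_compl (hi : IsOnePoint i a) {C : Set X.1} (h1 : IsCluster i C)
    (h2 : IsCluster i Cᶜ) : branchCount (quartetRel Y.1) a = 2 := by
  rw [hi.branchCount_eq (T := Prop) (fun s => s ∈ C) ?_ ?_]
  · rw [Nat.card_eq_fintype_card, Fintype.card_prop]
  · intro p
    by_cases hp : p
    · obtain ⟨x, hx⟩ := h1.nonempty
      exact ⟨x, by simp [hp, hx]⟩
    · obtain ⟨x, hx⟩ := h2.nonempty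
      exact ⟨x, by simpa [hp] using hx⟩
  · intro s s'
    rw [hi.near_iff_of_compl h1 h2, eq_iff_iff]

theorem branchCount_of_isEmpty (hi : IsOnePoint i a) [IsEmpty X.1] :
    branchCount (quartetRel Y.1) a = 0 := by
  rw [hi.branchCount_eq (T := X.1) id Function.surjective_id fun s => isEmptyElim s,
    Nat.card_of_isEmpty]

theorem branchCount_of_subsingleton (hi : IsOnePoint i a) [Nonempty X.1] [Subsingleton X.1] :
    branchCount (quartetRel Y.1) a = 1 := by
  rw [hi.branchCount_eq (T := X.1) id Function.surjective_id
    fun s s' => iff_of_true (Subsingleton.elim _ _) (Or.inl (Subsingleton.elim _ _))]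
  exact Nat.card_eq_one_iff_unique.2 ⟨inferInstance, inferInstance⟩

/-- Without complementary clusters there are at least three branches, since two branches would be
complementary clusters. -/
theorem three_le_branchCount (hi : IsOnePoint i a) [Nontrivial X.1]
    (h : ∀ C, IsCluster i C → ¬ IsCluster i Cᶜ) : 3 ≤ branchCount (quartetRel Y.1) a := by
  have := finite_of_mem X
  obtain ⟨T, g, hg, hgg, hc⟩ := hi.exists_branch_map
  have : Finite T := Finite.of_surjective g hg
  have : Fintype T := Fintype.ofFinite T
  obtain ⟨s, -⟩ := exists_pair_ne X.1
  obtain ⟨h1, h2⟩ := hi.isCluster_near s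
  obtain ⟨s', hs'⟩ := (Set.ne_univ_iff_exists_notMem _).1 h2
  have h3 := (hi.isCluster_near s').1
  have : ∃ s'', ¬ Near i s s'' ∧ ¬ Near i s' s'' := by
    by_contra! hcon
    refine h _ h1 ?_
    convert h3
    ext x
    refine ⟨fun hx => hcon x hx, fun hx hx' => hs' ?_⟩
    exact Near.trans hi hx' hx.symm
  obtain ⟨s'', h4, h5⟩ := this
  rw [hc, Nat.card_eq_fintype_card]
  refine Nat.succ_le_of_lt (Fintype.two_lt_card_iff.2 ⟨g s, g s', g s'', ?_, ?_, ?_⟩) <;>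
  rw [Ne, hgg] <;> assumption

end Near

section Count

variable {X Y X' : treeClass} {i : X.1 ↪[treeLang] Y.1} {j : X.1 ↪[treeLang] X'.1}
  {a : Y.1} {b : X'.1} {n : Prop} {E : Set (Set X.1)} {B : Amalgam i j}

theorem IsGluing.near_apply_iff (hj : IsOnePoint j b)
    (h : IsGluing i j n E) (hn : ¬ n)
    (hB : ∀ D, IsCluster B.inr D ↔ D ∈ gluingFamily i j b n E) (s s' : X.1) :
    Near B.inr (j s) (j s') ↔ Near i s s' := by
  constructor
  · rintro (h1 | ⟨D, h1, h2, h3, h4⟩)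
    · exact Or.inl (j.injective h1)
    rcases (hB D).1 h1 with ⟨g1, g2, g3, g4⟩ | ⟨g1, g2⟩
    · exact Or.inr ⟨j ⁻¹' D, g2, fun hu => hn (g4 hu), h3, h4⟩
    · have hu : j ⁻¹' D ≠ Set.univ := fun hu => h2 <| Set.eq_univ_iff_forall.2 fun y => by
        by_cases hy : y = b
        · exact hy ▸ g1
        · obtain ⟨x, rfl⟩ := hj.exists_eq hy
          exact Set.eq_univ_iff_forall.1 hu x
      exact Or.inr ⟨j ⁻¹' D, (h.mem _ g2 (Set.nonempty_of_mem (x := s) h3).ne_empty hu).1, hu,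
        h3, h4⟩
  · rintro (rfl | ⟨C, h1, h2, h3, h4⟩)
    · exact Or.inl rfl
    have e := Set.preimage_image_eq C j.injective
    by_cases hq : IsCluster j C
    · refine Or.inr ⟨j '' C, (hB _).2 (Or.inl ⟨hj.notMem_image C, ?_, ?_, ?_⟩), ?_,
        Set.mem_image_of_mem j h3, Set.mem_image_of_mem j h4⟩
      · rwa [e]
      · rwa [e]
      · rw [e]; exact fun hu => (h2 hu).elim
      · exact fun hu => hj.notMem_image C (hu ▸ Set.mem_univ b)
    · have e' := hj.preimage_insert C
      refine Or.inr ⟨insert b (j '' C), (hB _).2 (Or.inr ⟨Set.mem_insert _ _, ?_⟩), ?_,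
        Or.inr (Set.mem_image_of_mem j h3), Or.inr (Set.mem_image_of_mem j h4)⟩
      · rw [e']; exact h.left C h1 h2 hq
      · intro hu
        rw [hu, Set.preimage_univ] at e'
        exact h2 e'.symm

theorem near_new_iff (hj : IsOnePoint j b)
    (hB : ∀ D, IsCluster B.inr D ↔ D ∈ gluingFamily i j b n E) (s : X.1) :
    Near B.inr b (j s) ↔ ∃ C ∈ E, C ≠ Set.univ ∧ s ∈ C := by
  constructor
  · rintro (h1 | ⟨D, h1, h2, h3, h4⟩)
    · exact (hj.apply_ne s h1.symm).elim
    rcases (hB D).1 h1 with ⟨g1, -⟩ | ⟨g1, g2⟩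
    · exact (g1 h3).elim
    · refine ⟨j ⁻¹' D, g2, fun hu => h2 <| Set.eq_univ_iff_forall.2 fun y => ?_, h4⟩
      by_cases hy : y = b
      · exact hy ▸ g1
      · obtain ⟨x, rfl⟩ := hj.exists_eq hy
        exact Set.eq_univ_iff_forall.1 hu x
  · rintro ⟨C, h1, h2, h3⟩
    have e' := hj.preimage_insert C
    refine Or.inr ⟨insert b (j '' C), (hB _).2 (Or.inr ⟨Set.mem_insert _ _, by rwa [e']⟩), ?_,
      Set.mem_insert _ _, Or.inr (Set.mem_image_of_mem j h3)⟩
    intro hu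
    rw [hu, Set.preimage_univ] at e'
    exact h2 e'.symm

/-- If `b` joins an existing branch at `a`, then the number of branches is unchanged. -/
theorem IsGluing.branchCount_of_nontrivial (hi : IsOnePoint i a) (hj : IsOnePoint j b)
    (h : IsGluing i j n E) (hn : ¬ n) (hE : ∃ C ∈ E, C ≠ ∅ ∧ C ≠ Set.univ)
    (hab : B.inl a ≠ B.inr b) (hB : ∀ D, IsCluster B.inr D ↔ D ∈ gluingFamily i j b n E) :
    branchCount (quartetRel B.Z.1) (B.inl a) = branchCount (quartetRel Y.1) a := by
  classical
  have hr := B.isOnePoint_inr hi hj hab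
  obtain ⟨C, hC, h0, h1⟩ := hE
  obtain ⟨s₀, hs₀⟩ := Set.nonempty_iff_ne_empty.2 h0
  have hb : Near B.inr b (j s₀) := (near_new_iff hj hB s₀).2 ⟨C, hC, h1, hs₀⟩
  obtain ⟨T, g, hg, hgg, hc⟩ := hi.exists_branch_map
  have hex : ∀ y : X'.1, ∃ x, Near B.inr y (j x) := by
    intro y
    by_cases hy : y = b
    · exact ⟨s₀, hy ▸ hb⟩
    · obtain ⟨x, rfl⟩ := hj.exists_eq hy
      exact ⟨x, Or.inl rfl⟩
  choose r hrn using hex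
  rw [hc]
  refine hr.branchCount_eq (fun y => g (r y)) ?_ ?_
  · intro t
    obtain ⟨x, rfl⟩ := hg t
    refine ⟨j x, ?_⟩
    rw [hgg, ← h.near_apply_iff hj hn hB]
    exact (hrn (j x)).symm
  · intro s s'
    rw [hgg, ← h.near_apply_iff hj hn hB]
    exact ⟨fun h => ((hrn s).trans hr h).trans hr (hrn s').symm,
      fun h => ((hrn s).symm.trans hr h).trans hr (hrn s')⟩

/-- If `a` and `b` form no cherry and `b` joins no branch at `a`, then it is a new branch. -/
theorem IsGluing.branchCount_of_trivial (hi : IsOnePoint i a) (hj : IsOnePoint j b)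
    (h : IsGluing i j n E) (hn : ¬ n) (hE : ∀ C ∈ E, C = ∅ ∨ C = Set.univ)
    (hab : B.inl a ≠ B.inr b) (hB : ∀ D, IsCluster B.inr D ↔ D ∈ gluingFamily i j b n E) :
    branchCount (quartetRel B.Z.1) (B.inl a) = branchCount (quartetRel Y.1) a + 1 := by
  have := finite_of_mem X
  have hr := B.isOnePoint_inr hi hj hab
  obtain ⟨T, g, hg, hgg, hc⟩ := hi.exists_branch_map
  have : Finite T := Finite.of_surjective g hg
  have hb : ∀ s, ¬ Near B.inr b (j s) := by
    intro s hs
    obtain ⟨C, h1, h2, h3⟩ := (near_new_iff hj hB s).1 hs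
    rcases hE C h1 with h | h
    · rw [h] at h3; exact h3
    · exact h2 h
  rw [hc, ← Finite.card_option]
  have e1 : hj.equivOption.symm b = none := by rw [Equiv.symm_apply_eq]; rfl
  have e2 : ∀ x, hj.equivOption.symm (j x) = some x := fun x => by rw [Equiv.symm_apply_eq]; rfl
  refine hr.branchCount_eq (fun y => Option.map g (hj.equivOption.symm y)) ?_ ?_
  · rintro (_ | t)
    · exact ⟨b, by simp [e1]⟩
    · obtain ⟨x, rfl⟩ := hg t
      exact ⟨j x, by simp [e2]⟩
  · intro s s'
    by_cases hs : s = b <;> by_cases hs' : s' = b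
    · subst hs; subst hs'; simp [Near]
    · obtain ⟨x, rfl⟩ := hj.exists_eq hs'
      rw [hs, e1, e2]
      simpa using hb x
    · obtain ⟨x, rfl⟩ := hj.exists_eq hs
      rw [hs', e1, e2]
      simpa using fun h => hb x (Near.symm h)
    · obtain ⟨x, rfl⟩ := hj.exists_eq hs
      obtain ⟨x', rfl⟩ := hj.exists_eq hs'
      rw [e2, e2, h.near_apply_iff hj hn hB, ← hgg]
      simp

/-- If `a` and `b` form a cherry, then there are two branches at `a`, one of which is `b`. -/
theorem IsGluing.branchCount_of_cherry (hi : IsOnePoint i a) (hj : IsOnePoint j b)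
    (h : IsGluing i j n E) (hn : n) (hab : B.inl a ≠ B.inr b)
    (hB : ∀ D, IsCluster B.inr D ↔ D ∈ gluingFamily i j b n E) :
    branchCount (quartetRel B.Z.1) (B.inl a) = 2 := by
  have hr := B.isOnePoint_inr hi hj hab
  refine branchCount_of_compl hr (C := j '' Set.univ) ((h.isCherry_iff hi hj hB).1.2 hn) ?_
  rw [hj.compl_image, Set.compl_univ, Set.image_empty]
  simpa using hr.isCluster_singleton b

end Count

/-! ### Additivity of the weights -/

section Additivity

variable {X Y X' : treeClass} {i : X.1 ↪[treeLang] Y.1} {j : X.1 ↪[treeLang] X'.1}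
  {a : Y.1} {b : X'.1}

theorem IsOnePoint.isCluster_or_compl (hj : IsOnePoint j b) {C : Set X.1} (h : IsCluster i C)
    (hu : C ≠ Set.univ) : IsCluster j C ∨ IsCluster j Cᶜ := by
  obtain ⟨x, hx⟩ := h.nonempty
  obtain ⟨y, hy⟩ := (Set.ne_univ_iff_exists_notMem _).1 hu
  exact hj.isCluster_or ((IsOnePoint.weakSplit_of_isCluster h).isSplit hx hy)

theorem isCluster_iff_univ (hi : IsOnePoint i a) (hj : IsOnePoint j b) :
    IsCluster i Set.univ ↔ IsCluster j Set.univ :=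
  ⟨fun h => hj.isCluster_univ h.nonempty.to_type, fun h => hi.isCluster_univ h.nonempty.to_type⟩

/-- If two complementary sets are clusters of both extensions, then the extensions have the same
clusters, since every proper cluster of one lies in one of the two sets. -/
theorem IsOnePoint.isCluster_of_compl (hi : IsOnePoint i a) (hj : IsOnePoint j b) {C : Set X.1}
    (h1 : IsCluster i C) (h2 : IsCluster i Cᶜ) (h3 : IsCluster j C) (h4 : IsCluster j Cᶜ)
    {D : Set X.1} (hD : IsCluster i D) : IsCluster j D := by
  by_cases hu : D = Set.univ
  · rw [hu]; exact hj.isCluster_univ hD.nonempty.to_type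
  have key : ∀ C, C.Nonempty → IsCluster j C → IsCluster j Cᶜ → D ⊆ C → IsCluster j D := by
    intro C hC' h3 h4 hDC
    rcases hj.isCluster_or_compl hD hu with h | h
    · exact h
    have hu' : Dᶜ ≠ Set.univ := fun h' => hD.nonempty.ne_empty (Set.compl_univ_iff.1 h')
    rcases hj.subset_or_subset h3 h4 h hu' with h' | h'
    · refine (h4.nonempty.ne_empty ?_).elim
      rw [Set.eq_empty_iff_forall_notMem]
      exact fun x hx => hx (h' fun hx' => hx (hDC hx'))
    · rw [show D = C from Set.Subset.antisymm hDC (Set.compl_subset_compl.1 h')]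
      exact h3
  rcases hi.subset_or_subset h1 h2 hD hu with h | h
  · exact key C h1.nonempty h3 h4 h
  · exact key Cᶜ h2.nonempty h4 (by rwa [compl_compl]) h

/-- The empty and the full subset, which belong to the family `E` of every gluing datum. -/
def trivialSets (S : Type) : Set (Set S) := {C | C = ∅ ∨ C = Set.univ}

theorem mem_trivialSets {S : Type} [Subsingleton S] (C : Set S) : C ∈ trivialSets S := by
  rcases C.eq_empty_or_nonempty with h | ⟨y, hy⟩
  · exact Or.inl h
  · exact Or.inr (Set.eq_univ_iff_forall.2 fun z => Subsingleton.elim y z ▸ hy)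

/-- When the clusters of the two extensions differ, there is exactly one gluing datum. -/
theorem isGluingList_of_ne (hi : IsOnePoint i a) (hj : IsOnePoint j b)
    (hne : ¬ ∀ C, IsCluster i C ↔ IsCluster j C) :
    IsGluingList i j (fun _ : Unit => False)
      (fun _ => {C | C = ∅ ∨ C = Set.univ ∨ (IsCluster i C ∧ IsCluster j Cᶜ)}) := by
  have hcompl : ∀ C, IsCluster i C → IsCluster i Cᶜ → IsCluster j C → IsCluster j Cᶜ → False :=
    fun C h1 h2 h3 h4 => hne fun D =>
      ⟨fun h => hi.isCluster_of_compl hj h1 h2 h3 h4 h,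
        fun h => hj.isCluster_of_compl hi h3 h4 h1 h2 h⟩
  refine ⟨fun _ => ⟨Or.inl rfl, Or.inr (Or.inl rfl), ?_, ?_, False.elim, ?_, ?_, False.elim, ?_⟩,
    fun _ _ _ _ => rfl, fun n' E' h => ⟨(), ?_, ?_⟩⟩
  · rintro C (h | h | h) h0 h1
    exacts [(h0 h).elim, (h1 h).elim, h]
  · rintro C (h | h | ⟨h, h'⟩) hC'
    · exact Or.inl h
    · exact Or.inr h
    rcases hC' with g | g | ⟨g, g'⟩
    · exact Or.inr (Set.compl_empty_iff.1 g)
    · exact Or.inl (Set.compl_univ_iff.1 g)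
    · rw [compl_compl] at g'
      exact (hcompl C h g g' h').elim
  · exact fun C h1 h2 h3 => Or.inr (Or.inr ⟨h1, (hj.isCluster_or_compl h1 h2).resolve_left h3⟩)
  · intro C h1 h2 h3
    refine Or.inr (Or.inr ⟨(hi.isCluster_or_compl h1 h2).resolve_left h3, ?_⟩)
    rwa [compl_compl]
  · rintro ⟨x⟩ hs
    refine hne fun C => ?_
    rcases mem_trivialSets C with rfl | rfl
    · exact iff_of_false (fun h => h.nonempty.ne_empty rfl) (fun h => h.nonempty.ne_empty rfl)
    · exact isCluster_iff_univ hi hj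
  · refine ⟨False.elim, fun hn => hne fun C => ?_⟩
    by_cases hu : C = Set.univ
    · rw [hu]; exact isCluster_iff_univ hi hj
    constructor
    · intro h1
      by_contra h2
      rcases h.exclusive hn _ (h.left C h1 hu h2) with h | h
      exacts [h1.nonempty.ne_empty h, hu h]
    · intro h1
      by_contra h2
      rcases h.exclusive hn _ (h.right C h1 hu h2) with h | h
      exacts [hu (Set.compl_empty_iff.1 h), h1.nonempty.ne_empty (Set.compl_univ_iff.1 h)]
  · ext C
    constructor
    · rintro (rfl | rfl | ⟨h1, h2⟩)
      · exact h.empty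
      · exact h.univ
      by_contra h3
      have hu : C ≠ Set.univ := fun hu => h2.nonempty.ne_empty (by rw [hu, Set.compl_univ])
      have hu' : Cᶜ ≠ Set.univ := fun h => h1.nonempty.ne_empty (Set.compl_univ_iff.1 h)
      have h4 : IsCluster j C := by
        by_contra h4
        exact h3 (h.left C h1 hu h4)
      have h5 : IsCluster i Cᶜ := by
        by_contra h5
        have := h.right Cᶜ h2 hu' h5
        rw [compl_compl] at this
        exact h3 this
      exact hcompl C h1 h5 h4 h2
    · intro h1
      by_cases h0 : C = ∅
      · exact Or.inl h0
      by_cases hu : C = Set.univ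
      · exact Or.inr (Or.inl hu)
      exact Or.inr (Or.inr (h.mem C h1 h0 hu))

theorem weightAdditive_of_ne (hi : IsOnePoint i a) (hj : IsOnePoint j b)
    (hne : ¬ ∀ C, IsCluster i C ↔ IsCluster j C) : WeightAdditive i j := by
  have hl := isGluingList_of_ne hi hj hne
  have hg := hl.isGluing ()
  refine weightAdditive_of_isGluingList hi hj hne hl
    (fun _ => branchWeight (branchCount (quartetRel Y.1) a)) (fun _ B hab hB => ?_) (by simp)
  rw [hg.branchCount_of_nontrivial hi hj not_false ?_ hab hB]
  have : ∃ C, C ≠ Set.univ ∧ ¬ (IsCluster i C ↔ IsCluster j C) := by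
    by_contra! hcon
    refine hne fun C => ?_
    by_cases hu : C = Set.univ
    · rw [hu]; exact isCluster_iff_univ hi hj
    · exact hcon C hu
  obtain ⟨C, hu, hC⟩ := this
  by_cases h1 : IsCluster i C
  · have h2 : ¬ IsCluster j C := fun h => hC (iff_of_true h1 h)
    exact ⟨C, hg.left C h1 hu h2, h1.nonempty.ne_empty, hu⟩
  · have h2 : IsCluster j C := by
      by_contra h
      exact hC (iff_of_false h1 h)
    exact ⟨Cᶜ, hg.right C h2 hu h1, fun h => hu (Set.compl_empty_iff.1 h),
      fun h => h2.nonempty.ne_empty (Set.compl_univ_iff.1 h)⟩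

/-- The gluing data when the clusters of the two extensions agree. -/
theorem isGluing_of_iff (heq : ∀ C, IsCluster i C ↔ IsCluster j C)
    {n : Prop} {E : Set (Set X.1)} :
    IsGluing i j n E ↔ trivialSets X.1 ⊆ E ∧
      (∀ C ∈ E, C ∉ trivialSets X.1 → IsCluster i C ∧ IsCluster i Cᶜ ∧ Cᶜ ∉ E ∧ ¬ n) ∧
      (n → Nonempty X.1) ∧ (Nonempty X.1 → Subsingleton X.1 → n) := by
  constructor
  · intro h
    refine ⟨?_, fun C hC hC' => ?_, h.nonempty, h.small⟩
    · rintro C (rfl | rfl)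
      exacts [h.empty, h.univ]
    · obtain ⟨h0, h1⟩ := not_or.1 hC'
      exact ⟨(h.mem C hC h0 h1).1, (heq _).2 (h.mem C hC h0 h1).2,
        fun hc => hC' (h.compl C hC hc), fun hn => hC' (h.exclusive hn C hC)⟩
  · rintro ⟨h1, h2, h3, h4⟩
    refine ⟨h1 (Or.inl rfl), h1 (Or.inr rfl), fun C hC h0 hu => ?_, fun C hC hC' => ?_,
      fun hn C hC => ?_, fun C h _ h' => (h' ((heq C).1 h)).elim,
      fun C h _ h' => (h' ((heq C).2 h)).elim, h3, h4⟩
    · obtain ⟨g1, g2, -⟩ := h2 C hC (not_or.2 ⟨h0, hu⟩)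
      exact ⟨g1, (heq _).1 g2⟩
    · by_contra h
      exact (h2 C hC h).2.2.1 hC'
    · by_contra h
      exact (h2 C hC h).2.2.2 hn

/-- Here `w(0) = 1 + w(1)`: the new points are identified, or form the tree with two leaves. -/
theorem weightAdditive_of_isEmpty (hi : IsOnePoint i a) (hj : IsOnePoint j b)
    (heq : ∀ C, IsCluster i C ↔ IsCluster j C) [IsEmpty X.1] : WeightAdditive i j := by
  have hl : IsGluingList i j (fun _ : Unit => False) (fun _ => trivialSets X.1) := by
    refine ⟨fun _ => (isGluing_of_iff heq).2 ⟨subset_rfl, fun C h h' => (h' h).elim,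
      False.elim, fun h => (not_isEmpty_iff.2 h inferInstance).elim⟩, fun _ _ _ _ => rfl,
      fun n' E' h => ⟨(), ?_, ?_⟩⟩
    · exact ⟨False.elim, fun h' => not_isEmpty_iff.2 (h.nonempty h') inferInstance⟩
    · exact Set.Subset.antisymm ((isGluing_of_iff heq).1 h).1 fun C _ => mem_trivialSets C
  refine weightAdditive_of_isGluingList_of_iff hi hj heq hl (fun _ => branchWeight 1)
    (fun _ B hab hB => ?_) ?_
  · rw [(hl.isGluing ()).branchCount_of_trivial hi hj not_false (fun C hC => hC) hab hB,
      branchCount_of_isEmpty hi]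
  · rw [branchCount_of_isEmpty hi]
    simp [branchWeight]

/-- Here `w(1) = 1 + w(2)`: the new points are identified, or form a star with the point of `X`. -/
theorem weightAdditive_of_subsingleton (hi : IsOnePoint i a) (hj : IsOnePoint j b)
    (heq : ∀ C, IsCluster i C ↔ IsCluster j C) [Nonempty X.1] [Subsingleton X.1] :
    WeightAdditive i j := by
  have hl : IsGluingList i j (fun _ : Unit => True) (fun _ => trivialSets X.1) := by
    refine ⟨fun _ => (isGluing_of_iff heq).2 ⟨subset_rfl, fun C h h' => (h' h).elim,
      fun _ => inferInstance, fun _ _ => trivial⟩, fun _ _ _ _ => rfl,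
      fun n' E' h => ⟨(), ?_, ?_⟩⟩
    · exact ⟨fun _ => h.small inferInstance inferInstance, fun _ => trivial⟩
    · exact Set.Subset.antisymm ((isGluing_of_iff heq).1 h).1 fun C _ => mem_trivialSets C
  refine weightAdditive_of_isGluingList_of_iff hi hj heq hl (fun _ => branchWeight 2)
    (fun _ B hab hB => ?_) ?_
  · rw [(hl.isGluing ()).branchCount_of_cherry hi hj trivial hab hB]
  · rw [branchCount_of_subsingleton hi]
    simp [branchWeight]

/-- Here `w(c) = 1 + w(c + 1) + w(2)` with `c ≥ 3`: the new points are identified, or `b` is a new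
branch at `a`, or `a` and `b` form a cherry. -/
theorem weightAdditive_of_forall_not_compl (hi : IsOnePoint i a) (hj : IsOnePoint j b)
    (heq : ∀ C, IsCluster i C ↔ IsCluster j C) [Nontrivial X.1]
    (h : ∀ C, IsCluster i C → ¬ IsCluster i Cᶜ) : WeightAdditive i j := by
  have hl : IsGluingList i j (fun k : Bool => k = true) (fun _ => trivialSets X.1) := by
    refine ⟨fun k => (isGluing_of_iff heq).2 ⟨subset_rfl, fun C h h' => (h' h).elim,
      fun _ => inferInstance, fun _ h => (not_subsingleton X.1 h).elim⟩, ?_,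
      fun n' E' hg => ?_⟩
    · intro k k' hk _
      exact Bool.eq_iff_iff.2 hk
    · have : trivialSets X.1 = E' := by
        refine Set.Subset.antisymm ((isGluing_of_iff heq).1 hg).1 fun C hC => ?_
        by_contra hC'
        obtain ⟨h1, h2, -⟩ := ((isGluing_of_iff heq).1 hg).2.1 C hC hC'
        exact h C h1 h2
      by_cases hn : n'
      · exact ⟨true, by simp [hn], this⟩
      · exact ⟨false, by simp [hn], this⟩
  have hc := three_le_branchCount hi h
  refine weightAdditive_of_isGluingList_of_iff hi hj heq hl
    (fun k => branchWeight (if k then 2 else branchCount (quartetRel Y.1) a + 1))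
    (fun k B hab hB => ?_) ?_
  · cases k
    · rw [(hl.isGluing false).branchCount_of_trivial hi hj (by simp) (fun C hC => hC) hab hB]
      rfl
    · rw [(hl.isGluing true).branchCount_of_cherry hi hj rfl hab hB]
      rfl
  · generalize branchCount (quartetRel Y.1) a = c at hc
    have h1 : c ≠ 0 := by omega
    have h2 : c ≠ 1 := by omega
    have h3 : c ≠ 2 := by omega
    simp [branchWeight, h1, h2, h3]
    ring

/-- Here `w(2) = 1 + w(3) + 3 w(2)`: in addition to the three possibilities for `c ≥ 3`, the point
`b` can be attached to either of the two branches `C` and `Cᶜ`. -/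
theorem weightAdditive_of_compl (hi : IsOnePoint i a) (hj : IsOnePoint j b)
    (heq : ∀ C, IsCluster i C ↔ IsCluster j C) {C : Set X.1} (h1 : IsCluster i C)
    (h2 : IsCluster i Cᶜ) : WeightAdditive i j := by
  have hu : C ≠ Set.univ := fun h => by
    rw [h, Set.compl_univ] at h2
    exact h2.nonempty.ne_empty rfl
  have hu' : Cᶜ ≠ Set.univ := fun h => h1.nonempty.ne_empty (Set.compl_univ_iff.1 h)
  have hC : C ∉ trivialSets X.1 := not_or.2 ⟨h1.nonempty.ne_empty, hu⟩
  have hC' : Cᶜ ∉ trivialSets X.1 := not_or.2 ⟨h2.nonempty.ne_empty, hu'⟩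
  have hCC : C ≠ Cᶜ := fun h => by
    obtain ⟨x, hx⟩ := h1.nonempty
    have := hx
    rw [h] at this
    exact this hx
  have hX : Nontrivial X.1 := by
    obtain ⟨x, hx⟩ := h1.nonempty
    obtain ⟨y, hy⟩ := h2.nonempty
    exact ⟨x, y, fun h => hy (h ▸ hx)⟩
  -- no cherry and a trivial family, a cherry, or one of the two nontrivial sets added
  let n : Option (Option Bool) → Prop := fun k => k = some none
  let E : Option (Option Bool) → Set (Set X.1) := fun k =>
    match k with
    | none => trivialSets X.1
    | some none => trivialSets X.1
    | some (some true) => insert C (trivialSets X.1)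
    | some (some false) => insert Cᶜ (trivialSets X.1)
  have hl : IsGluingList i j n E := by
    refine ⟨fun k => (isGluing_of_iff heq).2 ⟨?_, ?_,
      fun _ => inferInstance, fun _ h => (not_subsingleton X.1 h).elim⟩, ?_,
      fun n' E' hg => ?_⟩
    · rcases k with _ | _ | _ | _
      exacts [subset_rfl, subset_rfl, Set.subset_insert _ _, Set.subset_insert _ _]
    · rcases k with _ | _ | _ | _ <;> intro D hD hD'
      · exact (hD' hD).elim
      · exact (hD' hD).elim
      · have : D = Cᶜ := hD.resolve_right hD'
        subst this
        refine ⟨h2, by rwa [compl_compl], ?_, by simp [n]⟩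
        rw [compl_compl]
        rintro (h | h)
        exacts [hCC h, hC h]
      · have : D = C := hD.resolve_right hD'
        subst this
        refine ⟨h1, h2, ?_, by simp [n]⟩
        rintro (h | h)
        exacts [hCC h.symm, hC' h]
    · have m1 : C ∉ insert Cᶜ (trivialSets X.1) := by
        rintro (h | h)
        exacts [hCC h, hC h]
      intro k k' hn hE
      rcases k with _ | _ | _ | _ <;> rcases k' with _ | _ | _ | _ <;>
        simp only [n, E, reduceCtorEq, Option.some.injEq, iff_false, false_iff, not_true_eq_false]
          at hn hE ⊢
      · exact hC' (hE ▸ Set.mem_insert _ _)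
      · exact hC (hE ▸ Set.mem_insert _ _)
      · exact hC' (hE ▸ Set.mem_insert _ _)
      · exact m1 (hE ▸ Set.mem_insert _ _)
      · exact hC (hE ▸ Set.mem_insert _ _)
      · exact m1 (hE ▸ Set.mem_insert _ _)
    · obtain ⟨g1, g2, -, -⟩ := (isGluing_of_iff heq).1 hg
      have hD : ∀ D ∈ E', D ∉ trivialSets X.1 → D = C ∨ D = Cᶜ := fun D hD hD' =>
        hi.eq_or_eq_compl h1 h2 (g2 D hD hD').1 (g2 D hD hD').2.1
      by_cases e1 : C ∈ E'
      · refine ⟨some (some true), ?_, Set.Subset.antisymm ?_ ?_⟩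
        · simpa [n] using (g2 C e1 hC).2.2.2
        · exact Set.insert_subset e1 g1
        · intro D hDE
          by_cases hDt : D ∈ trivialSets X.1
          · exact Or.inr hDt
          · rcases hD D hDE hDt with rfl | rfl
            · exact Or.inl rfl
            · exact ((g2 C e1 hC).2.2.1 hDE).elim
      by_cases e2 : Cᶜ ∈ E'
      · refine ⟨some (some false), ?_, Set.Subset.antisymm ?_ ?_⟩
        · simpa [n] using (g2 _ e2 hC').2.2.2
        · exact Set.insert_subset e2 g1
        · intro D hDE
          by_cases hDt : D ∈ trivialSets X.1
          · exact Or.inr hDt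
          · rcases hD D hDE hDt with rfl | rfl
            · exact (e1 hDE).elim
            · exact Or.inl rfl
      have : trivialSets X.1 = E' := by
        refine Set.Subset.antisymm g1 fun D hDE => ?_
        by_contra hDt
        rcases hD D hDE hDt with rfl | rfl
        exacts [e1 hDE, e2 hDE]
      by_cases hn : n'
      · exact ⟨some none, by simp [n, hn], this⟩
      · exact ⟨none, by simp [n, hn], this⟩
  have hc := branchCount_of_compl hi h1 h2
  refine weightAdditive_of_isGluingList_of_iff hi hj heq hl
    (fun k => branchWeight (if k = none then 3 else 2)) (fun k B hab hB => ?_) ?_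
  · have hk := hl.isGluing k
    rcases k with _ | _ | _ | _
    · rw [hk.branchCount_of_trivial hi hj (by simp [n]) (fun C hC => hC) hab hB, hc]
      rfl
    · rw [hk.branchCount_of_cherry hi hj rfl hab hB]
      rfl
    · rw [hk.branchCount_of_nontrivial hi hj (by simp [n])
        ⟨Cᶜ, Set.mem_insert _ _, h2.nonempty.ne_empty, hu'⟩ hab hB, hc]
      rfl
    · rw [hk.branchCount_of_nontrivial hi hj (by simp [n])
        ⟨C, Set.mem_insert _ _, h1.nonempty.ne_empty, hu⟩ hab hB, hc]
      rfl
  · rw [hc, Fintype.sum_option, Fintype.sum_option]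
    simp [branchWeight]
    ring

/-- The weights are additive over amalgamations. -/
theorem weightAdditive (i : X.1 ↪[treeLang] Y.1) (j : X.1 ↪[treeLang] X'.1) :
    WeightAdditive i j := by
  refine weightAdditive_of_onePoint (fun {X Y X'} i j a b hi hj => ?_) i j
  by_cases heq : ∀ C, IsCluster i C ↔ IsCluster j C
  · rcases isEmpty_or_nonempty X.1 with h | h
    · exact weightAdditive_of_isEmpty hi hj heq
    rcases subsingleton_or_nontrivial X.1 with h | h
    · exact weightAdditive_of_subsingleton hi hj heq
    by_cases hC : ∃ C, IsCluster i C ∧ IsCluster i Cᶜ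
    · obtain ⟨C, h1, h2⟩ := hC
      exact weightAdditive_of_compl hi hj heq h1 h2
    · push Not at hC
      exact weightAdditive_of_forall_not_compl hi hj heq hC
  · exact weightAdditive_of_ne hi hj heq

end Additivity

/-! ### The measure defined by the weights -/

section Measure

variable {X Y X' : treeClass}

theorem exists_structureWeight_eq_mul (i : X.1 ↪[treeLang] Y.1) :
    ∃ c, structureWeight Y = c * structureWeight X := by
  induction h : codim i generalizing X with
  | zero =>
    refine ⟨1, ?_⟩
    rw [one_mul]
    exact (structureWeight_congr
      (equivOfBijective i ⟨i.injective, surjective_of_codim_eq_zero h⟩)).symm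
  | succ n ih =>
    obtain ⟨Y₁, i₁, i₂, a, -, ha, h₂⟩ := exists_factorization i h
    obtain ⟨c, hc⟩ := ih i₂ h₂
    exact ⟨c * branchWeight (branchCount (quartetRel Y₁.1) a),
      by rw [hc, structureWeight_onePoint ha, mul_assoc]⟩

/-- The quotient of the weights of the target and of the source of an embedding. -/
noncomputable def weightRatio (i : X.1 ↪[treeLang] Y.1) : TauRing :=
  (exists_structureWeight_eq_mul i).choose

theorem weightRatio_mul (i : X.1 ↪[treeLang] Y.1) :
    weightRatio i * structureWeight X = structureWeight Y :=
  (exists_structureWeight_eq_mul i).choose_spec.symm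

theorem weightRatio_eq {i : X.1 ↪[treeLang] Y.1} {c : TauRing}
    (h : structureWeight Y = c * structureWeight X) : weightRatio i = c :=
  mul_right_cancel₀ (structureWeight_ne_zero X) ((weightRatio_mul i).trans h)

/-- The primary measure. The amalgamation axiom is the additivity of the weights, divided by the
weights of the two structures that are extended. -/
noncomputable def primaryMeasure : FraisseMeasure treeClass TauRing where
  toFun i := weightRatio i
  map_equiv e := weightRatio_eq (by rw [one_mul, structureWeight_congr e])
  map_comp i j := weightRatio_eq (by rw [mul_assoc, weightRatio_mul, weightRatio_mul])
  map_amalgam := by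
    intro X Y X' i j n A hA
    obtain ⟨ι, _, B, hB, hs⟩ := weightAdditive i j
    rw [← sum_weight_eq (A := A) hA hB] at hs
    refine weightRatio_eq (mul_right_cancel₀ (structureWeight_ne_zero X') ?_)
    rw [← hs]
    have : ∑ α, structureWeight (A α).Z =
        (∑ α, weightRatio (A α).inr) * structureWeight X' := by
      rw [Finset.sum_mul]
      exact Finset.sum_congr rfl fun α _ => (weightRatio_mul _).symm
    rw [this]
    ring

theorem IsMarkedExtension.exists_isOnePoint {f : X.1 ↪[treeLang] Y.1} {V : Type}
    {G : SimpleGraph V} {a : V} (h : IsMarkedExtension f G a) :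
    ∃ (ha : IsLeaf G a) (e : Y.1 ≃[treeLang] leafStructure G) (a' : Y.1), e a' = ⟨a, ha⟩ ∧
      IsOnePoint f a' := by
  obtain ⟨ha, e, he⟩ := h
  have h1 : e (e.symm ⟨a, ha⟩) = ⟨a, ha⟩ := e.apply_symm_apply _
  refine ⟨ha, e, e.symm ⟨a, ha⟩, h1, ?_⟩
  ext y
  have h2 := he (e y)
  constructor
  · rintro ⟨x, rfl⟩ hx
    refine h2.1 ⟨x, rfl⟩ ?_
    rw [Set.mem_singleton_iff.1 hx, h1]
  · intro hy
    have h3 : (e y).1 ≠ a := fun h3 =>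
      hy (e.injective ((Subtype.ext h3 : e y = ⟨a, ha⟩).trans h1.symm))
    obtain ⟨x, hx⟩ := h2.2 h3
    exact ⟨x, e.injective hx⟩

theorem markedValue_primaryMeasure {V : Type} [Finite V] {G : SimpleGraph V} (hG : G.IsTree)
    {a : V} {c : ℕ} (hc : ∀ ha : IsLeaf G a, branchCount (leafRel G) ⟨a, ha⟩ = c) :
    primaryMeasure.MarkedValue G a (branchWeight c) := by
  intro X Y f hf
  obtain ⟨ha, e, a', he, hone⟩ := hf.exists_isOnePoint
  refine weightRatio_eq (i := f) ?_
  rw [structureWeight_onePoint hone,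
    branchCount_congr (treelike_leafRel hG) e.toEquiv (quartetRel_equiv e) a']
  congr 2
  exact (congrArg (branchCount (leafRel G)) he).trans (hc ha)

end Measure

/-! ### The marked trees that define the parameters -/

theorem valence_eq_card {V : Type} [Fintype V] (G : SimpleGraph V) [DecidableRel G.Adj] (v : V) :
    valence G v = (Finset.univ.filter fun w => G.Adj v w).card := by
  rw [valence, ← Set.ncard_coe_finset]
  congr 1
  ext w
  simp

section Star

variable {m : ℕ}

theorem starGraph_adj_iff (v w : Fin (m + 1)) :
    (SimpleGraph.starGraph (0 : Fin (m + 1))).Adj v w ↔ v ≠ w ∧ (v = 0 ∨ w = 0) := by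
  simp [SimpleGraph.starGraph]

theorem valence_starGraph_zero : valence (SimpleGraph.starGraph (0 : Fin (m + 1))) 0 = m := by
  have : (SimpleGraph.starGraph (0 : Fin (m + 1))).neighborSet 0 = {0}ᶜ := by
    ext w
    simp [eq_comm]
  rw [valence, this, Set.ncard_compl, Set.ncard_singleton, Nat.card_fin, Nat.add_sub_cancel]

theorem valence_starGraph {v : Fin (m + 1)} (hv : v ≠ 0) :
    valence (SimpleGraph.starGraph (0 : Fin (m + 1))) v = 1 := by
  have : (SimpleGraph.starGraph (0 : Fin (m + 1))).neighborSet v = {0} := by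
    ext w
    simp only [SimpleGraph.mem_neighborSet, starGraph_adj_iff, hv, false_or, Set.mem_singleton_iff]
    exact ⟨fun h => h.2, fun h => ⟨h ▸ hv, h⟩⟩
  rw [valence, this, Set.ncard_singleton]

end Star

theorem treeY_adj_iff (v w : Fin 6) : treeY.Adj v w ↔
    s(v, w) ∈ ({s(0, 1), s(0, 2), s(0, 3), s(1, 4), s(1, 5)} : Finset (Sym2 (Fin 6))) ∧ v ≠ w := by
  simp only [treeY, SimpleGraph.fromEdgeSet_adj, ← Finset.mem_coe]
  simp

instance decidableRel_treeY_adj : DecidableRel treeY.Adj :=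
  fun v w => decidable_of_iff' _ (treeY_adj_iff v w)

theorem treeZ_adj_iff (v w : Fin 8) : treeZ.Adj v w ↔
    s(v, w) ∈ ({s(0, 1), s(1, 2), s(0, 3), s(0, 4), s(1, 5), s(2, 6), s(2, 7)} :
      Finset (Sym2 (Fin 8))) ∧ v ≠ w := by
  simp only [treeZ, SimpleGraph.fromEdgeSet_adj, ← Finset.mem_coe]
  simp

instance decidableRel_treeZ_adj : DecidableRel treeZ.Adj :=
  fun v w => decidable_of_iff' _ (treeZ_adj_iff v w)

theorem isTree_treeY : treeY.IsTree := by
  have hr : ∀ v, treeY.Reachable v 0 := by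
    have h1 : treeY.Reachable 1 0 := SimpleGraph.Adj.reachable (by decide)
    intro v
    fin_cases v
    · exact SimpleGraph.Reachable.refl _
    · exact h1
    · exact SimpleGraph.Adj.reachable (by decide)
    · exact SimpleGraph.Adj.reachable (by decide)
    · exact (SimpleGraph.Adj.reachable (by decide)).trans h1
    · exact (SimpleGraph.Adj.reachable (by decide)).trans h1
  rw [SimpleGraph.isTree_iff_connected_and_card]
  refine ⟨⟨fun v w => (hr v).trans (hr w).symm⟩, ?_⟩
  rw [Nat.card_eq_fintype_card, ← SimpleGraph.edgeFinset_card, Nat.card_fin]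
  decide

theorem isTree_treeZ : treeZ.IsTree := by
  have hr : ∀ v, treeZ.Reachable v 1 := by
    have h0 : treeZ.Reachable 0 1 := SimpleGraph.Adj.reachable (by decide)
    have h2 : treeZ.Reachable 2 1 := SimpleGraph.Adj.reachable (by decide)
    intro v
    fin_cases v
    · exact h0
    · exact SimpleGraph.Reachable.refl _
    · exact h2
    · exact (SimpleGraph.Adj.reachable (by decide)).trans h0
    · exact (SimpleGraph.Adj.reachable (by decide)).trans h0
    · exact SimpleGraph.Adj.reachable (by decide)
    · exact (SimpleGraph.Adj.reachable (by decide)).trans h2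
    · exact (SimpleGraph.Adj.reachable (by decide)).trans h2
  rw [SimpleGraph.isTree_iff_connected_and_card]
  refine ⟨⟨fun v w => (hr v).trans (hr w).symm⟩, ?_⟩
  rw [Nat.card_eq_fintype_card, ← SimpleGraph.edgeFinset_card, Nat.card_fin]
  decide

theorem valence_treeY_one : valence treeY 1 = 3 := by
  rw [valence_eq_card]
  decide

theorem valence_treeZ_one : valence treeZ 1 = 3 := by
  rw [valence_eq_card]
  decide

theorem isLeaf_treeY_iff (v : Fin 6) : IsLeaf treeY v ↔ 2 ≤ v := by
  rw [IsLeaf, valence_eq_card]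
  revert v
  decide

theorem isLeaf_treeZ_iff (v : Fin 8) : IsLeaf treeZ v ↔ 3 ≤ v := by
  rw [IsLeaf, valence_eq_card]
  revert v
  decide

theorem hasParameters_primaryMeasure :
    primaryMeasure.HasParameters (-((tau - 2) * tauSubOneInv)) 0 := by
  have hu : -((tau - 2) * tauSubOneInv) = tauSubOneInv - 1 := by
    linear_combination -tau_mul_inv
  have hstar : ∀ m : ℕ, 3 ≤ m →
      primaryMeasure.MarkedValue (SimpleGraph.starGraph (0 : Fin (m + 1))) (Fin.last m)
        (branchWeight (m - 1)) := by
    intro m hm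
    refine markedValue_primaryMeasure (SimpleGraph.isTree_starGraph _) fun ha => ?_
    have h0 : Fin.last m ≠ 0 := by
      intro h
      have := congrArg Fin.val h
      simp at this
      omega
    rw [branchCount_leafRel (SimpleGraph.isTree_starGraph _) ⟨Fin.last m, ha⟩ (x := 0)
      ((starGraph_adj_iff _ _).2 ⟨h0, Or.inr rfl⟩) (by rw [valence_starGraph_zero]; exact hm),
      valence_starGraph_zero]
  rw [hu]
  refine ⟨?_, ?_, ?_, ?_, ?_, ?_⟩
  · convert markedValue_primaryMeasure (c := 0) (SimpleGraph.isTree_starGraph (0 : Fin 1))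
      (a := 0) fun ha => ?_ using 1
    · simp [branchWeight]; ring
    · rw [branchCount_eq (treelike_leafRel (SimpleGraph.isTree_starGraph _)) (T := Empty)
        (fun s => (s.2 (Subsingleton.elim _ _)).elim) (fun t => t.elim)
        (fun s => (s.2 (Subsingleton.elim _ _)).elim)]
      simp
  · convert markedValue_primaryMeasure (c := 1) (SimpleGraph.isTree_starGraph (0 : Fin 2))
      (a := 1) fun ha => ?_ using 1
    · simp [branchWeight]
    · exact branchCount_leafRel_of_adj_leaf (SimpleGraph.isTree_starGraph _) ⟨1, ha⟩ (x := 0)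
        ((starGraph_adj_iff _ _).2 ⟨one_ne_zero, Or.inr rfl⟩)
        (valence_starGraph_zero (m := 1)).le
  · convert hstar 3 le_rfl using 1
    simp [branchWeight]
  · intro m hm
    convert hstar m (by omega) using 1
    obtain ⟨n, rfl⟩ : ∃ n, m = n + 4 := ⟨m - 4, by omega⟩
    rw [branchWeight, if_neg (by omega), if_neg (by omega), if_neg (by omega),
      Nat.add_sub_assoc (by norm_num)]
    push_cast
    ring
  · convert markedValue_primaryMeasure (c := 2) isTree_treeY (a := 5) fun ha => ?_ using 1
    · simp [branchWeight]
    · rw [branchCount_leafRel isTree_treeY ⟨5, ha⟩ (x := 1)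
        (show treeY.Adj 5 1 by decide) valence_treeY_one.ge,
        valence_treeY_one]
  · convert markedValue_primaryMeasure (c := 2) isTree_treeZ (a := 5) fun ha => ?_ using 1
    · simp [branchWeight]
    · rw [branchCount_leafRel isTree_treeZ ⟨5, ha⟩ (x := 1)
        (show treeZ.Adj 5 1 by decide) valence_treeZ_one.ge,
        valence_treeZ_one]

/-! ### The values of the primary measure on trees -/

theorem primaryMeasure_value {V : Type} [Fintype V] {G : SimpleGraph V} (hG : G.IsTree) :
    primaryMeasure.value (treeStructure G hG) = treeWeight G := by
  refine weightRatio_eq (i := emptyEmbedding _) ?_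
  rw [structureWeight_of_isEmpty (X := emptyStructure) (inferInstanceAs (IsEmpty Empty)), mul_one]
  exact structureWeight_eq hG (Equiv.refl _) fun _ _ _ _ => Iff.rfl

theorem treeWeight_of_isReducedTree {V : Type} [Fintype V] {G : SimpleGraph V}
    (hG : IsReducedTree G) : treeWeight G = (-1) ^ (nodes G).card * tau *
      tauSubOneInv ^ (leaves G).card * ∏ x ∈ nodes G, fallingVariant tau (valence G x) := by
  classical
  have h1 : ∏ v ∈ leaves G, vertexFactor (valence G v) = tauSubOneInv ^ (leaves G).card := by
    rw [Finset.prod_congr rfl (g := fun _ => tauSubOneInv), Finset.prod_const]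
    intro v hv
    have : IsLeaf G v := by simpa [leaves] using hv
    exact if_pos this
  have h2 : ∏ v ∈ nodes G, vertexFactor (valence G v) =
      (-1) ^ (nodes G).card * ∏ x ∈ nodes G, fallingVariant tau (valence G x) := by
    rw [← Finset.prod_const, ← Finset.prod_mul_distrib]
    refine Finset.prod_congr rfl fun v hv => ?_
    have : ¬ IsLeaf G v := by simpa [nodes] using hv
    exact (if_neg this).trans ((if_neg (hG v)).trans (neg_one_mul _).symm)
  have h3 : ∏ v, vertexFactor (valence G v) = (∏ v ∈ leaves G, vertexFactor (valence G v)) *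
      ∏ v ∈ nodes G, vertexFactor (valence G v) := by
    rw [leaves, nodes, Finset.prod_filter_mul_prod_filter_not]
  rw [treeWeight, h3, h1, h2]
  ring

/-! ### One-point extensions that are determined by a part of the base -/

section Square

variable {X Y X₀ Y₀ X' : treeClass} {i : X.1 ↪[treeLang] Y.1} {a : Y.1}
  {i₀ : X₀.1 ↪[treeLang] Y₀.1} {a₀ : Y₀.1} {k : X₀.1 ↪[treeLang] X.1} {j : X.1 ↪[treeLang] X'.1}
  {b : X'.1}

/-- A one-point extension `i : X → Y` by `a`, as an amalgamation of its restriction `i₀ : X₀ → Y₀`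
with the inclusion `k : X₀ → X`. -/
def squareAmalgam (hi : IsOnePoint i a) (h : Y₀.1 ↪[treeLang] Y.1) (hc : h.comp i₀ = i.comp k)
    (ha : h a₀ = a) : Amalgam i₀ k where
  Z := Y
  inl := h
  inr := i
  comm := hc
  cover := by
    rw [hi, Set.eq_univ_iff_forall]
    intro y
    by_cases hy : y = a
    · exact Or.inl ⟨a₀, ha.trans hy.symm⟩
    · exact Or.inr hy

/-- The restriction of a one-point extension of `X` to a subset of `X`. -/
theorem exists_squareAmalgam (hi : IsOnePoint i a) (S : Set X.1) :
    ∃ (X₀ Y₀ : treeClass) (i₀ : X₀.1 ↪[treeLang] Y₀.1) (a₀ : Y₀.1) (k : X₀.1 ↪[treeLang] X.1)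
      (h : Y₀.1 ↪[treeLang] Y.1), IsOnePoint i₀ a₀ ∧ h.comp i₀ = i.comp k ∧ h a₀ = a ∧
      Set.range k = S := by
  let T : Set Y.1 := insert a (i '' S)
  have hT : ∀ x, i.comp (restrictEmbedding X S) x ∈ T := fun x =>
    Or.inr ⟨_, restrictEmbedding_mem X S x, rfl⟩
  refine ⟨restrict X S, restrict Y T, restrictLift T (i.comp (restrictEmbedding X S)) hT,
    (⟨a, Or.inl rfl⟩ : T), restrictEmbedding X S, restrictEmbedding Y T, ?_, rfl, rfl,
    range_restrictEmbedding X S⟩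
  refine Set.eq_of_subset_of_subset ?_ ?_
  · rintro _ ⟨x, rfl⟩ hx
    exact hi.apply_ne _ (congrArg Subtype.val hx)
  · rintro ⟨z, rfl | ⟨x, hx, rfl⟩⟩ hz
    · exact (hz rfl).elim
    · exact ⟨(⟨x, hx⟩ : S), rfl⟩

theorem Amalgam.isOnePoint_inr_of_ne (B : Amalgam i₀ k) (h₀ : IsOnePoint i₀ a₀)
    (hB : ∀ x, B.inr x ≠ B.inl a₀) : IsOnePoint B.inr (B.inl a₀) := by
  refine Set.eq_of_subset_of_subset ?_ ?_
  · rintro _ ⟨x, rfl⟩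
    exact hB x
  · intro z hz
    rcases Set.eq_univ_iff_forall.1 B.cover z with ⟨y, rfl⟩ | h
    · obtain ⟨x, rfl⟩ := h₀.exists_eq (fun h => hz (h ▸ rfl) : y ≠ a₀)
      exact ⟨k x, (DFunLike.congr_fun B.comm x).symm⟩
    · exact h

/-- A split of an amalgamation restricts to a cluster of `i₀`. -/
theorem Amalgam.isCluster_of_isSplit (B : Amalgam i₀ k) (h₀ : IsOnePoint i₀ a₀) {A : Set B.Z.1}
    (hA : IsSplit (quartetRel B.Z.1) A) (ha : B.inl a₀ ∉ A) {x : X₀.1} (hx : B.inr (k x) ∈ A) :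
    IsCluster i₀ (k ⁻¹' (B.inr ⁻¹' A)) := by
  have hc : ∀ x, B.inl (i₀ x) = B.inr (k x) := DFunLike.congr_fun B.comm
  have h1 := (hA.trace (quartetRel_embedding B.inl) B.inl.injective).isSplit (x := i₀ x) (y := a₀)
    (by rw [Set.mem_preimage, hc]; exact hx) ha
  rw [← h₀.isCluster_preimage ha] at h1
  convert h1 using 1
  ext y
  simp only [Set.mem_preimage, hc]

/-- A cluster of `i₀` is the restriction of a split of a given amalgamation. -/
theorem Amalgam.exists_isSplit (B : Amalgam i₀ k) (h₀ : IsOnePoint i₀ a₀) {C : Set X₀.1}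
    (hC : IsCluster i₀ C) : ∃ A, IsSplit (quartetRel B.Z.1) A ∧ B.inl a₀ ∉ A ∧
      k ⁻¹' (B.inr ⁻¹' A) = C := by
  have hc : ∀ x, B.inl (i₀ x) = B.inr (k x) := DFunLike.congr_fun B.comm
  have := finite_of_mem Y₀
  obtain ⟨A, hA, hAC⟩ := IsSplit.exists_trace (quartetRel_embedding B.inl) B.inl.injective
    (treelike_of_mem B.Z) hC
  refine ⟨A, hA, fun h => h₀.notMem_image C (hAC ▸ h), ?_⟩
  ext x
  rw [Set.mem_preimage, Set.mem_preimage, ← hc, ← i₀.injective.mem_set_image, ← hAC]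
  rfl

theorem Amalgam.isCluster_preimage (B : Amalgam i₀ k) (h₀ : IsOnePoint i₀ a₀)
    (hB : IsOnePoint B.inr (B.inl a₀)) {C : Set X.1} (hC : IsCluster B.inr C) {x : X₀.1}
    (hx : k x ∈ C) : IsCluster i₀ (k ⁻¹' C) := by
  have := B.isCluster_of_isSplit h₀ hC (hB.notMem_image C) (Set.mem_image_of_mem _ hx)
  rwa [Set.preimage_image_eq _ B.inr.injective] at this

theorem Amalgam.exists_isCluster (B : Amalgam i₀ k) (h₀ : IsOnePoint i₀ a₀)
    (hB : IsOnePoint B.inr (B.inl a₀)) {C : Set X₀.1} (hC : IsCluster i₀ C) :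
    ∃ C', IsCluster B.inr C' ∧ k ⁻¹' C' = C := by
  obtain ⟨A, h1, h2, h3⟩ := B.exists_isSplit h₀ hC
  exact ⟨B.inr ⁻¹' A, (hB.isCluster_preimage h2).2 h1, h3⟩

variable {R : Type} [CommRing R]

/-- If every amalgamation of `i₀` and `k` has the same clusters as `i`, then `i` is the only one,
and hence has the same measure as `i₀`. -/
theorem FraisseMeasure.toFun_eq_of_isCluster_iff (μ : FraisseMeasure treeClass R)
    (hi : IsOnePoint i a) (h₀ : IsOnePoint i₀ a₀) {h : Y₀.1 ↪[treeLang] Y.1}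
    (hc : h.comp i₀ = i.comp k) (ha : h a₀ = a)
    (H : ∀ B : Amalgam i₀ k, (∀ x, B.inr x ≠ B.inl a₀) ∧
      (IsOnePoint B.inr (B.inl a₀) → ∀ C, IsCluster i C ↔ IsCluster B.inr C)) :
    μ.toFun i = μ.toFun i₀ := by
  have := μ.map_amalgam i₀ k 1 (fun _ => squareAmalgam hi h hc ha) fun B => ?_
  · rw [this, Fin.sum_univ_one]
    rfl
  · obtain ⟨h1, h2⟩ := H B
    have hB := B.isOnePoint_inr_of_ne h₀ h1
    obtain ⟨e, he1, he2⟩ := hi.exists_equiv hB (h2 hB)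
    refine ⟨0, ⟨e, ?_, ?_⟩, fun _ _ => Subsingleton.elim _ _⟩
    · ext y
      change e (h y) = B.inl y
      by_cases hy : y = a₀
      · rw [hy, ha, he2]
      · obtain ⟨x, rfl⟩ := h₀.exists_eq hy
        exact (congrArg e (DFunLike.congr_fun hc x)).trans
          ((he1 (k x)).trans (DFunLike.congr_fun B.comm x).symm)
    · ext x
      exact he1 x

/-- If the branches of `i` are clusters of `j`, then so are all clusters of `i`. -/
theorem IsOnePoint.isCluster_of_near (hi : IsOnePoint i a) (hj : IsOnePoint j b)
    (h : ∀ s, IsCluster j {s' | Near i s s'}) {C : Set X.1} (hC : IsCluster i C) :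
    IsCluster j C := by
  obtain ⟨s, hs⟩ := hC.nonempty
  by_cases hu : C = Set.univ
  · rw [hu]; exact hj.isCluster_univ ⟨s⟩
  rcases hj.isCluster_or_compl hC hu with h1 | h1
  · exact h1
  have hsub : C ⊆ {s' | Near i s s'} := fun x hx => Or.inr ⟨C, hC, hu, hs, hx⟩
  obtain ⟨y, hy⟩ := (Set.ne_univ_iff_exists_notMem _).1 hu
  rcases hj.laminar (h s) h1 with h2 | h2 | h2
  · exact (h2 (Or.inl rfl) hs).elim
  · have : Nontrivial X.1 := ⟨s, y, fun h => hy (h ▸ hs)⟩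
    refine ((hi.isCluster_near s).2 (Set.eq_univ_iff_forall.2 fun x => ?_)).elim
    by_cases hx : x ∈ C
    exacts [hsub hx, h2 hx]
  · rw [show C = {s' | Near i s s'} from Set.Subset.antisymm hsub
      (Set.disjoint_compl_right_iff_subset.1 h2)]
    exact h s

/-- Extensions with the same branches have the same clusters, if no complement of a branch is a
cluster of the second extension only. -/
theorem IsOnePoint.isCluster_iff_of_near (hi : IsOnePoint i a) (hj : IsOnePoint j b)
    (h : ∀ s, IsCluster j {s' | Near i s s'}) (h' : ∀ s, ¬ IsCluster j {s' | Near i s s'}ᶜ)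
    (C : Set X.1) : IsCluster i C ↔ IsCluster j C := by
  refine ⟨hi.isCluster_of_near hj h, fun hC => ?_⟩
  by_cases hu : C = Set.univ
  · rw [hu]; exact hi.isCluster_univ hC.nonempty.to_type
  rcases hi.isCluster_or_compl hC hu with h1 | h1
  · exact h1
  -- the branch that contains the complement of `C` is equal to it
  obtain ⟨s, hs⟩ := h1.nonempty
  have hu' : Cᶜ ≠ Set.univ := fun h => hC.nonempty.ne_empty (Set.compl_univ_iff.1 h)
  have hsub : Cᶜ ⊆ {s' | Near i s s'} := fun x hx => Or.inr ⟨Cᶜ, h1, hu', hs, hx⟩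
  have h2 := hi.isCluster_of_near hj h h1
  have hne : {s' | Near i s s'} ≠ Set.univ := by
    obtain ⟨y, hy⟩ := hC.nonempty
    have : Nontrivial X.1 := ⟨s, y, fun h => hs (h ▸ hy)⟩
    exact (hi.isCluster_near s).2
  rcases hj.subset_or_subset hC h2 (h s) hne with h3 | h3
  · exact (hs (h3 (Or.inl rfl))).elim
  · refine (h' s ?_).elim
    rw [show {s' | Near i s s'} = Cᶜ from Set.Subset.antisymm h3 hsub, compl_compl]
    exact hC

/-! ### A base with one point in each of three or more branches -/

theorem IsOnePoint.exists_not_near (hi : IsOnePoint i a) [Nontrivial X.1]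
    (h : ∀ C, IsCluster i C → ¬ IsCluster i Cᶜ) (s : X.1) :
    ∃ s' s'', ¬ Near i s s' ∧ ¬ Near i s s'' ∧ ¬ Near i s' s'' := by
  obtain ⟨h1, h2⟩ := hi.isCluster_near s
  obtain ⟨s', hs'⟩ := (Set.ne_univ_iff_exists_notMem _).1 h2
  by_contra! hcon
  refine h _ h1 ?_
  convert (hi.isCluster_near s').1
  ext x
  exact ⟨fun hx => hcon s' x hs' hx, fun hx hx' => hs' (Near.trans hi hx' hx.symm)⟩

section Representatives

variable {h : Y₀.1 ↪[treeLang] Y.1}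

/-- A proper cluster of `i₀` lies in one branch of `i`. -/
theorem near_of_isCluster (hi : IsOnePoint i a) (h₀ : IsOnePoint i₀ a₀)
    (hc : h.comp i₀ = i.comp k) (ha : h a₀ = a) {C : Set X₀.1} (hC : IsCluster i₀ C)
    {x y z : X₀.1} (hx : x ∉ C) (hy : y ∈ C) (hz : z ∈ C) : Near i (k y) (k z) := by
  have hone : IsOnePoint (squareAmalgam hi h hc ha).inr ((squareAmalgam hi h hc ha).inl a₀) := by
    change IsOnePoint i (h a₀)
    rwa [ha]
  obtain ⟨C', h1, rfl⟩ := (squareAmalgam hi h hc ha).exists_isCluster h₀ hone hC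
  exact Or.inr ⟨C', h1, fun hu => hx (by rw [hu]; trivial), hy, hz⟩

/-- A one-point extension with at least three branches has the same measure as its restriction to a
set of points that meets all branches. -/
theorem FraisseMeasure.toFun_eq_of_representatives (μ : FraisseMeasure treeClass R)
    (hi : IsOnePoint i a) (h₀ : IsOnePoint i₀ a₀) (hc : h.comp i₀ = i.comp k) (ha : h a₀ = a)
    [Nontrivial X.1] (h3 : ∀ C, IsCluster i C → ¬ IsCluster i Cᶜ)
    (hk : ∀ s, ∃ x, Near i s (k x)) : μ.toFun i = μ.toFun i₀ := by
  -- no proper cluster of `i₀` contains the representatives of two branches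
  have key : ∀ (s : X.1) (C : Set X₀.1), IsCluster i₀ C → (∀ x, Near i s (k x) → x ∉ C) →
      ¬ ∀ x, ¬ Near i s (k x) → x ∈ C := by
    intro s C hC h1 h2
    obtain ⟨s', s'', g1, g2, g3⟩ := hi.exists_not_near h3 s
    obtain ⟨x, hx⟩ := hk s
    obtain ⟨x', hx'⟩ := hk s'
    obtain ⟨x'', hx''⟩ := hk s''
    have h4 := near_of_isCluster hi h₀ hc ha hC (h1 x hx)
      (h2 x' fun h => g1 (h.trans hi hx'.symm)) (h2 x'' fun h => g2 (h.trans hi hx''.symm))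
    exact g3 ((hx'.trans hi h4).trans hi hx''.symm)
  have hex : ∀ s, ∃ x, ¬ Near i s (k x) := by
    intro s
    obtain ⟨s', -, g1, -⟩ := hi.exists_not_near h3 s
    obtain ⟨x', hx'⟩ := hk s'
    exact ⟨x', fun h => g1 (h.trans hi hx'.symm)⟩
  refine μ.toFun_eq_of_isCluster_iff hi h₀ hc ha fun B => ⟨fun s hs => ?_, fun hB => ?_⟩
  -- if `a` were identified with `s`, then the complement of the branch of `s` would be a cluster
  · have hA : IsSplit (quartetRel X.1) {s' | Near i s s'} := by
      obtain ⟨g1, g2⟩ := hi.isCluster_near s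
      obtain ⟨y, hy⟩ := (Set.ne_univ_iff_exists_notMem _).1 g2
      exact (IsOnePoint.weakSplit_of_isCluster g1).isSplit (x := s) (Or.inl rfl) hy
    have := finite_of_mem X
    obtain ⟨A, g1, g2⟩ := hA.exists_trace (quartetRel_embedding B.inr) B.inr.injective
      (treelike_of_mem B.Z)
    have hmem : ∀ x, B.inr x ∈ A ↔ Near i s x := fun x => Set.ext_iff.1 g2 x
    obtain ⟨x, hx⟩ := hex s
    have g3 := B.isCluster_of_isSplit h₀ (A := Aᶜ) (g1.compl (treelike_of_mem B.Z))
      (by rw [← hs, Set.mem_compl_iff, not_not, hmem]; exact Or.inl rfl) (x := x)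
      (by rw [Set.mem_compl_iff, hmem]; exact hx)
    refine key s _ g3 (fun x hx => ?_) (fun x hx => ?_)
    · simpa [hmem] using hx
    · simpa [hmem] using hx
  · have h' : ∀ s, ¬ IsCluster B.inr {s' | Near i s s'}ᶜ := by
      intro s hs
      obtain ⟨x, hx⟩ := hex s
      exact key s _ (B.isCluster_preimage h₀ hB hs (x := x) hx) (fun x hx h => h hx)
        (fun x hx => hx)
    refine hi.isCluster_iff_of_near hB (fun s => ?_) h'
    obtain ⟨g1, g2⟩ := hi.isCluster_near s
    exact (hB.isCluster_or_compl g1 g2).resolve_right (h' s)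

end Representatives

/-! ### A base with one or two points in each of two branches -/

/-- `p` and `q` are points of `D`, and no proper subset of `D` that contains both is a cluster. They
may coincide if `D` is a single point. -/
def IsSpread (i : X.1 ↪[treeLang] Y.1) (D : Set X.1) (p q : X.1) : Prop :=
  p ∈ D ∧ q ∈ D ∧ ∀ C, IsCluster i C → p ∈ C → q ∈ C → C ⊆ D → C = D

theorem IsOnePoint.exists_isSpread (hi : IsOnePoint i a) {D : Set X.1} (hD : D.Nonempty) :
    ∃ p q, IsSpread i D p q := by
  have := finite_of_mem X
  obtain ⟨p, hp⟩ := hD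
  by_cases h1 : D = {p}
  · refine ⟨p, p, hp, hp, fun C _ h _ hC => Set.Subset.antisymm hC ?_⟩
    rw [h1, Set.singleton_subset_iff]
    exact h
  have hfin : {C : Set X.1 | IsCluster i C ∧ C ⊂ D ∧ p ∈ C}.Finite := Set.toFinite _
  obtain ⟨M, hM⟩ := hfin.exists_maximal ⟨{p}, hi.isCluster_singleton p,
    (Set.singleton_subset_iff.2 hp).ssubset_of_ne (Ne.symm h1), rfl⟩
  obtain ⟨g1, g2, g3⟩ := hM.prop
  obtain ⟨q, hq, hqM⟩ := Set.exists_of_ssubset g2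
  refine ⟨p, q, hp, hq, fun C hC hpC hqC hCD => ?_⟩
  by_contra hne
  rcases hi.laminar g1 hC with h | h | h
  · exact hqM (hM.le_of_ge ⟨hC, hCD.ssubset_of_ne hne, hpC⟩ h hqC)
  · exact hqM (h hqC)
  · exact Set.disjoint_left.1 h g3 hpC

section TwoBranches

variable {D : Set X.1} {p p' q : X₀.1}

theorem IsOnePoint.not_subset_compl (hi : IsOnePoint i a) (h1 : IsCluster i D)
    (h2 : IsCluster i Dᶜ) {C : Set X.1} (hC : IsCluster i C) {x y z : X.1} (hx : x ∉ C)
    (hy : y ∈ C) (hyD : y ∈ D) (hz : z ∈ C) : z ∈ D := by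
  rcases hi.subset_or_subset h1 h2 hC (fun h => hx (h ▸ trivial)) with h | h
  exacts [h hz, (h hy hyD).elim]

/-- If a split of `X` has `p` and `p'` on the one side and `q` on the other, then the first side
contains `D`. -/
theorem IsSpread.subset (hi : IsOnePoint i a) (h1 : IsCluster i D) (h2 : IsCluster i Dᶜ)
    {p p' q : X.1} (hp : IsSpread i D p p') (hq : q ∉ D) {C : Set X.1}
    (hC : IsSplit (quartetRel X.1) C) (hpC : p ∈ C) (hpC' : p' ∈ C) (hqC : q ∉ C) :
    D ⊆ C := by
  rcases hi.isCluster_or hC with h | h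
  · refine (hp.2.2 C h hpC hpC' fun z hz => ?_).ge
    exact hi.not_subset_compl h1 h2 h hqC hpC hp.1 hz
  · intro z hz
    by_contra hzC
    exact hq (hi.not_subset_compl h1 h2 h (fun h => h hpC) hzC hz hqC)

/-- In an amalgamation, the new point cannot be identified with a point of the branch `D`. -/
theorem IsSpread.inr_ne (hi : IsOnePoint i a) (h₀ : IsOnePoint i₀ a₀) (h1 : IsCluster i D)
    (h2 : IsCluster i Dᶜ) (hp : IsSpread i D (k p) (k p')) (hq : k q ∉ D)
    (hD : IsCluster i₀ (k ⁻¹' D)) (B : Amalgam i₀ k) {s : X.1} (hs : s ∈ D) :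
    B.inr s ≠ B.inl a₀ := by
  intro hsa
  obtain ⟨A, g1, g2, g3⟩ := B.exists_isSplit h₀ hD
  have hmem : ∀ x, k x ∈ B.inr ⁻¹' A ↔ k x ∈ D := fun x => Set.ext_iff.1 g3 x
  have hqA : k q ∉ B.inr ⁻¹' A := fun h => hq ((hmem q).1 h)
  have hpA := (hmem p).2 hp.1
  have hpA' := (hmem p').2 hp.2.1
  have g4 := (g1.trace (quartetRel_embedding B.inr) B.inr.injective).isSplit hpA hqA
  have : B.inr s ∈ A := hp.subset hi h1 h2 hq g4 hpA hpA' hqA hs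
  exact g2 (hsa ▸ this)

/-- In an amalgamation, the branch `D` is still a cluster. -/
theorem IsSpread.isCluster_inr (hi : IsOnePoint i a) (h₀ : IsOnePoint i₀ a₀) (h1 : IsCluster i D)
    (h2 : IsCluster i Dᶜ) (hp : IsSpread i D (k p) (k p')) (hq : k q ∉ D)
    (hD : IsCluster i₀ (k ⁻¹' D)) (B : Amalgam i₀ k) (hB : IsOnePoint B.inr (B.inl a₀)) :
    IsCluster B.inr D := by
  obtain ⟨C, g1, g2⟩ := B.exists_isCluster h₀ hB hD
  have hmem : ∀ x, k x ∈ C ↔ k x ∈ D := fun x => Set.ext_iff.1 g2 x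
  have hqC : k q ∉ C := fun h => hq ((hmem q).1 h)
  have hpC := (hmem p).2 hp.1
  have hpC' := (hmem p').2 hp.2.1
  have g4 := (IsOnePoint.weakSplit_of_isCluster g1).isSplit hpC hqC
  have hsub : D ⊆ C := hp.subset hi h1 h2 hq g4 hpC hpC' hqC
  rcases hB.isCluster_or_compl h1 (fun h => hq (h ▸ trivial)) with g5 | g5
  · exact g5
  rcases hB.laminar g1 g5 with h | h | h
  · exact (h hpC hp.1).elim
  · exact (hqC (h hq)).elim
  · rwa [show D = C from Set.Subset.antisymm hsub (Set.disjoint_compl_right_iff_subset.1 h)]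

/-- A one-point extension with two branches has the same measure as its restriction to a set of
points that contains a spread pair in each of the branches. -/
theorem FraisseMeasure.toFun_eq_of_isSpread {h : Y₀.1 ↪[treeLang] Y.1}
    (μ : FraisseMeasure treeClass R) (hi : IsOnePoint i a) (h₀ : IsOnePoint i₀ a₀)
    (hc : h.comp i₀ = i.comp k) (ha : h a₀ = a) (h1 : IsCluster i D) (h2 : IsCluster i Dᶜ)
    {q' : X₀.1} (hp : IsSpread i D (k p) (k p')) (hq : IsSpread i Dᶜ (k q) (k q')) :
    μ.toFun i = μ.toFun i₀ ∧ IsCluster i₀ (k ⁻¹' D) ∧ IsCluster i₀ (k ⁻¹' Dᶜ) := by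
  have hone : IsOnePoint (squareAmalgam hi h hc ha).inr ((squareAmalgam hi h hc ha).inl a₀) := by
    change IsOnePoint i (h a₀)
    rwa [ha]
  have hD : IsCluster i₀ (k ⁻¹' D) :=
    (squareAmalgam hi h hc ha).isCluster_preimage h₀ hone h1 hp.1
  have hD' : IsCluster i₀ (k ⁻¹' Dᶜ) :=
    (squareAmalgam hi h hc ha).isCluster_preimage h₀ hone h2 hq.1
  have h2' : IsCluster i Dᶜᶜ := by rwa [compl_compl]
  have hpD : k p ∉ Dᶜ := fun h => h hp.1
  refine ⟨μ.toFun_eq_of_isCluster_iff hi h₀ hc ha fun B => ⟨fun s => ?_, fun hB C => ?_⟩, hD, hD'⟩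
  · by_cases hs : s ∈ D
    · exact hp.inr_ne hi h₀ h1 h2 hq.1 hD B hs
    · exact hq.inr_ne hi h₀ h2 h2' hpD hD' B hs
  · have g1 := hp.isCluster_inr hi h₀ h1 h2 hq.1 hD B hB
    have g2 := hq.isCluster_inr hi h₀ h2 h2' hpD hD' B hB
    exact ⟨fun h => hi.isCluster_of_compl hB h1 h2 g1 g2 h,
      fun h => hB.isCluster_of_compl hi g1 g2 h1 h2 h⟩

end TwoBranches

end Square

/-! ### Recognition of the marked trees -/

section Recognition

variable {S : Type} {R R' : S → S → S → S → Prop}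

/-- Exactly two of the four points lie in `A`. -/
def Bisects (A : Set S) (x₁ x₂ y₁ y₂ : S) : Prop :=
  ((x₁ ∈ A ↔ x₂ ∈ A) ∧ (y₁ ∈ A ↔ y₂ ∈ A) ∧ ¬ (x₁ ∈ A ↔ y₁ ∈ A)) ∨
    (Separates A x₁ x₂ ∧ Separates A y₁ y₂)

theorem Treelike.iff_separates (hR : Treelike R) {A : Set S} (hA : IsSplit R A) {x₁ x₂ y₁ y₂ : S}
    (hn : [x₁, x₂, y₁, y₂].Nodup) (h : Bisects A x₁ x₂ y₁ y₂) :
    R x₁ x₂ y₁ y₂ ↔ Separates A x₁ x₂ := by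
  rcases h with ⟨h1, h2, h3⟩ | ⟨h1, h2⟩
  · refine iff_of_false (fun h => ?_) (fun h => h h1)
    obtain ⟨-, B, hB, h4, h5⟩ := hR.iff.1 h
    have hcompat := IsSplit.compat hR hA hB
    by_cases h6 : x₁ ∈ B ↔ y₁ ∈ B
    · exact hcompat.cross h1 h2 h3 h6 (by unfold Separates at *; tauto) h4
    · exact hcompat.cross h1 h2.symm (by tauto) (by unfold Separates at *; tauto)
        (by unfold Separates at *; tauto) h4
  · exact iff_of_true (hR.iff.2 ⟨hn, A, hA, h1, h2⟩) h1

/-- A treelike relation is determined by splits that bisect all sets of four points. -/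
theorem Treelike.iff_of_bisects (hR : Treelike R) (hR' : Treelike R')
    (h : ∀ x₁ x₂ y₁ y₂, [x₁, x₂, y₁, y₂].Nodup →
      ∃ A, IsSplit R A ∧ IsSplit R' A ∧ Bisects A x₁ x₂ y₁ y₂) (x₁ x₂ y₁ y₂ : S) :
    R x₁ x₂ y₁ y₂ ↔ R' x₁ x₂ y₁ y₂ := by
  by_cases hn : [x₁, x₂, y₁, y₂].Nodup
  · obtain ⟨A, h1, h2, h3⟩ := h _ _ _ _ hn
    rw [hR.iff_separates h1 hn h3, hR'.iff_separates h2 hn h3]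
  · exact iff_of_false (fun h => hn (hR.nodup h)) (fun h => hn (hR'.nodup h))

instance decidableBisects [DecidableEq S] (A : Finset S) (x₁ x₂ y₁ y₂ : S) :
    Decidable (Bisects (A : Set S) x₁ x₂ y₁ y₂) := by
  unfold Bisects Separates
  simp only [Finset.mem_coe]
  infer_instance

theorem iff_of_isSplit_fin_four {R R' : Fin 4 → Fin 4 → Fin 4 → Fin 4 → Prop} (hR : Treelike R)
    (hR' : Treelike R') (h1 : IsSplit R {0, 1}) (h2 : IsSplit R' {0, 1}) (x₁ x₂ y₁ y₂ : Fin 4) :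
    R x₁ x₂ y₁ y₂ ↔ R' x₁ x₂ y₁ y₂ := by
  have key : ∀ x₁ x₂ y₁ y₂ : Fin 4, [x₁, x₂, y₁, y₂].Nodup →
      Bisects (({0, 1} : Finset (Fin 4)) : Set (Fin 4)) x₁ x₂ y₁ y₂ := by
    decide
  rw [Finset.coe_pair] at key
  exact hR.iff_of_bisects hR' (fun x₁ x₂ y₁ y₂ hn => ⟨_, h1, h2, key _ _ _ _ hn⟩) x₁ x₂ y₁ y₂

theorem iff_of_isSplit_fin_five {R R' : Fin 5 → Fin 5 → Fin 5 → Fin 5 → Prop} (hR : Treelike R)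
    (hR' : Treelike R') (h1 : IsSplit R {0, 1}) (h2 : IsSplit R' {0, 1}) (h3 : IsSplit R {2, 3})
    (h4 : IsSplit R' {2, 3}) (x₁ x₂ y₁ y₂ : Fin 5) : R x₁ x₂ y₁ y₂ ↔ R' x₁ x₂ y₁ y₂ := by
  have key : ∀ x₁ x₂ y₁ y₂ : Fin 5, [x₁, x₂, y₁, y₂].Nodup →
      Bisects (({0, 1} : Finset (Fin 5)) : Set (Fin 5)) x₁ x₂ y₁ y₂ ∨
        Bisects (({2, 3} : Finset (Fin 5)) : Set (Fin 5)) x₁ x₂ y₁ y₂ := by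
    decide
  rw [Finset.coe_pair, Finset.coe_pair] at key
  refine hR.iff_of_bisects hR' (fun x₁ x₂ y₁ y₂ hn => ?_) x₁ x₂ y₁ y₂
  rcases key x₁ x₂ y₁ y₂ hn with h | h
  exacts [⟨_, h1, h2, h⟩, ⟨_, h3, h4, h⟩]

theorem isSplit_comap {T : Type} {Q : T → T → T → T → Prop} {f : S → T}
    (hf : Function.Injective f) {A : Set T} (hA : IsSplit Q A) {x y : S} (hx : f x ∈ A)
    (hy : f y ∉ A) : IsSplit (fun a b c d => Q (f a) (f b) (f c) (f d)) (f ⁻¹' A) :=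
  (hA.trace (f := f) (fun _ _ _ _ => Iff.rfl) hf).isSplit hx hy

variable {X Y : treeClass} {f : X.1 ↪[treeLang] Y.1} {a : Y.1}

theorem IsOnePoint.isMarkedExtension (hf : IsOnePoint f a) {V : Type} {G : SimpleGraph V} {g : V}
    (hg : IsLeaf G g) (e : Y.1 ≃ {v : V // IsLeaf G v}) (he : e a = ⟨g, hg⟩)
    (h : ∀ s t u v, quartetRel Y.1 s t u v ↔ leafRel G (e s) (e t) (e u) (e v)) :
    IsMarkedExtension f G g := by
  refine ⟨hg, mkEquiv (Y := leafStructure G) e fun s t u v => (h s t u v).symm, fun v => ?_⟩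
  constructor
  · rintro ⟨x, hx⟩ hv
    have : e (f x) = e a := hx.trans ((Subtype.ext hv : v = ⟨g, hg⟩).trans he.symm)
    exact hf.apply_ne x (e.injective this)
  · intro hv
    obtain ⟨x, hx⟩ := hf.exists_eq (y := e.symm v) fun h => hv <| by
      have : v = ⟨g, hg⟩ := by rw [← he, ← h, e.apply_symm_apply]
      rw [this]
    exact ⟨x, (congrArg e hx).trans (e.apply_symm_apply v)⟩

/-- A marked extension is recognized by a common labelling of the points. -/
theorem IsOnePoint.isMarkedExtension_of_labels (hf : IsOnePoint f a) {V : Type} [Finite V]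
    {G : SimpleGraph V} {T : Type} {φ : T → Y.1} (hφ : Function.Bijective φ)
    {ψ : T → {v : V // IsLeaf G v}} (hψ : Function.Bijective ψ) {l : T} (hl : φ l = a)
    (h : ∀ s t u v, quartetRel Y.1 (φ s) (φ t) (φ u) (φ v) ↔
      leafRel G (ψ s) (ψ t) (ψ u) (ψ v)) :
    IsMarkedExtension f G (ψ l).1 := by
  let e₁ := Equiv.ofBijective φ hφ
  let e₂ := Equiv.ofBijective ψ hψ
  have h1 : ∀ y, φ (e₁.symm y) = y := e₁.apply_symm_apply
  refine hf.isMarkedExtension (ψ l).2 (e₁.symm.trans e₂) ?_ fun s t u v => ?_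
  · have : e₁.symm a = l := by rw [Equiv.symm_apply_eq]; exact hl.symm
    rw [Equiv.trans_apply, this]
    rfl
  · have := h (e₁.symm s) (e₁.symm t) (e₁.symm u) (e₁.symm v)
    rwa [h1, h1, h1, h1] at this

/-! ### Stars -/

/-- If all splits are trivial, then the quaternary relation is empty. -/
theorem not_quartetRel_of_isCluster (hf : IsOnePoint f a)
    (h : ∀ C, IsCluster f C → C.Subsingleton ∨ C = Set.univ) (s t u v : Y.1) :
    ¬ quartetRel Y.1 s t u v := by
  have hY := treelike_of_mem Y
  intro hq
  obtain ⟨hn, A, hA, h1, h2⟩ := hY.iff.1 hq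
  have key : ∀ A, a ∉ A → IsSplit (quartetRel Y.1) A → Separates A s t → Separates A u v →
      False := by
    intro A ha hA h1 h2
    rw [nodup_four] at hn
    obtain ⟨n1, n2, n3, n4, n5, n6⟩ := hn
    rcases h _ ((hf.isCluster_preimage ha).2 hA) with h3 | h3
    · have h4 : A.Subsingleton := by
        rw [← hf.image_preimage ha]
        exact h3.image f
      by_cases hs : s ∈ A <;> by_cases hu : u ∈ A
      · exact n2 (h4 hs hu)
      · exact n3 (h4 hs (by by_contra hv; exact h2 (iff_of_false hu hv)))
      · exact n4 (h4 (by by_contra ht; exact h1 (iff_of_false hs ht)) hu)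
      · exact n5 (h4 (by by_contra ht; exact h1 (iff_of_false hs ht))
          (by by_contra hv; exact h2 (iff_of_false hu hv)))
    · have h4 : ∀ y, y ∉ A ↔ y = a := by
        intro y
        rw [← hf.image_preimage ha, h3, hf.image_univ]
        simp
      by_cases hs : s ∈ A <;> by_cases hu : u ∈ A
      · exact n5 (((h4 t).1 fun ht => h1 (iff_of_true hs ht)).trans
          ((h4 v).1 fun hv => h2 (iff_of_true hu hv)).symm)
      · exact n4 (((h4 t).1 fun ht => h1 (iff_of_true hs ht)).trans ((h4 u).1 hu).symm)
      · exact n3 (((h4 s).1 hs).trans ((h4 v).1 fun hv => h2 (iff_of_true hu hv)).symm)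
      · exact n2 (((h4 s).1 hs).trans ((h4 u).1 hu).symm)
  by_cases ha : a ∈ A
  · exact key Aᶜ (by simpa using ha) (hA.compl hY) (separates_compl.2 h1) (separates_compl.2 h2)
  · exact key A ha hA h1 h2

theorem not_leafRel_starGraph {m : ℕ}
    (s t u v : {v // IsLeaf (SimpleGraph.starGraph (0 : Fin (m + 1))) v}) :
    ¬ leafRel (SimpleGraph.starGraph (0 : Fin (m + 1))) s t u v := by
  have hG := SimpleGraph.isTree_starGraph (0 : Fin (m + 1))
  intro h
  obtain ⟨hn, W, ⟨x, y, hW⟩, h1, h2⟩ := (quartet_iff hG).1 h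
  -- one side of each edge is a single vertex
  have key : ∀ W x, IsCut (SimpleGraph.starGraph (0 : Fin (m + 1))) W x 0 →
      Separates W s.1 t.1 → Separates W u.1 v.1 → False := by
    intro W x hW h1 h2
    have h3 : ∀ z, z ∈ W → z = x := fun z hz =>
      (hW.unique z hz 0 hW.right
        ((starGraph_adj_iff _ _).2 ⟨fun h => hW.right (h ▸ hz), Or.inr rfl⟩)).1
    have h4 : ∀ p q, Separates W p q → p = x ∨ q = x := by
      intro p q hpq
      by_cases hp : p ∈ W
      · exact Or.inl (h3 p hp)
      · exact Or.inr (h3 q (by by_contra hq; exact hpq (iff_of_false hp hq)))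
    obtain ⟨n1, n2, n3, n4, n5, n6⟩ := nodup_four.1 hn
    rcases h4 _ _ h1 with h5 | h5 <;> rcases h4 _ _ h2 with h6 | h6
    exacts [n2 (h5.trans h6.symm), n3 (h5.trans h6.symm), n4 (h5.trans h6.symm),
      n5 (h5.trans h6.symm)]
  rcases ((starGraph_adj_iff _ _).1 hW.adj).2 with rfl | rfl
  · exact key Wᶜ y hW.compl (separates_compl.2 h1) (separates_compl.2 h2)
  · exact key W x hW h1 h2

theorem isMarkedExtension_starGraph (hf : IsOnePoint f a)
    (h : ∀ s t u v, ¬ quartetRel Y.1 s t u v) {m : ℕ} {g : Fin (m + 1)}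
    (hg : IsLeaf (SimpleGraph.starGraph (0 : Fin (m + 1))) g)
    (hc : Nat.card Y.1 = Nat.card {v // IsLeaf (SimpleGraph.starGraph (0 : Fin (m + 1))) v}) :
    IsMarkedExtension f (SimpleGraph.starGraph (0 : Fin (m + 1))) g := by
  classical
  have := finite_of_mem Y
  obtain ⟨e⟩ := Finite.card_eq.1 hc
  refine hf.isMarkedExtension hg (e.trans (Equiv.swap (e a) ⟨g, hg⟩)) ?_ fun s t u v => ?_
  · rw [Equiv.trans_apply, Equiv.swap_apply_left]
  · exact iff_of_false (h _ _ _ _) (not_leafRel_starGraph _ _ _ _)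

theorem card_leaves_starGraph {m : ℕ} (hm : 2 ≤ m) :
    Nat.card {v // IsLeaf (SimpleGraph.starGraph (0 : Fin (m + 1))) v} = m := by
  have : ∀ v, IsLeaf (SimpleGraph.starGraph (0 : Fin (m + 1))) v ↔
      v ∈ ({0}ᶜ : Set (Fin (m + 1))) := by
    intro v
    by_cases hv : v = 0
    · subst hv
      rw [IsLeaf, valence_starGraph_zero]
      simp
      omega
    · rw [IsLeaf, valence_starGraph hv]
      simp [hv]
  simp only [this]
  rw [Nat.card_coe_set_eq, Set.ncard_compl, Set.ncard_singleton, Nat.card_fin, Nat.add_sub_cancel]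

variable {R : Type} [CommRing R] {μ μ' : FraisseMeasure treeClass R} {u v : R}

/-- Measures with the same parameters agree on stars, which are the extensions with empty
quaternary relation. -/
theorem toFun_eq_of_not_quartetRel (hμ : μ.HasParameters u v) (hμ' : μ'.HasParameters u v)
    (hf : IsOnePoint f a) (h : ∀ s t u v, ¬ quartetRel Y.1 s t u v) :
    μ.toFun f = μ'.toFun f := by
  have := finite_of_mem Y
  have hpos : 0 < Nat.card Y.1 := Nat.card_pos_iff.2 ⟨⟨a⟩, inferInstance⟩
  have hlast : ∀ m, 2 ≤ m → IsLeaf (SimpleGraph.starGraph (0 : Fin (m + 1))) (Fin.last m) := by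
    intro m hm
    refine (valence_starGraph fun h => ?_).le
    have := congrArg Fin.val h
    simp at this
    omega
  obtain h1 | h1 | h1 | h1 : Nat.card Y.1 = 1 ∨ Nat.card Y.1 = 2 ∨ Nat.card Y.1 = 3 ∨
      4 ≤ Nat.card Y.1 := by omega
  · have hl : ∀ v, IsLeaf (SimpleGraph.starGraph (0 : Fin 1)) v := fun v => by
      rw [Subsingleton.elim v 0]
      exact (valence_starGraph_zero (m := 0)).trans_le zero_le_one
    have hm : IsMarkedExtension f (SimpleGraph.starGraph (0 : Fin 1)) 0 :=
      isMarkedExtension_starGraph hf h (hl 0) (by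
        rw [h1, Nat.card_congr (Equiv.subtypeUnivEquiv hl), Nat.card_fin])
    rw [hμ.x_one _ _ f hm, hμ'.x_one _ _ f hm]
  · have hl : ∀ v, IsLeaf (SimpleGraph.starGraph (0 : Fin 2)) v := fun v => by
      by_cases hv : v = 0
      · rw [hv]
        exact (valence_starGraph_zero (m := 1)).le
      · exact (valence_starGraph hv).le
    have hm : IsMarkedExtension f (SimpleGraph.starGraph (0 : Fin 2)) 1 :=
      isMarkedExtension_starGraph hf h (hl 1) (by
        rw [h1, Nat.card_congr (Equiv.subtypeUnivEquiv hl), Nat.card_fin])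
    rw [hμ.x_two _ _ f hm, hμ'.x_two _ _ f hm]
  · have hm : IsMarkedExtension f (SimpleGraph.starGraph (0 : Fin 4)) (Fin.last 3) :=
      isMarkedExtension_starGraph hf h (hlast 3 (by norm_num)) (by
        rw [h1, card_leaves_starGraph (by norm_num)])
    rw [hμ.x_three _ _ f hm, hμ'.x_three _ _ f hm]
  · have hm : IsMarkedExtension f (SimpleGraph.starGraph (0 : Fin (Nat.card Y.1 + 1)))
        (Fin.last (Nat.card Y.1)) :=
      isMarkedExtension_starGraph hf h (hlast _ (by omega)) (by
        rw [card_leaves_starGraph (by omega)])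
    rw [hμ.x_ge_four _ h1 _ _ f hm, hμ'.x_ge_four _ h1 _ _ f hm]

/-! ### The trees `Y` and `Z` -/

theorem isSplit_of_isCut {V : Type} [Finite V] {G : SimpleGraph V} (hG : G.IsTree) {W : Set V}
    {x y : V} (hW : IsCut G W x y) : IsSplit (leafRel G) (Subtype.val ⁻¹' W) :=
  (isSplit_leafRel_iff hG).2 ⟨W, ⟨x, y, hW⟩, rfl⟩

/-- The leaves of `treeY`, the marked one last. -/
def leafY : Fin 4 → {v // IsLeaf treeY v} :=
  fun l => ⟨![2, 3, 4, 5] l, (isLeaf_treeY_iff _).2 (by revert l; decide)⟩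

theorem bijective_leafY : Function.Bijective leafY := by
  constructor
  · intro l l' h
    have h' : (![2, 3, 4, 5] : Fin 4 → Fin 6) l = (![2, 3, 4, 5] : Fin 4 → Fin 6) l' :=
      congrArg Subtype.val h
    revert l l' h'
    decide
  · rintro ⟨v, hv⟩
    have h : ∃ l, (![2, 3, 4, 5] : Fin 4 → Fin 6) l = v := by
      rw [isLeaf_treeY_iff] at hv
      revert v
      decide
    obtain ⟨l, hl⟩ := h
    exact ⟨l, Subtype.ext hl⟩

/-- The leaves of `treeZ`, the marked one last. -/
def leafZ : Fin 5 → {v // IsLeaf treeZ v} :=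
  fun l => ⟨![3, 4, 6, 7, 5] l, (isLeaf_treeZ_iff _).2 (by revert l; decide)⟩

theorem bijective_leafZ : Function.Bijective leafZ := by
  constructor
  · intro l l' h
    have h' : (![3, 4, 6, 7, 5] : Fin 5 → Fin 8) l = (![3, 4, 6, 7, 5] : Fin 5 → Fin 8) l' :=
      congrArg Subtype.val h
    revert l l' h'
    decide
  · rintro ⟨v, hv⟩
    have h : ∃ l, (![3, 4, 6, 7, 5] : Fin 5 → Fin 8) l = v := by
      rw [isLeaf_treeZ_iff] at hv
      revert v
      decide
    obtain ⟨l, hl⟩ := h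
    exact ⟨l, Subtype.ext hl⟩

theorem isCut_treeY : IsCut treeY (↑({0, 2, 3} : Finset (Fin 6))) 0 1 := by
  refine ⟨by decide, by decide, by decide, ?_⟩
  simp only [Finset.mem_coe]
  decide

theorem isCut_treeZ_left : IsCut treeZ (↑({0, 3, 4} : Finset (Fin 8))) 0 1 := by
  refine ⟨by decide, by decide, by decide, ?_⟩
  simp only [Finset.mem_coe]
  decide

theorem isCut_treeZ_right : IsCut treeZ (↑({2, 6, 7} : Finset (Fin 8))) 2 1 := by
  refine ⟨by decide, by decide, by decide, ?_⟩
  simp only [Finset.mem_coe]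
  decide

theorem isMarkedExtension_treeY (hf : IsOnePoint f a) {p p' q : X.1} (hpp : p ≠ p') (hpq : p ≠ q)
    (hpq' : p' ≠ q) (hX : ∀ x, x = p ∨ x = p' ∨ x = q) (h : IsCluster f {p, p'}) :
    IsMarkedExtension f treeY 5 := by
  let φ : Fin 4 → Y.1 := ![f p, f p', f q, a]
  have hne := hf.apply_ne
  have hφ : Function.Bijective φ := by
    constructor
    · intro l l' hl
      fin_cases l <;> fin_cases l' <;>
        simp [φ, hne, (hne _).symm, hpp, hpq, hpq', hpp.symm, hpq.symm, hpq'.symm] at hl ⊢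
    · intro y
      by_cases hy : y = a
      · exact ⟨3, hy.symm⟩
      · obtain ⟨x, rfl⟩ := hf.exists_eq hy
        rcases hX x with rfl | rfl | rfl
        exacts [⟨0, rfl⟩, ⟨1, rfl⟩, ⟨2, rfl⟩]
  have t1 : φ ⁻¹' (f '' {p, p'}) = {0, 1} := by
    ext l
    fin_cases l <;> simp [φ, hne, hpq.symm, hpq'.symm]
  have t2 : leafY ⁻¹' (Subtype.val ⁻¹' (↑({0, 2, 3} : Finset (Fin 6)))) = {0, 1} := by
    ext l
    fin_cases l <;> simp [leafY]
  have s1 := isSplit_comap hφ.1 h (x := 0) (y := 3) (Set.mem_image_of_mem f (Or.inl rfl))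
    (hf.notMem_image _)
  have s2 := isSplit_comap bijective_leafY.1 (isSplit_of_isCut isTree_treeY isCut_treeY)
    (x := 0) (y := 3) (by simp [leafY]) (by simp [leafY])
  rw [t1] at s1
  rw [t2] at s2
  exact hf.isMarkedExtension_of_labels hφ bijective_leafY (l := 3) rfl
    (iff_of_isSplit_fin_four
      ((treelike_of_mem Y).comap (fun _ _ _ _ => Iff.rfl) hφ.1)
      ((treelike_leafRel isTree_treeY).comap (fun _ _ _ _ => Iff.rfl) bijective_leafY.1) s1 s2)

theorem isMarkedExtension_treeZ (hf : IsOnePoint f a) {p p' q q' : X.1} (hpp : p ≠ p')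
    (hqq : q ≠ q') (hX : ∀ x, x = p ∨ x = p' ∨ x = q ∨ x = q') (h : IsCluster f {p, p'})
    (h' : IsCluster f {q, q'}) (hd : Disjoint ({p, p'} : Set X.1) {q, q'}) :
    IsMarkedExtension f treeZ 5 := by
  let φ : Fin 5 → Y.1 := ![f p, f p', f q, f q', a]
  have hne := hf.apply_ne
  have hpq : p ≠ q := fun h => Set.disjoint_left.1 hd (Or.inl rfl) (Or.inl h)
  have hpq' : p ≠ q' := fun h => Set.disjoint_left.1 hd (Or.inl rfl) (Or.inr h)
  have hp'q : p' ≠ q := fun h => Set.disjoint_left.1 hd (Or.inr rfl) (Or.inl h)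
  have hp'q' : p' ≠ q' := fun h => Set.disjoint_left.1 hd (Or.inr rfl) (Or.inr h)
  have hφ : Function.Bijective φ := by
    constructor
    · intro l l' hl
      fin_cases l <;> fin_cases l' <;>
        simp [φ, hne, (hne _).symm, hpp, hqq, hpq, hpq', hp'q, hp'q', hpp.symm, hqq.symm, hpq.symm,
          hpq'.symm, hp'q.symm, hp'q'.symm] at hl ⊢
    · intro y
      by_cases hy : y = a
      · exact ⟨4, hy.symm⟩
      · obtain ⟨x, rfl⟩ := hf.exists_eq hy
        rcases hX x with rfl | rfl | rfl | rfl
        exacts [⟨0, rfl⟩, ⟨1, rfl⟩, ⟨2, rfl⟩, ⟨3, rfl⟩]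
  have t1 : φ ⁻¹' (f '' {p, p'}) = {0, 1} := by
    ext l
    fin_cases l <;> simp [φ, hne, hpq.symm, hpq'.symm, hp'q.symm, hp'q'.symm]
  have t2 : leafZ ⁻¹' (Subtype.val ⁻¹' (↑({0, 3, 4} : Finset (Fin 8)))) = {0, 1} := by
    ext l
    fin_cases l <;> simp [leafZ]
  have t3 : φ ⁻¹' (f '' {q, q'}) = {2, 3} := by
    ext l
    fin_cases l <;> simp [φ, hne, hpq, hpq', hp'q, hp'q']
  have t4 : leafZ ⁻¹' (Subtype.val ⁻¹' (↑({2, 6, 7} : Finset (Fin 8)))) = {2, 3} := by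
    ext l
    fin_cases l <;> simp [leafZ]
  have s1 := isSplit_comap hφ.1 h (x := 0) (y := 4) (Set.mem_image_of_mem f (Or.inl rfl))
    (hf.notMem_image _)
  have s2 := isSplit_comap bijective_leafZ.1 (isSplit_of_isCut isTree_treeZ isCut_treeZ_left)
    (x := 0) (y := 4) (by simp [leafZ]) (by simp [leafZ])
  have s3 := isSplit_comap hφ.1 h' (x := 2) (y := 4) (Set.mem_image_of_mem f (Or.inl rfl))
    (hf.notMem_image _)
  have s4 := isSplit_comap bijective_leafZ.1 (isSplit_of_isCut isTree_treeZ isCut_treeZ_right)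
    (x := 2) (y := 4) (by simp [leafZ]) (by simp [leafZ])
  rw [t1] at s1
  rw [t2] at s2
  rw [t3] at s3
  rw [t4] at s4
  exact hf.isMarkedExtension_of_labels hφ bijective_leafZ (l := 4) rfl
    (iff_of_isSplit_fin_five
      ((treelike_of_mem Y).comap (fun _ _ _ _ => Iff.rfl) hφ.1)
      ((treelike_leafRel isTree_treeZ).comap (fun _ _ _ _ => Iff.rfl) bijective_leafZ.1)
      s1 s2 s3 s4)

/-! ### Uniqueness -/

theorem toFun_eq_of_card_le_two (hμ : μ.HasParameters u v) (hμ' : μ'.HasParameters u v)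
    (hf : IsOnePoint f a) {p q : X.1} (hX : ∀ x, x = p ∨ x = q) : μ.toFun f = μ'.toFun f := by
  refine toFun_eq_of_not_quartetRel hμ hμ' hf (not_quartetRel_of_isCluster hf fun C _ => ?_)
  by_cases hC : p ∈ C ∧ q ∈ C
  · right
    rw [Set.eq_univ_iff_forall]
    intro x
    rcases hX x with rfl | rfl
    exacts [hC.1, hC.2]
  · left
    intro x hx y hy
    rcases hX x with rfl | rfl <;> rcases hX y with rfl | rfl
    exacts [rfl, (hC ⟨hx, hy⟩).elim, (hC ⟨hy, hx⟩).elim, rfl]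

/-- Measures with the same parameters agree on extensions with two branches. Depending on how many
of the two branches are single points, the restriction to spread pairs is the marked tree `X_3`,
`Y` or `Z`. -/
theorem toFun_eq_of_compl (hμ : μ.HasParameters u v) (hμ' : μ'.HasParameters u v)
    (hf : IsOnePoint f a) {D : Set X.1} (h1 : IsCluster f D) (h2 : IsCluster f Dᶜ) :
    μ.toFun f = μ'.toFun f := by
  obtain ⟨p, p', hp⟩ := hf.exists_isSpread h1.nonempty
  obtain ⟨q, q', hq⟩ := hf.exists_isSpread h2.nonempty
  obtain ⟨X₀, Y₀, i₀, a₀, k, h, h₀, hc, ha, hk⟩ := exists_squareAmalgam hf {p, p', q, q'}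
  have hmem : ∀ s ∈ ({p, p', q, q'} : Set X.1), ∃ x, k x = s := fun s hs => by
    rw [← hk] at hs
    exact hs
  obtain ⟨P, rfl⟩ := hmem p (by simp)
  obtain ⟨P', rfl⟩ := hmem p' (by simp)
  obtain ⟨Q, rfl⟩ := hmem q (by simp)
  obtain ⟨Q', rfl⟩ := hmem q' (by simp)
  have hX : ∀ x, x = P ∨ x = P' ∨ x = Q ∨ x = Q' := by
    intro x
    have : k x ∈ ({k P, k P', k Q, k Q'} : Set X.1) := hk ▸ Set.mem_range_self x
    simpa using this
  obtain ⟨e, hD, hD'⟩ := μ.toFun_eq_of_isSpread hf h₀ hc ha h1 h2 hp hq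
  rw [e, (μ'.toFun_eq_of_isSpread hf h₀ hc ha h1 h2 hp hq).1]
  have hPD : k P ∈ D := hp.1
  have hPD' : k P' ∈ D := hp.2.1
  have hQD : k Q ∉ D := hq.1
  have hQD' : k Q' ∉ D := hq.2.1
  have e1 : k ⁻¹' D = {P, P'} := by
    ext x
    constructor
    · intro hx
      rcases hX x with rfl | rfl | rfl | rfl
      exacts [Or.inl rfl, Or.inr rfl, (hQD hx).elim, (hQD' hx).elim]
    · rintro (rfl | rfl)
      exacts [hPD, hPD']
  have e2 : k ⁻¹' Dᶜ = {Q, Q'} := by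
    ext x
    constructor
    · intro hx
      rcases hX x with rfl | rfl | rfl | rfl
      exacts [(hx hPD).elim, (hx hPD').elim, Or.inl rfl, Or.inr rfl]
    · rintro (rfl | rfl)
      exacts [hQD, hQD']
  have hd : Disjoint ({P, P'} : Set X₀.1) {Q, Q'} := by
    rw [← e1, ← e2]
    exact (disjoint_compl_right (a := D)).preimage k
  rw [e1] at hD
  rw [e2] at hD'
  have hPQ : P ≠ Q := fun h => Set.disjoint_left.1 hd (Or.inl rfl) (Or.inl h)
  have hP'Q : P' ≠ Q := fun h => Set.disjoint_left.1 hd (Or.inr rfl) (Or.inl h)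
  have hPQ' : P ≠ Q' := fun h => Set.disjoint_left.1 hd (Or.inl rfl) (Or.inr h)
  by_cases hP : P = P' <;> by_cases hQ : Q = Q'
  · subst hP hQ
    exact toFun_eq_of_card_le_two hμ hμ' h₀ (p := P) (q := Q) (by simpa using hX)
  · subst hP
    have hm := isMarkedExtension_treeY h₀ hQ hPQ.symm hPQ'.symm
      (fun x => by have := hX x; tauto) hD'
    rw [hμ.y _ _ _ hm, hμ'.y _ _ _ hm]
  · subst hQ
    have hm := isMarkedExtension_treeY h₀ hP hPQ hP'Q (fun x => by have := hX x; tauto) hD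
    rw [hμ.y _ _ _ hm, hμ'.y _ _ _ hm]
  · have hm := isMarkedExtension_treeZ h₀ hP hQ hX hD hD' hd
    rw [hμ.z _ _ _ hm, hμ'.z _ _ _ hm]

/-- Measures with the same parameters agree on extensions with at least three branches, since the
restriction to a set of representatives of the branches is a star. -/
theorem toFun_eq_of_forall_not_compl (hμ : μ.HasParameters u v) (hμ' : μ'.HasParameters u v)
    (hf : IsOnePoint f a) [Nontrivial X.1] (h3 : ∀ C, IsCluster f C → ¬ IsCluster f Cᶜ) :
    μ.toFun f = μ'.toFun f := by
  obtain ⟨T, g, hg, hgg, -⟩ := hf.exists_branch_map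
  obtain ⟨X₀, Y₀, i₀, a₀, k, h, h₀, hc, ha, hk⟩ :=
    exists_squareAmalgam hf (Set.range (Function.surjInv hg))
  have hrep : ∀ s, ∃ x, Near f s (k x) := by
    intro s
    have : Function.surjInv hg (g s) ∈ Set.range k := hk ▸ Set.mem_range_self _
    obtain ⟨x, hx⟩ := this
    exact ⟨x, by rw [hx, ← hgg, Function.surjInv_eq hg]⟩
  rw [μ.toFun_eq_of_representatives hf h₀ hc ha h3 hrep,
    μ'.toFun_eq_of_representatives hf h₀ hc ha h3 hrep]
  refine toFun_eq_of_not_quartetRel hμ hμ' h₀ (not_quartetRel_of_isCluster h₀ fun C hC => ?_)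
  by_cases hu : C = Set.univ
  · exact Or.inr hu
  obtain ⟨x, hx⟩ := (Set.ne_univ_iff_exists_notMem _).1 hu
  refine Or.inl fun y hy z hz => k.injective ?_
  have h4 := (hgg _ _).2 (near_of_isCluster hf h₀ hc ha hC hx hy hz)
  have h5 : ∀ x, ∃ t, Function.surjInv hg t = k x := fun x => by
    have : k x ∈ Set.range (Function.surjInv hg) := hk ▸ Set.mem_range_self x
    exact this
  obtain ⟨t, ht⟩ := h5 y
  obtain ⟨t', ht'⟩ := h5 z
  rw [← ht, ← ht', Function.surjInv_eq hg, Function.surjInv_eq hg] at h4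
  rw [← ht, ← ht', h4]

/-- Measures with the same parameters agree on one-point extensions. -/
theorem toFun_eq_of_isOnePoint (hμ : μ.HasParameters u v) (hμ' : μ'.HasParameters u v)
    (hf : IsOnePoint f a) : μ.toFun f = μ'.toFun f := by
  rcases isEmpty_or_nonempty X.1 with hX | ⟨⟨p⟩⟩
  · exact toFun_eq_of_not_quartetRel hμ hμ' hf
      (not_quartetRel_of_isCluster hf fun C _ => Or.inl fun x => hX.elim x)
  rcases subsingleton_or_nontrivial X.1 with hX | hX
  · exact toFun_eq_of_card_le_two hμ hμ' hf (p := p) (q := p)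
      fun x => Or.inl (Subsingleton.elim _ _)
  by_cases hC : ∃ C, IsCluster f C ∧ IsCluster f Cᶜ
  · obtain ⟨C, h1, h2⟩ := hC
    exact toFun_eq_of_compl hμ hμ' hf h1 h2
  · push Not at hC
    exact toFun_eq_of_forall_not_compl hμ hμ' hf hC

/-- A measure is determined by its parameters. -/
theorem eq_of_hasParameters (hμ : μ.HasParameters u v) (hμ' : μ'.HasParameters u v) : μ = μ' := by
  have key : ∀ n, ∀ {X Y : treeClass} (i : X.1 ↪[treeLang] Y.1), codim i = n →
      μ.toFun i = μ'.toFun i := by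
    intro n
    induction n with
    | zero =>
      intro X Y i hi
      let e := equivOfBijective i ⟨i.injective, surjective_of_codim_eq_zero hi⟩
      have he : e.toEmbedding = i := by
        ext x
        rfl
      rw [← he, μ.map_equiv, μ'.map_equiv]
    | succ n ih =>
      intro X Y i hi
      obtain ⟨Y₁, i₁, i₂, a, rfl, h₁, h₂⟩ := exists_factorization i hi
      rw [μ.map_comp, μ'.map_comp, ih i₂ h₂, toFun_eq_of_isOnePoint hμ hμ' h₁]
  ext X Y i
  exact key _ i rfl

end Recognition

theorem proposition3p9 :
    ∃ μ : FraisseMeasure treeClass TauRing,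
      μ.HasParameters (-((tau - 2) * tauSubOneInv)) 0 ∧
      (∀ μ' : FraisseMeasure treeClass TauRing,
        μ'.HasParameters (-((tau - 2) * tauSubOneInv)) 0 → μ' = μ) ∧
      ∀ (V : Type) [Fintype V] (G : SimpleGraph V) (hG : G.IsTree), IsReducedTree G →
        μ.value (treeStructure G hG) =
          (-1) ^ (nodes G).card * tau * tauSubOneInv ^ (leaves G).card *
            ∏ x ∈ nodes G, fallingVariant tau (valence G x) :=
  ⟨primaryMeasure, hasParameters_primaryMeasure,
    fun _ h => eq_of_hasParameters h hasParameters_primaryMeasure,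
    fun _ _ _ hG hred => (primaryMeasure_value hG).trans (treeWeight_of_isReducedTree hred)⟩
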